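/- Fix a finite relational signature $\Sigma$ with symbols of arity at most two, including a binary symbol $\le$. An ordered $\Sigma$-structure is a $\Sigma$-structure $\mathbf S$ in which $\le$ is a total order; all structures here are finite and nonempty, and $|\mathbf S|$ is the number of elements. The atomic type $\mathrm{atp}(a,b)$ of a pair records which atomic formulas in two variables hold at $(a,b)$; the adjacency matrix of $\mathbf S$ is the $\mathbf S\times\mathbf S$ matrix with entry $\mathrm{atp}(a,b)$ at $(a,b)$, with rows and columns ordered by $\le$. For $k,t\ge 1$, a $(k,t)$-mixed minor of a matrix $M$ is a pair of a partition $\mathcal R$ of its rows and a partition $\mathcal C$ of its columns, each into exactly $t$ nonempty intervals, such that for all $R\in\mathcal R$ and $C\in\mathcal C$ the submatrix $M[R\times C]$ has at least $k$ distinct rows or at least $k$ distinct columns. Two nonempty sets $X,Y\subseteq\mathbf S$ are homogeneous if $\mathrm{atp}(x,y)$ is the same for all $x\in X$, $y\in Y$. A partition $\mathcal P$ of $\mathbf S$ has red-degree at most $d$ if for each $X\in\mathcal P$ there are at most $d$ sets $Y\in\mathcal P$, $Y\ne X$, such that $X,Y$ are not homogeneous. A contraction sequence of $\mathbf S$, with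 $n=|\mathbf S|$, is a sequence $\mathcal P_1,\dots,\mathcal P_n$ of partitions of $\mathbf S$ where $\mathcal P_1$ has one part, $\mathcal P_n$ is the partition into singletons, and each $\mathcal P_{i+1}$ arises from $\mathcal P_i$ by splitting one part into two; it has red-degree at most $d$ if all $\mathcal P_i$ do. **Corollary.** There are a constant $c$, a polynomial $p$ and an algorithm (a program for a random access machine whose elementary operations, including addition and truncated subtraction of natural numbers but not multiplication, have unit cost), all depending only on $\Sigma$, such that, given any ordered $\Sigma$-structure $\mathbf S$ and integers $k,t\ge 1$, the algorithm halts within $p(|\mathbf S|)$ steps and outputs one of the following: - a contraction sequence of $\mathbf S$ of red-degree at most $2^{2^{c\cdot kt}}$, or - a $(k,t)$-mixed minor of the adjacency matrix of $\mathbf S$. -/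

import Mathlib

section

open FirstOrder FirstOrder.Language FirstOrder.Language.Structure

/-! ### Adjacency matrices, mixed minors and contraction sequences -/

/-- The atomic types in two variables `x₀, x₁` over `L`: a truth value for each atomic formula
`R(x_{s 0}, …, x_{s (l - 1)})`, where `R` is a relation symbol of arity `l`. -/
abbrev AtomicType (L : Language) : Type _ :=
  (R : Σ l, L.Relations l) → (Fin R.1 → Fin 2) → Prop

/-- The atomic type of the pair `(a, b)`. -/
def atp (L : Language) {α : Type*} [L.Structure α] (a b : α) : AtomicType L :=
  fun R s => RelMap R.2 (![a, b] ∘ s)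

/-- The adjacency matrix: the entry at `(a, b)` is the atomic type of `(a, b)`. -/
def adjacencyMatrix (L : Language) (α : Type*) [L.Structure α] : Matrix α α (AtomicType L) :=
  fun a b => atp L a b

/-- The number of distinct rows of the submatrix `M[X × Y]`. -/
noncomputable def numRows {ι κ A : Type*} (M : Matrix ι κ A) (X : Set ι) (Y : Set κ) : ℕ :=
  ((fun (i : ι) (j : Y) => M i j) '' X).ncard

/-- The number of distinct columns of the submatrix `M[X × Y]`. -/
noncomputable def numCols {ι κ A : Type*} (M : Matrix ι κ A) (X : Set ι) (Y : Set κ) : ℕ :=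
  ((fun (j : κ) (i : X) => M i j) '' Y).ncard

/-- `P` is a partition into convex subsets (intervals). -/
def IsConvexPartition {α : Type*} [LinearOrder α] (P : Set (Set α)) : Prop :=
  Setoid.IsPartition P ∧ ∀ X ∈ P, X.OrdConnected

/-- The pair `(R, C)` is a `(k, t)`-mixed minor of the matrix `M`. -/
structure IsMixedMinor {ι κ A : Type*} [LinearOrder ι] [LinearOrder κ] (M : Matrix ι κ A)
    (k t : ℕ) (R : Set (Set ι)) (C : Set (Set κ)) : Prop where
  convex_rows : IsConvexPartition R
  convex_cols : IsConvexPartition C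
  card_rows : R.ncard = t
  card_cols : C.ncard = t
  mixed : ∀ X ∈ R, ∀ Y ∈ C, k ≤ numRows M X Y ∨ k ≤ numCols M X Y

/-- The types over `Y` of the elements of `X`; the type of `x` over `Y` records the atomic type of
`(x, y)` for every `y ∈ Y`. -/
def typesOver (L : Language) {α : Type*} [L.Structure α] (X Y : Set α) :
    Set (Y → AtomicType L) :=
  (fun (x : α) (y : Y) => atp L x y) '' X

/-- `X` and `Y` are homogeneous. For nonempty `X` and `Y` this says that all entries of the
submatrix of the adjacency matrix with rows `X` and columns `Y` are equal. -/
def Homogeneous (L : Language) {α : Type*} [L.Structure α] (X Y : Set α) : Prop :=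
  (typesOver L X Y).ncard = 1 ∧ (typesOver L Y X).ncard = 1

/-- The partition `P` has red-degree at most `d`. -/
def RedDegreeLE (L : Language) {α : Type*} [L.Structure α] (P : Set (Set α)) (d : ℕ) : Prop :=
  ∀ X ∈ P, {Y ∈ P | Y ≠ X ∧ ¬ Homogeneous L X Y}.ncard ≤ d

/-- `Q` is obtained from `P` by splitting one of the parts of `P` into two. -/
def IsSplitOf {α : Type*} (P Q : Set (Set α)) : Prop :=
  ∃ X ∈ P, ∃ Y Z : Set α, Y.Nonempty ∧ Z.Nonempty ∧ Disjoint Y Z ∧ Y ∪ Z = X ∧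
    Q = (P \ {X}) ∪ {Y, Z}

/-- `P 0, …, P (N - 1)` is a contraction sequence: it starts with the partition with one part,
ends with the partition into singletons, and each step splits one part into two. -/
structure IsContractionSequence {α : Type*} (N : ℕ) (P : ℕ → Set (Set α)) : Prop where
  pos : 0 < N
  isPartition : ∀ i < N, Setoid.IsPartition (P i)
  first : P 0 = {Set.univ}
  last : P (N - 1) = Set.range fun a : α => ({a} : Set α)
  split : ∀ i, i + 1 < N → IsSplitOf (P i) (P (i + 1))

/-! ### Random access machines with unit cost -/

/-- A memory configuration: registers and arrays of natural numbers. A program refers to finitely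
many registers and arrays; array cells are addressed by the contents of registers. -/
structure RamState where
  reg : ℕ → ℕ
  arr : ℕ → ℕ → ℕ

/-- The contents of register `x` are replaced by `v`. -/
def RamState.setReg (s : RamState) (x v : ℕ) : RamState :=
  { s with reg := Function.update s.reg x v }

/-- The contents of cell `i` of array `a` are replaced by `v`. -/
def RamState.setArr (s : RamState) (a i v : ℕ) : RamState :=
  { s with arr := Function.update s.arr a (Function.update (s.arr a) i v) }

/-- Programs. The only arithmetic operations are addition and truncated subtraction, so that the
unit-cost measure is polynomially related to Turing machine time. -/
inductive RamProg where
  | skip : RamProg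
  /-- `x := c` -/
  | const (x c : ℕ) : RamProg
  /-- `x := y + z` -/
  | add (x y z : ℕ) : RamProg
  /-- `x := y - z` (and `x := 0` if `y < z`) -/
  | sub (x y z : ℕ) : RamProg
  /-- `x := a[y]` -/
  | read (x a y : ℕ) : RamProg
  /-- `a[x] := y` -/
  | write (a x y : ℕ) : RamProg
  | seq (p q : RamProg) : RamProg
  /-- if `x ≠ 0` then `p` else `q` -/
  | ite (x : ℕ) (p q : RamProg) : RamProg
  /-- while `x ≠ 0` do `p` -/
  | loop (x : ℕ) (p : RamProg) : RamProg

/-- `RamProg.Runs p s T s'`: started in `s`, the program `p` halts in `s'` after exactly `T` steps.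
Every elementary instruction and every test takes one step. -/
inductive RamProg.Runs : RamProg → RamState → ℕ → RamState → Prop
  | skip (s : RamState) : Runs .skip s 1 s
  | const (s : RamState) (x c : ℕ) : Runs (.const x c) s 1 (s.setReg x c)
  | add (s : RamState) (x y z : ℕ) : Runs (.add x y z) s 1 (s.setReg x (s.reg y + s.reg z))
  | sub (s : RamState) (x y z : ℕ) : Runs (.sub x y z) s 1 (s.setReg x (s.reg y - s.reg z))
  | read (s : RamState) (x a y : ℕ) : Runs (.read x a y) s 1 (s.setReg x (s.arr a (s.reg y)))
  | write (s : RamState) (a x y : ℕ) :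
      Runs (.write a x y) s 1 (s.setArr a (s.reg x) (s.reg y))
  | seq {p q : RamProg} {s s' s'' : RamState} {T T' : ℕ} :
      Runs p s T s' → Runs q s' T' s'' → Runs (.seq p q) s (T + T') s''
  | ite_pos {x : ℕ} {p q : RamProg} {s s' : RamState} {T : ℕ} :
      s.reg x ≠ 0 → Runs p s T s' → Runs (.ite x p q) s (T + 1) s'
  | ite_neg {x : ℕ} {p q : RamProg} {s s' : RamState} {T : ℕ} :
      s.reg x = 0 → Runs q s T s' → Runs (.ite x p q) s (T + 1) s'
  | loop_step {x : ℕ} {p : RamProg} {s s' s'' : RamState} {T T' : ℕ} :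
      s.reg x ≠ 0 → Runs p s T s' → Runs (.loop x p) s' T' s'' →
        Runs (.loop x p) s (T + T' + 1) s''
  | loop_exit {x : ℕ} {p : RamProg} {s : RamState} :
      s.reg x = 0 → Runs (.loop x p) s 1 s

/-! ### Input and output -/

open Classical in
/-- The input. Registers `0, 1, 2` contain the number `n` of elements of the structure, `k` and `t`.
The relation symbol with number `j` is given by its truth table in array `j`: the tuple
`(x₀, …, x_{l - 1})` of element numbers has address `∑ i, x_i * n ^ i`. All other registers and
cells contain `0`. -/
noncomputable def ramInput {L : Language} {m : ℕ} (e : (Σ l, L.Relations l) ≃ Fin m)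
    {α : Type*} [L.Structure α] {n : ℕ} (ν : α ≃ Fin n) (k t : ℕ) : RamState where
  reg x := if x = 0 then n else if x = 1 then k else if x = 2 then t else 0
  arr j i := if ∃ (R : Σ l, L.Relations l) (x : Fin R.1 → α),
    (e R : ℕ) = j ∧ (finFunctionFinEquiv (ν ∘ x) : ℕ) = i ∧ RelMap R.2 x then 1 else 0

/-- The partition of `α` into the sets of elements with equal labels, where the label of the element
with number `i` is in cell `off + i` of the array `A`. -/
def readPartition {α : Type*} {n : ℕ} (ν : α ≃ Fin n) (A : ℕ → ℕ) (off : ℕ) : Set (Set α) :=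
  (Setoid.ker fun a : α => A (off + ν a)).classes

/-- The `i`-th partition of the output sequence; its labels are in cells
`i * n, …, i * n + n - 1` of array `0`. -/
def outSequence {α : Type*} {n : ℕ} (ν : α ≃ Fin n) (s : RamState) (i : ℕ) : Set (Set α) :=
  readPartition ν (s.arr 0) (i * n)

/-- The output pair of a row partition (array `0`) and a column partition (array `1`). -/
def outRows {α : Type*} {n : ℕ} (ν : α ≃ Fin n) (s : RamState) : Set (Set α) :=
  readPartition ν (s.arr 0) 0

/-- See `outRows`. -/
def outCols {α : Type*} {n : ℕ} (ν : α ≃ Fin n) (s : RamState) : Set (Set α) :=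
  readPartition ν (s.arr 1) 0

end

/-! Elements are replaced by their positions in the order and atomic types by numerical codes. A
block of the resulting matrix is mixed if it has at least `k' = 16 ^ m + k` distinct rows or
columns, where `m` is the number of relation symbols. The algorithm keeps one division of the order
into intervals, used for rows and columns alike. It starts with singletons and in each round merges
two consecutive intervals. The invariant is that no interval `I` of the division admits more than `d
= 2 ^ (10 * t + 8)` consecutive disjoint groups of intervals that are each mixed with `I`; the
largest number of such groups is a `chainLength`. For singletons this number is `0`, because `k'`
exceeds the number of codes (`not_mixed_single`).

Call two elements similar if they lie in the same interval and agree on every other interval that is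
not mixed with it. Short chains force few classes: a greedy argument colours the rows of an interval
with `k' ^ (2 * d + 1)` colours so that equally coloured rows are similar
(`IsDivision.exists_coloring`). A class can fail to be homogeneous only to classes in its own
interval and in the at most `d` single intervals mixed with it. Merging two intervals makes
similarity coarser, so every partition between the old and the new similarity classes has red-degree
at most `(d + 1) * (2 * k' ^ (2 * d + 1))` (`IsDivision.card_redLabels_merge_le`). Joining similar
classes one pair at a time, over all rounds, therefore produces a contraction sequence in reverse
order; `redDegree_bound` gives the doubly exponential bound.

It remains to find either a minor or two consecutive intervals whose union still has short chains.
This is a theorem of Marcus–Tardos type (`sum_chainLength_le`, `exists_chainLength_pair_le`). Its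
column divisions are special: the cuts are midpoints of the dyadic intervals around one point `x`,
at the levels given by the binary digits of a number `y`. Every chain of `2 ^ t - 1` intervals is
separated by `t - 1` such cuts (`exists_cutSet`). Since a dyadic interval of length `T` has only `T
* T` pairs `(x, y)`, the pigeonhole principle yields a density bound `2 ^ O(t)`. The same fact makes
the search polynomial: all pairs `(x, y)` are tried, and for fixed cuts the row intervals are found
greedily. The search does not decide whether a minor exists; the absence of a dyadic one already
guarantees a good pair to merge.

For the running time, the algorithm is written in a small language in which every loop runs for `N =
2 * n + 1` rounds, so that a compiled program has a cost polynomial in `N` (`RamExpr.compile_spec`,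
`RamCmd.compile_spec`). Longest chains are computable there because taking the earliest possible end
is optimal (`intervalChain_iff_iterate`). -/

/-! ### Chains of consecutive intervals -/

/-- A property of intervals `[a, b)` of natural numbers that is inherited by larger intervals and
fails for empty ones. -/
structure IntervalPred (P : ℕ → ℕ → Prop) : Prop where
  mono : ∀ {a b a' b'}, a' ≤ a → b ≤ b' → P a b → P a' b'
  lt : ∀ {a b}, P a b → a < b

/-- There are `r` consecutive intervals with property `P` between `lo` and `hi`, the first of which
starts at `lo`. -/
def IntervalChain (P : ℕ → ℕ → Prop) (hi : ℕ) : ℕ → ℕ → Prop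
  | 0, _ => True
  | r + 1, lo => ∃ e ≤ hi, P lo e ∧ IntervalChain P hi r e

namespace IntervalChain

variable {P Q : ℕ → ℕ → Prop}

theorem mono_pred (h : ∀ a b, P a b → Q a b) {hi r lo : ℕ} (hc : IntervalChain P hi r lo) :
    IntervalChain Q hi r lo := by
  induction r generalizing lo with
  | zero => trivial
  | succ r ih => obtain ⟨e, he, h1, h2⟩ := hc; exact ⟨e, he, h _ _ h1, ih h2⟩

theorem mono_lo (hP : IntervalPred P) {hi r lo lo' : ℕ} (hl : lo' ≤ lo)
    (hc : IntervalChain P hi r lo) : IntervalChain P hi r lo' := by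
  cases r with
  | zero => trivial
  | succ r => obtain ⟨e, he, h1, h2⟩ := hc; exact ⟨e, he, hP.mono hl le_rfl h1, h2⟩

theorem mono_hi {hi hi' r lo : ℕ} (hl : hi ≤ hi') (hc : IntervalChain P hi r lo) :
    IntervalChain P hi' r lo := by
  induction r generalizing lo with
  | zero => trivial
  | succ r ih => obtain ⟨e, he, h1, h2⟩ := hc; exact ⟨e, he.trans hl, h1, ih h2⟩

theorem anti_length {hi r r' lo : ℕ} (hr : r' ≤ r) (hc : IntervalChain P hi r lo) :
    IntervalChain P hi r' lo := by
  induction r generalizing lo r' with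
  | zero => obtain rfl : r' = 0 := by omega
            trivial
  | succ r ih =>
    cases r' with
    | zero => trivial
    | succ r' => obtain ⟨e, he, h1, h2⟩ := hc; exact ⟨e, he, h1, ih (by omega) h2⟩

theorem append (hP : IntervalPred P) {lo mid hi r r' : ℕ} (hlo : lo ≤ mid) (hmid : mid ≤ hi)
    (h1 : IntervalChain P mid r lo) (h2 : IntervalChain P hi r' mid) :
    IntervalChain P hi (r + r') lo := by
  induction r generalizing lo with
  | zero => simpa using h2.mono_lo hP hlo
  | succ r ih =>
    obtain ⟨e, he, h3, h4⟩ := h1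
    rw [Nat.add_right_comm]
    exact ⟨e, he.trans hmid, h3, ih he h4⟩

/-- At most one interval of the chain straddles `mid`, and only this one is lost. -/
theorem split (hP : IntervalPred P) {lo mid hi r : ℕ} (h : IntervalChain P hi r lo) :
    ∃ r₁ r₂, IntervalChain P mid r₁ lo ∧ IntervalChain P hi r₂ mid ∧ r ≤ r₁ + r₂ + 1 := by
  induction r generalizing lo with
  | zero => exact ⟨0, 0, trivial, trivial, by omega⟩
  | succ r ih =>
    obtain ⟨e, he, h1, h2⟩ := h
    by_cases hem : e ≤ mid
    · obtain ⟨r₁, r₂, h3, h4, h5⟩ := ih h2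
      exact ⟨r₁ + 1, r₂, ⟨e, hem, h1, h3⟩, h4, by omega⟩
    · exact ⟨0, r, trivial, h2.mono_lo hP (by omega), by omega⟩

theorem length_le (hP : IntervalPred P) {hi r lo : ℕ} (h : IntervalChain P hi r lo) :
    r ≤ hi - lo := by
  induction r generalizing lo with
  | zero => omega
  | succ r ih =>
    obtain ⟨e, he, h1, h2⟩ := h
    have := hP.lt h1
    have := ih h2
    omega

theorem pred (hP : IntervalPred P) {hi r lo : ℕ} (h : IntervalChain P hi r lo) (hr : 0 < r) :
    P lo hi := by
  cases r with
  | zero => omega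
  | succ r => obtain ⟨e, he, h1, -⟩ := h; exact hP.mono le_rfl he h1

theorem one {hi lo : ℕ} (h : P lo hi) : IntervalChain P hi 1 lo :=
  ⟨hi, le_rfl, h, trivial⟩

/-- The selected intervals need not be adjacent: by monotonicity each of them absorbs the gap before
it. -/
theorem of_finset (hP : IntervalPred P) {z : ℕ → ℕ} (hz : Monotone z) (M : ℕ) (S : Finset ℕ)
    (hS : ∀ i ∈ S, i < M ∧ P (z i) (z (i + 1))) : IntervalChain P (z M) S.card (z 0) := by
  induction M generalizing S with
  | zero =>
    have : S = ∅ := Finset.eq_empty_of_forall_notMem fun i hi => by have := (hS i hi).1; omega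
    subst this
    trivial
  | succ M ih =>
    have h1 := ih (S.erase M) fun i hi => by
      have h := hS i (Finset.mem_of_mem_erase hi)
      exact ⟨by have := Finset.ne_of_mem_erase hi; omega, h.2⟩
    by_cases hM : M ∈ S
    · have h2 := h1.append hP (hz (Nat.zero_le M)) (hz (Nat.le_succ M)) (one (hS M hM).2)
      rwa [Finset.card_erase_add_one hM] at h2
    · rw [Finset.erase_eq_of_notMem hM] at h1
      exact h1.mono_hi (hz (Nat.le_succ M))

theorem comap {f : ℕ → ℕ} (hf : Monotone f) {hi r lo : ℕ}
    (h : IntervalChain (fun a b => P (f a) (f b)) hi r lo) : IntervalChain P (f hi) r (f lo) := by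
  induction r generalizing lo with
  | zero => trivial
  | succ r ih => obtain ⟨e, he, h1, h2⟩ := h; exact ⟨f e, hf he, h1, ih h2⟩

end IntervalChain

open Classical in
/-- The length of the longest chain. -/
noncomputable def chainLength (P : ℕ → ℕ → Prop) (lo hi : ℕ) : ℕ :=
  Nat.findGreatest (fun r => IntervalChain P hi r lo) (hi - lo)

/-- Chains can be shortened, and every interval with property `P` contains a point, so the search
bound `hi - lo` in `chainLength` cuts nothing off. -/
theorem intervalChain_iff {P : ℕ → ℕ → Prop} (hP : IntervalPred P) {lo hi r : ℕ} :
    IntervalChain P hi r lo ↔ r ≤ chainLength P lo hi := by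
  classical
  constructor
  · intro h
    exact Nat.le_findGreatest (h.length_le hP) h
  · intro h
    have : IntervalChain P hi (chainLength P lo hi) lo := by
      unfold chainLength
      exact Nat.findGreatest_spec (P := fun r => IntervalChain P hi r lo) (Nat.zero_le _) trivial
    exact this.anti_length h

theorem intervalChain_chainLength {P : ℕ → ℕ → Prop} (hP : IntervalPred P) (lo hi : ℕ) :
    IntervalChain P hi (chainLength P lo hi) lo := (intervalChain_iff hP).2 le_rfl

theorem chainLength_le {P : ℕ → ℕ → Prop} (hP : IntervalPred P) (lo hi : ℕ) :
    chainLength P lo hi ≤ hi - lo := (intervalChain_chainLength hP lo hi).length_le hP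

theorem chainLength_split {P : ℕ → ℕ → Prop} (hP : IntervalPred P) (lo mid hi : ℕ) :
    chainLength P lo hi ≤ chainLength P lo mid + chainLength P mid hi + 1 := by
  obtain ⟨r₁, r₂, h1, h2, h3⟩ := (intervalChain_chainLength hP lo hi).split hP (mid := mid)
  rw [intervalChain_iff hP] at h1 h2
  omega

theorem chainLength_append {P : ℕ → ℕ → Prop} (hP : IntervalPred P) {lo mid hi : ℕ}
    (h1 : lo ≤ mid) (h2 : mid ≤ hi) :
    chainLength P lo mid + chainLength P mid hi ≤ chainLength P lo hi :=
  (intervalChain_iff hP).1 ((intervalChain_chainLength hP lo mid).append hP h1 h2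
    (intervalChain_chainLength hP mid hi))

theorem pred_of_chainLength_pos {P : ℕ → ℕ → Prop} (hP : IntervalPred P) {lo hi : ℕ}
    (h : 0 < chainLength P lo hi) : P lo hi :=
  (intervalChain_chainLength hP lo hi).pred hP h

theorem chainLength_pos {P : ℕ → ℕ → Prop} (hP : IntervalPred P) {lo hi : ℕ}
    (h : P lo hi) : 0 < chainLength P lo hi :=
  (intervalChain_iff hP).1 (IntervalChain.one h)

theorem chainLength_mono_pred {P Q : ℕ → ℕ → Prop} (hP : IntervalPred P) (hQ : IntervalPred Q)
    (h : ∀ a b, P a b → Q a b) (lo hi : ℕ) : chainLength P lo hi ≤ chainLength Q lo hi :=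
  (intervalChain_iff hQ).1 ((intervalChain_chainLength hP lo hi).mono_pred h)

/-! ### Dyadic divisions -/

/-- The midpoint of the dyadic interval of length `2 ^ (i + 1)` that contains `x`. -/
def cutPoint (x i : ℕ) : ℕ := (2 * (x / 2 ^ (i + 1)) + 1) * 2 ^ i

/-- The midpoints of the dyadic intervals around `x` selected by the binary digits of `y`. -/
def cutSet (x y : ℕ) : Finset ℕ := ((Finset.range y).filter fun i => y.testBit i).image (cutPoint x)

theorem mem_cutSet {x y u : ℕ} : u ∈ cutSet x y ↔ ∃ i, y.testBit i ∧ u = cutPoint x i := by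
  simp only [cutSet, Finset.mem_image, Finset.mem_filter, Finset.mem_range]
  constructor
  · rintro ⟨i, ⟨-, h⟩, rfl⟩; exact ⟨i, h, rfl⟩
  · rintro ⟨i, h, rfl⟩
    exact ⟨i, ⟨Nat.lt_two_pow_self.trans_le (Nat.ge_two_pow_of_testBit h), h⟩, rfl⟩

theorem cutPoint_bounds {b i w x : ℕ} (hi : i < b) (hw : 2 ^ b ∣ w) (h1 : w ≤ x)
    (h2 : x < w + 2 ^ b) : w < cutPoint x i ∧ cutPoint x i < w + 2 ^ b := by
  obtain ⟨j, rfl⟩ : ∃ j, b = i + 1 + j := ⟨b - (i + 1), by omega⟩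
  obtain ⟨v, rfl⟩ := hw
  have hp : 0 < 2 ^ i := by positivity
  have e1 : 2 ^ (i + 1 + j) = 2 ^ (i + 1) * 2 ^ j := pow_add _ _ _
  have e2 : 2 ^ (i + 1) = 2 * 2 ^ i := pow_succ' _ _
  have h3 : 2 ^ j * v ≤ x / 2 ^ (i + 1) := by
    rw [Nat.le_div_iff_mul_le (by positivity)]
    calc _ = 2 ^ (i + 1 + j) * v := by rw [e1]; ring
      _ ≤ x := h1
  have h4 : x / 2 ^ (i + 1) < 2 ^ j * v + 2 ^ j := by
    rw [Nat.div_lt_iff_lt_mul (by positivity)]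
    calc x < _ := h2
      _ = _ := by rw [e1]; ring
  unfold cutPoint
  rw [e1, e2] at *
  generalize x / (2 * 2 ^ i) = z at *
  constructor
  · have := Nat.mul_le_mul_right (2 ^ i) h3
    nlinarith
  · have : 2 * z + 2 ≤ 2 * (2 ^ j * v + 2 ^ j) := by omega
    have := Nat.mul_le_mul_right (2 ^ i) this
    nlinarith

/-- The midpoint does not depend on the choice of `x` in the dyadic interval. A cut at a higher
level can thus be added without changing the point `x` found at the lower levels. -/
theorem cutPoint_top {b w x : ℕ} (hw : 2 ^ (b + 1) ∣ w) (h1 : w ≤ x)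
    (h2 : x < w + 2 ^ (b + 1)) : cutPoint x b = w + 2 ^ b := by
  obtain ⟨v, rfl⟩ := hw
  have : x / 2 ^ (b + 1) = v := by
    rw [Nat.div_eq_iff (by positivity)]
    constructor
    · linarith
    · rw [mul_comm v]; omega
  rw [cutPoint, this, pow_succ]; ring

theorem cutSet_zero (x : ℕ) : cutSet x 0 = ∅ := by simp [cutSet]

theorem cutSet_bounds {b w x y u : ℕ} (hy : y < 2 ^ b) (hw : 2 ^ b ∣ w) (h1 : w ≤ x)
    (h2 : x < w + 2 ^ b) (hu : u ∈ cutSet x y) : w < u ∧ u < w + 2 ^ b := by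
  obtain ⟨i, hi, rfl⟩ := mem_cutSet.1 hu
  refine cutPoint_bounds ?_ hw h1 h2
  by_contra h
  have := Nat.ge_two_pow_of_testBit hi
  have : 2 ^ b ≤ 2 ^ i := Nat.pow_le_pow_right (by norm_num) (by omega)
  omega

/-- Since `y < 2 ^ b`, the digit `b` is still free, and setting it records one more cut. -/
theorem cutSet_add {b x y : ℕ} (hy : y < 2 ^ b) :
    cutSet x (2 ^ b + y) = insert (cutPoint x b) (cutSet x y) := by
  ext u
  simp only [Finset.mem_insert, mem_cutSet]
  constructor
  · rintro ⟨i, hi, rfl⟩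
    by_cases h : i = b
    · left; rw [h]
    · right
      refine ⟨i, ?_, rfl⟩
      rcases lt_or_gt_of_ne h with h | h
      · rwa [Nat.testBit_two_pow_add_gt h] at hi
      · have := Nat.ge_two_pow_of_testBit hi
        have : 2 ^ (b + 1) ≤ 2 ^ i := Nat.pow_le_pow_right (by norm_num) (by omega)
        rw [pow_succ] at this
        omega
  · rintro (rfl | ⟨i, hi, rfl⟩)
    · refine ⟨b, ?_, rfl⟩
      rw [Nat.testBit_two_pow_add_eq, Nat.testBit_lt_two_pow hy]; rfl
    · refine ⟨i, ?_, rfl⟩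
      have : i < b := by
        by_contra h
        have := Nat.ge_two_pow_of_testBit hi
        have : 2 ^ b ≤ 2 ^ i := Nat.pow_le_pow_right (by norm_num) (by omega)
        omega
      rwa [Nat.testBit_two_pow_add_gt this]

/-- Scaling by `2 ^ a` shifts all dyadic levels by `a`, so cut systems of a coarsened matrix are cut
systems of the original one. -/
theorem cutSet_mul (x y a : ℕ) :
    cutSet (x * 2 ^ a) (y * 2 ^ a) = (cutSet x y).image (· * 2 ^ a) := by
  have key : ∀ i, cutPoint (x * 2 ^ a) (i + a) = cutPoint x i * 2 ^ a := fun i => by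
    have : x * 2 ^ a / 2 ^ (i + a + 1) = x / 2 ^ (i + 1) := by
      rw [show i + a + 1 = (i + 1) + a by omega, pow_add, Nat.mul_div_mul_right _ _ (by positivity)]
    rw [cutPoint, cutPoint, this, pow_add]; ring
  ext u
  simp only [Finset.mem_image, mem_cutSet]
  constructor
  · rintro ⟨i, hi, rfl⟩
    rw [Nat.testBit_mul_two_pow] at hi
    simp only [Bool.and_eq_true, decide_eq_true_eq] at hi
    refine ⟨_, ⟨i - a, hi.2, rfl⟩, ?_⟩
    rw [← key, Nat.sub_add_cancel hi.1]
  · rintro ⟨_, ⟨i, hi, rfl⟩, rfl⟩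
    refine ⟨i + a, ?_, (key i).symm⟩
    rw [Nat.testBit_mul_two_pow]
    simpa using hi

/-- A long chain around a dyadic interval is separated by few dyadic midpoints. -/
theorem exists_cutSet {P : ℕ → ℕ → Prop} (hP : IntervalPred P) (b : ℕ) :
    ∀ w p q l, 2 ^ b ∣ w → p ≤ w → w + 2 ^ b ≤ q → ¬ P p w → ¬ P (w + 2 ^ b) q → 1 ≤ l →
      IntervalChain P q (2 ^ l - 1) p →
      ∃ x y, w ≤ x ∧ x < w + 2 ^ b ∧ y < 2 ^ b ∧ l ≤ (cutSet x y).card + 1 ∧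
        ∀ u ∈ insert p (insert q (cutSet x y)), ∀ v ∈ insert p (insert q (cutSet x y)),
          u < v → P u v := by
  have hone : ∀ {p q l : ℕ}, 1 ≤ l → IntervalChain P q (2 ^ l - 1) p → P p q :=
    fun {p q l} hl hc => hc.pred hP (by
      have : 2 ^ 1 ≤ 2 ^ l := Nat.pow_le_pow_right (by norm_num) hl
      omega)
  have hbase : ∀ {b w p q : ℕ}, P p q → ∃ x y, w ≤ x ∧ x < w + 2 ^ b ∧ y < 2 ^ b ∧
      1 ≤ (cutSet x y).card + 1 ∧
        ∀ u ∈ insert p (insert q (cutSet x y)), ∀ v ∈ insert p (insert q (cutSet x y)),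
          u < v → P u v := fun {b w p q} h => by
    have := hP.lt h
    refine ⟨w, 0, le_rfl, by simp, by simp, by simp, ?_⟩
    rw [cutSet_zero]
    simp only [Finset.mem_insert, Finset.notMem_empty, or_false]
    rintro u (rfl | rfl) v (rfl | rfl) huv
    · omega
    · exact h
    · omega
    · omega
  induction b with
  | zero =>
    intro w p q l _ hp hq hpw hwq hl hc
    obtain rfl | hl2 : l = 1 ∨ 2 ≤ l := by omega
    · exact hbase (hone le_rfl hc)
    -- The first two intervals of the chain meet at some `e`. If `e ≤ w`, the first lies in `[p,
    -- w)`; otherwise the second lies in `[w + 1, q)`. Both are excluded.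
    · exfalso
      have : 2 ^ 2 ≤ 2 ^ l := Nat.pow_le_pow_right (by norm_num) hl2
      obtain ⟨e, he, h1, e', he', h2, -⟩ := hc.anti_length (r' := 2) (by omega)
      rcases Nat.lt_or_ge w e with h | h
      · exact hwq (hP.mono (by simpa using h) he' h2)
      · exact hpw (hP.mono le_rfl h h1)
  | succ b ih =>
    intro w p q l hw hp hq hpw hwq hl hc
    have hb : 2 ^ (b + 1) = 2 ^ b + 2 ^ b := by rw [pow_succ]; ring
    have hw' : 2 ^ b ∣ w := (pow_dvd_pow 2 (Nat.le_succ b)).trans hw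
    have hm' : 2 ^ b ∣ w + 2 ^ b := (Nat.dvd_add_right hw').2 dvd_rfl
    have e1 : w + 2 ^ b + 2 ^ b = w + 2 ^ (b + 1) := by omega
    -- The midpoint `w + 2 ^ b` becomes a cut only if both sides of it have property `P`. If one
    -- side fails, the other half is searched with the same `p` and `q`.
    by_cases hL : P p (w + 2 ^ b)
    swap
    · obtain ⟨x, y, h1, h2, h3, h4⟩ := ih (w + 2 ^ b) p q l hm' (by omega) (by omega) hL
        (by rwa [e1]) hl hc
      exact ⟨x, y, by omega, by omega, by omega, h4⟩
    by_cases hR : P (w + 2 ^ b) q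
    swap
    · obtain ⟨x, y, h1, h2, h3, h4⟩ := ih w p q l hw' hp (by omega) hpw hR hl hc
      exact ⟨x, y, by omega, by omega, by omega, h4⟩
    obtain rfl | hl2 : l = 1 ∨ 2 ≤ l := by omega
    · exact hbase (hone le_rfl hc)
    obtain ⟨l, rfl⟩ : ∃ l', l = l' + 1 := ⟨l - 1, by omega⟩
    have hl1 : 1 ≤ l := by omega
    have hpl : 2 ^ 1 ≤ 2 ^ l := Nat.pow_le_pow_right (by norm_num) hl1
    have hpl' : 2 ^ (l + 1) = 2 ^ l + 2 ^ l := by rw [pow_succ]; ring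
    -- Cutting loses one interval, so `r₁ + r₂ ≥ 2 * (2 ^ l - 1)` and one side keeps a chain of
    -- length `2 ^ l - 1`. The recursion goes there with the midpoint as a new end; the other side
    -- is needed only as a single piece, by `hL` or `hR`.
    obtain ⟨r₁, r₂, h1, h2, h3⟩ := hc.split hP (mid := w + 2 ^ b)
    rcases Nat.lt_or_ge r₂ (2 ^ l - 1) with hr | hr
    · obtain ⟨x, y, k1, k2, k3, k4, k5⟩ := ih w p (w + 2 ^ b) l hw' hp le_rfl hpw
        (fun h => (hP.lt h).false) hl1 (h1.anti_length (by omega))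
      have hcut : cutPoint x b = w + 2 ^ b := cutPoint_top hw k1 (by omega)
      have hbd := fun u (hu : u ∈ cutSet x y) => cutSet_bounds k3 hw' k1 k2 hu
      refine ⟨x, 2 ^ b + y, k1, by omega, by omega, ?_, ?_⟩
      · rw [cutSet_add k3, Finset.card_insert_of_notMem]
        · omega
        · rw [hcut]; intro h; have := hbd _ h; omega
      · rw [cutSet_add k3, hcut]
        have aux : ∀ u ∈ insert p (insert q (insert (w + 2 ^ b) (cutSet x y))),
            u = q ∨ (u ∈ insert p (insert (w + 2 ^ b) (cutSet x y)) ∧ u ≤ w + 2 ^ b) := by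
          intro u hu
          simp only [Finset.mem_insert] at hu ⊢
          rcases hu with rfl | rfl | rfl | hu
          · right; exact ⟨by simp, by omega⟩
          · left; rfl
          · right; exact ⟨by simp, le_rfl⟩
          · right; exact ⟨by simp [hu], (hbd u hu).2.le⟩
        intro u hu v hv huv
        rcases aux u hu with rfl | ⟨hu1, hu2⟩ <;> rcases aux v hv with rfl | ⟨hv1, hv2⟩
        · omega
        · omega
        · exact hP.mono hu2 le_rfl hR
        · exact k5 u hu1 v hv1 huv
    · obtain ⟨x, y, k1, k2, k3, k4, k5⟩ := ih (w + 2 ^ b) (w + 2 ^ b) q l hm' le_rfl (by omega)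
        (fun h => (hP.lt h).false) (by rwa [e1]) hl1 (h2.anti_length hr)
      have hcut : cutPoint x b = w + 2 ^ b := cutPoint_top hw (by omega) (by omega)
      have hbd := fun u (hu : u ∈ cutSet x y) => cutSet_bounds k3 hm' k1 k2 hu
      refine ⟨x, 2 ^ b + y, by omega, by omega, by omega, ?_, ?_⟩
      · rw [cutSet_add k3, Finset.card_insert_of_notMem]
        · omega
        · rw [hcut]; intro h; have := hbd _ h; omega
      · rw [cutSet_add k3, hcut]
        have aux : ∀ u ∈ insert p (insert q (insert (w + 2 ^ b) (cutSet x y))),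
            u = p ∨ (u ∈ insert (w + 2 ^ b) (insert q (cutSet x y)) ∧ w + 2 ^ b ≤ u) := by
          intro u hu
          simp only [Finset.mem_insert] at hu ⊢
          rcases hu with rfl | rfl | rfl | hu
          · left; rfl
          · right; exact ⟨by simp, by omega⟩
          · right; exact ⟨by simp, le_rfl⟩
          · right; exact ⟨by simp [hu], (hbd u hu).1.le⟩
        intro u hu v hv huv
        rcases aux u hu with rfl | ⟨hu1, hu2⟩ <;> rcases aux v hv with rfl | ⟨hv1, hv2⟩
        · omega
        · exact hP.mono le_rfl hv2 hL
        · omega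
        · exact k5 u hu1 v hv1 huv

/-! ### A density theorem for mixed blocks -/

/-- A property of pairs of intervals `[a, b)`, `[c, d)` that is monotone, symmetric and fails for
empty intervals. -/
structure MixPred (X : ℕ → ℕ → ℕ → ℕ → Prop) : Prop where
  mono : ∀ {a b c d a' b' c' d'}, a' ≤ a → b ≤ b' → c' ≤ c → d ≤ d' → X a b c d → X a' b' c' d'
  symm : ∀ {a b c d}, X a b c d → X c d a b
  lt : ∀ {a b c d}, X a b c d → c < d

namespace MixPred

variable {X : ℕ → ℕ → ℕ → ℕ → Prop}

theorem lt' (hX : MixPred X) {a b c d : ℕ} (h : X a b c d) : a < b := hX.lt (hX.symm h)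

theorem row (hX : MixPred X) (a b : ℕ) : IntervalPred (X a b) where
  mono h1 h2 h := hX.mono le_rfl le_rfl h1 h2 h
  lt h := hX.lt h

theorem comap (hX : MixPred X) {f : ℕ → ℕ} (hf : Monotone f) :
    MixPred fun a b c d => X (f a) (f b) (f c) (f d) where
  mono h1 h2 h3 h4 h := hX.mono (hf h1) (hf h2) (hf h3) (hf h4) h
  symm h := hX.symm h
  lt h := hf.reflect_lt (hX.lt h)

end MixPred

/-- The rows `[lo, hi)` form a mixed block with each of the intervals into which the points of `K`
divide `[0, top)`. -/
def MixedWithAll (X : ℕ → ℕ → ℕ → ℕ → Prop) (K : Finset ℕ) (top lo hi : ℕ) : Prop :=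
  ∀ u ∈ insert 0 (insert top K), ∀ v ∈ insert 0 (insert top K), u < v → X lo hi u v

theorem MixPred.mixedWithAll {X : ℕ → ℕ → ℕ → ℕ → Prop} (hX : MixPred X) (K : Finset ℕ) {top : ℕ}
    (h0 : 0 < top) : IntervalPred (MixedWithAll X K top) where
  mono h1 h2 h u hu v hv huv := hX.mono h1 h2 le_rfl le_rfl (h u hu v hv huv)
  lt h := hX.lt' (h 0 (by simp) top (by simp) h0)

/-- A division of `[0, top)` by dyadic midpoints around some `x` into at least `t` intervals,
together with `t` disjoint intervals of rows that are mixed with all of them. -/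
def DyadicMinor (X : ℕ → ℕ → ℕ → ℕ → Prop) (top t : ℕ) : Prop :=
  ∃ x y, x < top ∧ y < top ∧ t ≤ (cutSet x y).card + 1 ∧ (∀ u ∈ cutSet x y, 0 < u ∧ u < top) ∧
    IntervalChain (MixedWithAll X (cutSet x y) top) top t 0

/-- Lets the absence of a dyadic minor pass to the coarsened matrix in the density induction. -/
theorem DyadicMinor.scale {X : ℕ → ℕ → ℕ → ℕ → Prop} {top t : ℕ} (a : ℕ)
    (h : DyadicMinor (fun p q r s => X (p * 2 ^ a) (q * 2 ^ a) (r * 2 ^ a) (s * 2 ^ a)) top t) :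
    DyadicMinor X (top * 2 ^ a) t := by
  obtain ⟨x, y, hx, hy, hc, hb, hch⟩ := h
  have hp : 0 < 2 ^ a := by positivity
  refine ⟨x * 2 ^ a, y * 2 ^ a, Nat.mul_lt_mul_of_pos_right hx hp,
    Nat.mul_lt_mul_of_pos_right hy hp, ?_, ?_, ?_⟩
  · rwa [cutSet_mul, Finset.card_image_of_injective _ fun u v h => Nat.eq_of_mul_eq_mul_right hp h]
  · rw [cutSet_mul]
    simp only [Finset.mem_image]
    rintro _ ⟨u, hu, rfl⟩
    exact ⟨Nat.mul_pos (hb u hu).1 hp, Nat.mul_lt_mul_of_pos_right (hb u hu).2 hp⟩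
  · have := IntervalChain.comap (P := MixedWithAll X (cutSet (x * 2 ^ a) (y * 2 ^ a)) (top * 2 ^ a))
      (f := fun i => i * 2 ^ a) (fun i j h => Nat.mul_le_mul_right _ h) (hi := top) (r := t)
      (lo := 0) (hch.mono_pred fun lo hi hm => ?_)
    · simpa using this
    · have himg : insert 0 (insert (top * 2 ^ a) (cutSet (x * 2 ^ a) (y * 2 ^ a))) =
          (insert 0 (insert top (cutSet x y))).image (· * 2 ^ a) := by
        rw [cutSet_mul, Finset.image_insert, Finset.image_insert, zero_mul]
      intro u hu v hv huv
      rw [himg, Finset.mem_image] at hu hv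
      obtain ⟨u, hu, rfl⟩ := hu
      obtain ⟨v, hv, rfl⟩ := hv
      exact hm u hu v hv (Nat.lt_of_mul_lt_mul_right huv)

/-- Without a dyadic minor, few disjoint row intervals have long chains inside a fixed dyadic
interval. -/
theorem card_le_of_not_dyadicMinor {X : ℕ → ℕ → ℕ → ℕ → Prop} (hX : MixPred X) {top t a w M : ℕ}
    (ht : 1 ≤ t) (hno : ¬ DyadicMinor X top t) (hw : 2 ^ a ∣ w) (hw' : w + 2 ^ a ≤ top)
    {z : ℕ → ℕ} (hz : Monotone z) (hzM : z M ≤ top) (S : Finset ℕ)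
    (hS : ∀ i ∈ S, i < M ∧ 2 ^ t - 1 ≤ chainLength (X (z i) (z (i + 1))) w (w + 2 ^ a)) :
    S.card ≤ (t - 1) * (2 ^ a * 2 ^ a) := by
  have hp : 0 < 2 ^ a := by positivity
  -- The long chain gives `t - 1` dyadic cuts inside `[w, w + 2 ^ a)`. Extending the outer pieces to
  -- `0` and `top` keeps them mixed.
  have key : ∀ i ∈ S, ∃ xy : ℕ × ℕ, (w ≤ xy.1 ∧ xy.1 < w + 2 ^ a ∧ xy.2 < 2 ^ a) ∧
      t ≤ (cutSet xy.1 xy.2).card + 1 ∧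
      MixedWithAll X (cutSet xy.1 xy.2) top (z i) (z (i + 1)) := by
    intro i hi
    have hP := hX.row (z i) (z (i + 1))
    obtain ⟨x, y, h1, h2, h3, h4, h5⟩ := exists_cutSet hP a w w (w + 2 ^ a) t hw le_rfl le_rfl
      (fun h => (hP.lt h).false) (fun h => (hP.lt h).false) ht ((intervalChain_iff hP).2 (hS i hi).2)
    have hbd := fun u (hu : u ∈ cutSet x y) => cutSet_bounds h3 hw h1 h2 hu
    refine ⟨(x, y), ⟨h1, h2, h3⟩, h4, ?_⟩
    intro u hu v hv huv
    simp only [Finset.mem_insert] at hu hv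
    have hu' : ∃ u' ∈ insert w (insert (w + 2 ^ a) (cutSet x y)), u ≤ u' ∧ (u = u' ∨ u' = w) := by
      rcases hu with rfl | rfl | hu
      · exact ⟨w, by simp, by omega, Or.inr rfl⟩
      · rcases hv with rfl | rfl | hv
        · omega
        · omega
        · have := hbd v hv; omega
      · exact ⟨u, by simp [hu], le_rfl, Or.inl rfl⟩
    have hv' : ∃ v' ∈ insert w (insert (w + 2 ^ a) (cutSet x y)),
        v' ≤ v ∧ ((v = v' ∧ v ∈ cutSet x y) ∨ v' = w + 2 ^ a) := by
      rcases hv with rfl | rfl | hv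
      · omega
      · exact ⟨w + 2 ^ a, by simp, by omega, Or.inr rfl⟩
      · exact ⟨v, by simp [hv], le_rfl, Or.inl ⟨rfl, hv⟩⟩
    obtain ⟨u', hu1, hu2, hu3⟩ := hu'
    obtain ⟨v', hv1, hv2, hv3⟩ := hv'
    refine hP.mono hu2 hv2 (h5 u' hu1 v' hv1 ?_)
    rcases hu3 with rfl | rfl <;> rcases hv3 with ⟨rfl, hv3⟩ | rfl
    · exact huv
    · simp only [Finset.mem_insert] at hu1
      rcases hu1 with rfl | rfl | hu1
      · omega
      · rcases hv with rfl | rfl | hv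
        · omega
        · rcases hu with hu | hu | hu
          · omega
          · omega
          · have := hbd _ hu; omega
        · have := hbd v hv; omega
      · exact (hbd u hu1).2
    · exact (hbd _ hv3).1
    · omega
  choose! f hf using key
  by_contra hcon
  have hmaps : Set.MapsTo f S (Finset.Ico w (w + 2 ^ a) ×ˢ Finset.range (2 ^ a) : Finset _) := by
    intro i hi
    have := (hf i hi).1
    simp only [Finset.coe_product, Set.mem_prod, Finset.mem_coe, Finset.mem_Ico, Finset.mem_range]
    tauto
  -- There are only `2 ^ a * 2 ^ a` pairs `(x, y)`, so `t` of the row intervals share one, and these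
  -- are the rows of a dyadic minor.
  obtain ⟨⟨x, y⟩, hxy, hcard⟩ := Finset.exists_lt_card_fiber_of_mul_lt_card_of_maps_to
    (s := S) (n := t - 1) hmaps (by
      rw [Finset.card_product, Nat.card_Ico, Finset.card_range, Nat.add_sub_cancel_left, mul_comm]
      omega)
  set F := S.filter fun i => f i = (x, y) with hF
  have hFm : ∀ i ∈ F, i ∈ S ∧ f i = (x, y) := fun i hi => by simpa [hF] using hi
  obtain ⟨i₀, hi₀⟩ : F.Nonempty := Finset.card_pos.1 (by omega)
  have h0 := hf i₀ (hFm i₀ hi₀).1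
  rw [(hFm i₀ hi₀).2] at h0
  simp only at h0
  have htop : 0 < top := by omega
  refine hno ⟨x, y, by omega, by omega, h0.2.1, fun u hu => ?_, ?_⟩
  · have := cutSet_bounds h0.1.2.2 hw h0.1.1 h0.1.2.1 hu
    omega
  · have hW := hX.mixedWithAll (cutSet x y) htop
    have := IntervalChain.of_finset hW hz M F fun i hi => by
      obtain ⟨h1, h2⟩ := hFm i hi
      have h3 := (hf i h1).2.2
      rw [h2] at h3
      exact ⟨(hS i h1).1, h3⟩
    exact ((this.mono_lo hW (Nat.zero_le _)).mono_hi hzM).anti_length (by omega)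

open Classical in
/-- Replacing columns by groups of `T` columns shortens chains by a bounded factor, except for the
groups that contain long chains themselves. -/
theorem chainLength_le_coarsen {P : ℕ → ℕ → Prop} (hP : IntervalPred P) {T s : ℕ} (hs : 1 ≤ s)
    (M : ℕ) : ∀ n lo, M - lo = n → lo ≤ M → chainLength P (lo * T) (M * T) ≤
      (s + 1) * chainLength (fun c d => P (c * T) (d * T)) lo M +
        T * ((Finset.Ico lo M).filter fun c => s ≤ chainLength P (c * T) ((c + 1) * T)).card := by
  have hP' : IntervalPred fun c d => P (c * T) (d * T) :=
    ⟨fun h1 h2 h => hP.mono (Nat.mul_le_mul_right _ h1) (Nat.mul_le_mul_right _ h2) h,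
      fun h => Nat.lt_of_mul_lt_mul_right (hP.lt h)⟩
  intro n
  induction n using Nat.strong_induction_on with
  | _ n ih =>
    intro lo hn hlo
    by_cases hM : P (lo * T) (M * T)
    swap
    · have : chainLength P (lo * T) (M * T) = 0 := by
        by_contra h
        exact hM (pred_of_chainLength_pos hP (Nat.pos_of_ne_zero h))
      omega
    -- The shortest coarse interval from `lo` ends with the group `f`. Nothing before `f` has
    -- property `P`, the group itself contributes less than `s` unless it is wide, and crossing its
    -- two ends costs at most `2`. This makes `s + 1` per coarse interval.
    have hex : ∃ e, P (lo * T) (e * T) := ⟨M, hM⟩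
    set e := Nat.find hex with he
    have he1 : P (lo * T) (e * T) := Nat.find_spec hex
    have heM : e ≤ M := Nat.find_min' hex hM
    have hlt : lo < e := hP'.lt (a := lo) (b := e) he1
    obtain ⟨f, hf⟩ : ∃ f, e = f + 1 := ⟨e - 1, by omega⟩
    have hf1 : ¬ P (lo * T) (f * T) := Nat.find_min hex (by omega)
    rw [hf] at he1 heM hlt
    have h1 : chainLength P (lo * T) (f * T) = 0 := by
      by_contra h
      exact hf1 (pred_of_chainLength_pos hP (Nat.pos_of_ne_zero h))
    have h2 := chainLength_split hP (lo * T) (f * T) (M * T)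
    have h3 := chainLength_split hP (f * T) ((f + 1) * T) (M * T)
    have h4 := ih (M - (f + 1)) (by omega) (f + 1) rfl heM
    have h5 : 1 + chainLength (fun c d => P (c * T) (d * T)) (f + 1) M ≤
        chainLength (fun c d => P (c * T) (d * T)) lo M :=
      le_trans (Nat.add_le_add_right (chainLength_pos hP' he1) _)
        (chainLength_append hP' hlt.le heM)
    have h6 := Nat.mul_le_mul_left (s + 1) h5
    rw [mul_add, mul_one] at h6
    have hsub : (Finset.Ico (f + 1) M).filter (fun c => s ≤ chainLength P (c * T) ((c + 1) * T)) ⊆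
        (Finset.Ico lo M).filter (fun c => s ≤ chainLength P (c * T) ((c + 1) * T)) :=
      Finset.filter_subset_filter _ (Finset.Ico_subset_Ico_left hlt.le)
    by_cases hwide : s ≤ chainLength P (f * T) ((f + 1) * T)
    · have hcard : ((Finset.Ico (f + 1) M).filter
          fun c => s ≤ chainLength P (c * T) ((c + 1) * T)).card + 1 ≤
          ((Finset.Ico lo M).filter fun c => s ≤ chainLength P (c * T) ((c + 1) * T)).card := by
        rw [← Finset.card_insert_of_notMem (a := f) (by simp)]
        refine Finset.card_le_card (Finset.insert_subset ?_ hsub)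
        simp only [Finset.mem_filter, Finset.mem_Ico]
        exact ⟨⟨by omega, by omega⟩, hwide⟩
      have h7 := Nat.mul_le_mul_left T hcard
      rw [mul_add, mul_one] at h7
      have h8 := chainLength_le hP (f * T) ((f + 1) * T)
      have : (f + 1) * T - f * T = T := by rw [add_mul, one_mul, Nat.add_sub_cancel_left]
      omega
    · have h7 := Nat.mul_le_mul_left T (Finset.card_le_card hsub)
      omega

/-- Removing the last point destroys at most the last interval of the chain. -/
theorem IntervalChain.of_succ {P : ℕ → ℕ → Prop} (hP : IntervalPred P) {hi r lo : ℕ}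
    (h : IntervalChain P (hi + 1) (r + 1) lo) : IntervalChain P hi r lo := by
  induction r generalizing lo with
  | zero => trivial
  | succ r ih =>
    obtain ⟨e, he, h1, h2⟩ := h
    refine ⟨e, ?_, h1, ih h2⟩
    have := hP.lt (h2.pred hP (by omega))
    omega

/-- Each piece is cut off as soon as its chain length reaches `h`. By `IntervalChain.of_succ` it
does not overshoot, and all pieces but the last use up `h` of the total chain length, which bounds
their number. -/
theorem exists_division {P : ℕ → ℕ → Prop} (hP : IntervalPred P) {h : ℕ} (hh : 1 ≤ h) (M : ℕ) :
    ∀ n lo, M - lo = n → lo ≤ M → ∃ (Q : ℕ) (z : ℕ → ℕ), Monotone z ∧ z 0 = lo ∧ z Q = M ∧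
      (∀ b < Q, chainLength P (z b) (z (b + 1)) ≤ h) ∧ Q * h ≤ chainLength P lo M + h := by
  intro n
  induction n using Nat.strong_induction_on with
  | _ n ih =>
    intro lo hn hlo
    by_cases hM : chainLength P lo M ≤ h
    · refine ⟨1, fun b => if b = 0 then lo else M, ?_, by simp, by simp, ?_, by omega⟩
      · intro a b hab
        dsimp only
        split_ifs <;> omega
      · intro b hb
        obtain rfl : b = 0 := by omega
        simpa using hM
    push Not at hM
    have hex : ∃ e, h ≤ chainLength P lo e := ⟨M, hM.le⟩
    classical
    set e := Nat.find hex with he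
    have he1 : h ≤ chainLength P lo e := Nat.find_spec hex
    have heM : e ≤ M := Nat.find_min' hex hM.le
    have hlt : lo < e := by have := chainLength_le hP lo e; omega
    obtain ⟨f, hf⟩ : ∃ f, e = f + 1 := ⟨e - 1, by omega⟩
    have hf1 : ¬ h ≤ chainLength P lo f := Nat.find_min hex (by omega)
    rw [hf] at he1 heM hlt
    have hle : chainLength P lo (f + 1) ≤ h := by
      by_contra hcon
      have := (intervalChain_iff hP (lo := lo) (hi := f + 1) (r := h + 1)).2 (by omega)
      exact hf1 ((intervalChain_iff hP).1 (this.of_succ hP))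
    obtain ⟨Q, z, hz, hz0, hzQ, hzh, hQ⟩ := ih (M - (f + 1)) (by omega) (f + 1) rfl heM
    have happ := chainLength_append hP hlt.le heM
    refine ⟨Q + 1, fun b => if b = 0 then lo else z (b - 1), ?_, by simp, by simpa using hzQ, ?_,
      by rw [add_mul]; omega⟩
    · intro a b hab
      have hzlo : ∀ i, lo ≤ z i := fun i => by have := hz (Nat.zero_le i); omega
      dsimp only
      split_ifs
      · exact le_rfl
      · exact hzlo _
      · omega
      · exact hz (by omega)
    · intro b hb
      rcases Nat.eq_zero_or_pos b with rfl | hb0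
      · simpa [hz0] using hle
      · have := hzh (b - 1) (by omega)
        simp only [Nat.add_sub_cancel, Nat.succ_ne_zero, if_false, hb0.ne']
        rwa [Nat.sub_add_cancel hb0] at this

-- Each piece costs one for an interval straddling its boundary, and at most `h` more if it contains
-- a chain at all.
open Classical in
theorem chainLength_le_division {P : ℕ → ℕ → Prop} (hP : IntervalPred P) {z : ℕ → ℕ} {h : ℕ}
    (Q : ℕ) (hz : ∀ b < Q, chainLength P (z b) (z (b + 1)) ≤ h) :
    chainLength P (z 0) (z Q) ≤
      ∑ b ∈ Finset.range Q, (1 + h * if P (z b) (z (b + 1)) then 1 else 0) := by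
  induction Q with
  | zero => have := chainLength_le hP (z 0) (z 0); simpa using this
  | succ Q ih =>
    rw [Finset.sum_range_succ]
    have h1 := chainLength_split hP (z 0) (z Q) (z (Q + 1))
    have h2 := ih fun b hb => hz b (by omega)
    have h3 := hz Q (by omega)
    have h4 : chainLength P (z Q) (z (Q + 1)) ≤ h * if P (z Q) (z (Q + 1)) then 1 else 0 := by
      split_ifs with hq
      · simpa using h3
      · by_contra hcon
        exact hq (pred_of_chainLength_pos hP (by omega))
    omega

theorem sum_range_mul_block (f : ℕ → ℕ) (M T : ℕ) : ∑ i ∈ Finset.range (M * T), f i =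
    ∑ c ∈ Finset.range M, ∑ j ∈ Finset.range T, f (c * T + j) := by
  induction M with
  | zero => simp
  | succ M ih => rw [Finset.sum_range_succ, ← ih, add_mul, one_mul, Finset.sum_range_add]

/-- The rows of a dyadic interval of rows together have chains not much longer than the whole
interval. -/
theorem sum_chainLength_block_le {X : ℕ → ℕ → ℕ → ℕ → Prop} (hX : MixPred X) {M t a c : ℕ}
    (ht : 1 ≤ t) (hno : ¬ DyadicMinor X (M * 2 ^ a) t) (hc : c < M) :
    ∑ j ∈ Finset.range (2 ^ a), chainLength
        (fun p q => X (c * 2 ^ a + j) (c * 2 ^ a + j + 1) (p * 2 ^ a) (q * 2 ^ a)) 0 M ≤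
      2 ^ t * (chainLength (fun p q => X (c * 2 ^ a) ((c + 1) * 2 ^ a) (p * 2 ^ a) (q * 2 ^ a)) 0 M +
        2 ^ a) + 2 ^ a * (2 ^ a * ((t - 1) * (2 ^ a * 2 ^ a))) := by
  classical
  set T := 2 ^ a with hT
  have hTp : 0 < T := by positivity
  have hmul : Monotone fun i : ℕ => i * T := fun i j h => Nat.mul_le_mul_right _ h
  have hrow : ∀ p q, IntervalPred fun r s => X p q (r * T) (s * T) := fun p q =>
    ⟨fun h1 h2 h => (hX.row p q).mono (hmul h1) (hmul h2) h,
      fun h => Nat.lt_of_mul_lt_mul_right (hX.lt h)⟩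
  set R : ℕ → ℕ → ℕ → Prop :=
    fun j p q => X (c * T + j) (c * T + j + 1) (p * T) (q * T) with hR
  have hRp : ∀ j, IntervalPred (R j) := fun j => hrow _ _
  set L := chainLength (fun p q => X (c * T) ((c + 1) * T) (p * T) (q * T)) 0 M with hL
  -- The columns are divided so that the `T` rows of the block, taken together, have chains of
  -- length at most `T` on each piece. The number of pieces satisfies `Q * T ≤ L + T`.
  obtain ⟨Q, z, hz, hz0, hzQ, hzh, hQ⟩ :=
    exists_division (hrow (c * T) ((c + 1) * T)) hTp M M 0 rfl (Nat.zero_le _)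
  have hsub : ∀ j < T, ∀ p q, R j p q → X (c * T) ((c + 1) * T) (p * T) (q * T) :=
    fun j hj p q h => hX.mono (by omega) (by rw [add_mul]; omega) le_rfl le_rfl h
  have h1 : ∀ j ∈ Finset.range T, chainLength (R j) 0 M ≤
      ∑ b ∈ Finset.range Q, (1 + T * if R j (z b) (z (b + 1)) then 1 else 0) := by
    intro j hj
    have hj' := Finset.mem_range.1 hj
    have := chainLength_le_division (hRp j) (z := z) (h := T) Q fun b hb =>
      (chainLength_mono_pred (hRp j) (hrow _ _) (hsub j hj') _ _).trans (hzh b hb)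
    rwa [hz0, hzQ] at this
  set tall : ℕ → ℕ := fun b => ((Finset.range T).filter fun j => R j (z b) (z (b + 1))).card
    with htall
  set S := (Finset.range Q).filter fun b => 2 ^ t - 1 ≤ tall b with hS
  -- By symmetry a piece mixed with many single rows of the block has a long chain inside that
  -- dyadic block, so the pigeonhole bound applies with rows and columns exchanged.
  have hSc : S.card ≤ (t - 1) * (T * T) := by
    refine card_le_of_not_dyadicMinor hX ht hno (a := a) (w := c * T) (M := Q)
      (z := fun b => z b * T) ⟨c, mul_comm _ _⟩ ?_ (hmul.comp hz) ?_ S ?_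
    · calc c * T + 2 ^ a = (c + 1) * T := by rw [add_mul, one_mul]
        _ ≤ M * T := Nat.mul_le_mul_right _ hc
    · simp only [hzQ]; exact le_rfl
    · intro b hb
      rw [hS, Finset.mem_filter, Finset.mem_range] at hb
      refine ⟨hb.1, hb.2.trans ?_⟩
      have := IntervalChain.of_finset (hX.row (z b * T) (z (b + 1) * T))
        (z := fun j => c * T + j) (fun i j h => Nat.add_le_add_left h _) T
        ((Finset.range T).filter fun j => R j (z b) (z (b + 1))) fun j hj => by
          rw [Finset.mem_filter, Finset.mem_range] at hj
          exact ⟨hj.1, hX.symm hj.2⟩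
      exact (intervalChain_iff (hX.row _ _)).1 this
  have htallT : ∀ b, tall b ≤ T := fun b =>
    (Finset.card_filter_le _ _).trans (Finset.card_range T).le
  have h2 : ∑ b ∈ Finset.range Q, tall b ≤ Q * (2 ^ t - 1) + T * S.card := by
    have : ∀ b ∈ Finset.range Q, tall b ≤
        (2 ^ t - 1) + T * if 2 ^ t - 1 ≤ tall b then 1 else 0 := by
      intro b _
      split_ifs with h
      · have := htallT b; omega
      · omega
    refine (Finset.sum_le_sum this).trans ?_
    rw [Finset.sum_add_distrib, ← Finset.mul_sum, Finset.sum_const, Finset.card_range,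
      smul_eq_mul, ← Finset.card_filter]
  -- A row pays `1` for each piece and `T` for each piece it is mixed with. The second kind of
  -- payment is counted by pieces rather than by rows, through `tall`.
  have h3 : ∑ j ∈ Finset.range T, chainLength (R j) 0 M ≤
      T * Q + T * (Q * (2 ^ t - 1) + T * S.card) := by
    refine (Finset.sum_le_sum h1).trans ?_
    simp only [Finset.sum_add_distrib, ← Finset.mul_sum, Finset.sum_const, Finset.card_range,
      smul_eq_mul, mul_one]
    rw [Finset.sum_comm]
    simp only [← Finset.card_filter]
    exact Nat.add_le_add_left (Nat.mul_le_mul_left _ h2) _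
  have hpt : 2 ^ t = (2 ^ t - 1) + 1 := by have : 0 < 2 ^ t := by positivity
                                           omega
  calc ∑ j ∈ Finset.range T, chainLength (R j) 0 M ≤ _ := h3
    _ = 2 ^ t * (Q * T) + T * (T * S.card) := by
      generalize 2 ^ t - 1 = s at *
      rw [hpt]; ring
    _ ≤ _ := by gcongr

/-- The density bound of a Marcus–Tardos type theorem. -/
theorem sum_chainLength_le {t : ℕ} (ht : 1 ≤ t) : ∀ (A : ℕ) (X : ℕ → ℕ → ℕ → ℕ → Prop),
    MixPred X → ¬ DyadicMinor X (2 ^ A) t →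
      ∑ i ∈ Finset.range (2 ^ A), chainLength (X i (i + 1)) 0 (2 ^ A) ≤
        (2 ^ (2 * t + 1)) ^ 5 * 2 ^ A := by
  classical
  intro A
  induction A using Nat.strong_induction_on with
  | _ A ih =>
    intro X hX hno
    -- The coarsening factor is `T = 2 ^ a = 2 * 4 ^ t`. Coarsening columns and then rows loses a
    -- factor `2 ^ t` each time, so the recursive term `4 ^ t * (T ^ 5 * M)` is half of the
    -- permitted `T ^ 5 * (M * T)`.
    set a := 2 * t + 1 with ha
    rcases Nat.lt_or_ge A a with hA | hA
    · calc _ ≤ ∑ i ∈ Finset.range (2 ^ A), 2 ^ A :=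
            Finset.sum_le_sum fun i _ => by simpa using chainLength_le (hX.row i (i + 1)) 0 (2 ^ A)
        _ = 2 ^ A * 2 ^ A := by simp
        _ ≤ _ := by
          refine Nat.mul_le_mul_right _ ?_
          rw [← pow_mul]
          exact Nat.pow_le_pow_right (by norm_num) (by omega)
    obtain ⟨B, rfl⟩ : ∃ B, A = B + a := ⟨A - a, by omega⟩
    have hTp : 0 < 2 ^ a := by positivity
    have hmul : Monotone fun i : ℕ => i * 2 ^ a := fun i j h => Nat.mul_le_mul_right _ h
    rw [pow_add] at hno ⊢
    have hIH := ih B (by omega) _ (hX.comap hmul) fun h => hno (h.scale a)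
    set M := 2 ^ B with hM
    have hs1 : 2 ^ t - 1 + 1 = 2 ^ t := Nat.sub_add_cancel (by have : 0 < 2 ^ t := by positivity
                                                               omega)
    have hs : 1 ≤ 2 ^ t - 1 := by
      have : 2 ^ 1 ≤ 2 ^ t := Nat.pow_le_pow_right (by norm_num) ht
      omega
    set wide : ℕ → Finset ℕ := fun i => (Finset.Ico 0 M).filter fun c =>
      2 ^ t - 1 ≤ chainLength (X i (i + 1)) (c * 2 ^ a) ((c + 1) * 2 ^ a) with hwide
    have hA1 : ∀ i ∈ Finset.range (M * 2 ^ a), chainLength (X i (i + 1)) 0 (M * 2 ^ a) ≤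
        2 ^ t * chainLength (fun c d => X i (i + 1) (c * 2 ^ a) (d * 2 ^ a)) 0 M +
          2 ^ a * (wide i).card := fun i _ => by
      have := chainLength_le_coarsen (hX.row i (i + 1)) hs (T := 2 ^ a) M M 0 rfl (Nat.zero_le _)
      rwa [hs1, zero_mul] at this
    have hW : ∑ i ∈ Finset.range (M * 2 ^ a), (wide i).card ≤
        M * ((t - 1) * (2 ^ a * 2 ^ a)) := by
      simp only [hwide, Finset.card_filter]
      rw [Finset.sum_comm]
      simp only [← Finset.card_filter]
      have h : ∀ c ∈ Finset.Ico 0 M, ((Finset.range (M * 2 ^ a)).filter fun i =>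
          2 ^ t - 1 ≤ chainLength (X i (i + 1)) (c * 2 ^ a) ((c + 1) * 2 ^ a)).card ≤
          (t - 1) * (2 ^ a * 2 ^ a) := by
        intro c hc
        have e : (c + 1) * 2 ^ a = c * 2 ^ a + 2 ^ a := by rw [add_mul, one_mul]
        refine card_le_of_not_dyadicMinor hX ht hno (w := c * 2 ^ a) (M := M * 2 ^ a)
          (z := fun i => i) ⟨c, mul_comm _ _⟩ ?_ monotone_id le_rfl _ ?_
        · rw [← e]; exact Nat.mul_le_mul_right _ (Finset.mem_Ico.1 hc).2
        · intro i hi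
          rw [Finset.mem_filter, Finset.mem_range] at hi
          rw [← e]
          exact hi
      refine (Finset.sum_le_sum h).trans ?_
      simp
    have hB : ∑ i ∈ Finset.range (M * 2 ^ a),
        chainLength (fun c d => X i (i + 1) (c * 2 ^ a) (d * 2 ^ a)) 0 M ≤
        2 ^ t * ((2 ^ a) ^ 5 * M + M * 2 ^ a) +
          M * (2 ^ a * (2 ^ a * ((t - 1) * (2 ^ a * 2 ^ a)))) := by
      rw [sum_range_mul_block]
      refine (Finset.sum_le_sum fun c hc =>
        sum_chainLength_block_le hX ht hno (Finset.mem_range.1 hc)).trans ?_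
      rw [Finset.sum_add_distrib, ← Finset.mul_sum, Finset.sum_add_distrib]
      simp only [Finset.sum_const, Finset.card_range, smul_eq_mul]
      gcongr
    have htt : t - 1 ≤ 2 ^ t := (Nat.sub_le _ _).trans Nat.lt_two_pow_self.le
    have hTt : 2 ^ a = 2 * (2 ^ t * 2 ^ t) := by rw [ha, ← pow_add, pow_succ]; ring_nf
    have ht2 : 2 ≤ 2 ^ t := by omega
    calc _ ≤ _ := Finset.sum_le_sum hA1
      _ ≤ 2 ^ t * (2 ^ t * ((2 ^ a) ^ 5 * M + M * 2 ^ a) +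
          M * (2 ^ a * (2 ^ a * ((t - 1) * (2 ^ a * 2 ^ a))))) +
          2 ^ a * (M * ((t - 1) * (2 ^ a * 2 ^ a))) := by
        rw [Finset.sum_add_distrib, ← Finset.mul_sum, ← Finset.mul_sum]
        gcongr
      _ ≤ 2 ^ t * (2 ^ t * ((2 ^ a) ^ 5 * M + M * 2 ^ a) +
          M * (2 ^ a * (2 ^ a * (2 ^ t * (2 ^ a * 2 ^ a))))) +
          2 ^ a * (M * (2 ^ t * (2 ^ a * 2 ^ a))) := by gcongr
      -- With `T = 2 * (u * u)` the term containing `T ^ 5 * M` takes exactly half of `T ^ 6 * M`.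
      -- The other terms have lower order in `T` and fit into the second half because `T ≥ 8`.
      _ ≤ (2 ^ a) ^ 5 * (M * 2 ^ a) := by
        generalize 2 ^ t = u at *
        generalize 2 ^ a = T at *
        have e1 : 2 * (u * (u * (T ^ 5 * M + M * T))) = T * (T ^ 5 * M + M * T) := by
          rw [hTt]; ring
        have e2 : 2 * (u * (M * (T * (T * (u * (T * T)))))) = T * (M * T ^ 4) := by
          rw [hTt]; ring
        have hTu : u ≤ T := by rw [hTt]; nlinarith
        have hT8 : 8 ≤ T := by rw [hTt]; nlinarith
        have e3 : T * (M * (u * (T * T))) ≤ M * T ^ 4 := by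
          calc T * (M * (u * (T * T))) ≤ T * (M * (T * (T * T))) := by gcongr
            _ = _ := by ring
        have e4 : T ^ 4 * 8 ≤ T ^ 5 := by rw [pow_succ T 4]; gcongr
        have e5 : T ^ 5 * 8 ≤ T ^ 6 := by rw [pow_succ T 5]; gcongr
        have e6 : T ^ 2 ≤ T ^ 4 := Nat.pow_le_pow_right (by omega) (by norm_num)
        have e4' := Nat.mul_le_mul_left M e4
        have e5' := Nat.mul_le_mul_left M e5
        have e6' := Nat.mul_le_mul_left M e6
        nlinarith

/-- Without a dyadic minor, some pair of consecutive rows has short chains. -/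
theorem exists_chainLength_pair_le {X : ℕ → ℕ → ℕ → ℕ → Prop} (hX : MixPred X) {t m A : ℕ}
    (ht : 1 ≤ t) (hA : 2 ^ A < m)
    (hA' : m ≤ 2 ^ A * 2) (hno : ¬ DyadicMinor X (2 ^ A * 2) t) :
    ∃ p, p + 2 ≤ m ∧ chainLength (X p (p + 2)) 0 (2 ^ A * 2) ≤ 8 * (2 ^ (2 * t + 1)) ^ 5 := by
  have hmul : Monotone fun i : ℕ => i * 2 := fun i j h => Nat.mul_le_mul_right _ h
  have hY := hX.comap hmul
  have hsum := sum_chainLength_le ht A _ hY fun h =>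
    hno (by simpa using DyadicMinor.scale 1 (by simpa using h))
  set C := (2 ^ (2 * t + 1)) ^ 5
  by_contra! hcon
  have hbig : ∀ i, i * 2 + 2 ≤ m →
      2 * C + 1 ≤ chainLength (fun c d => X (i * 2) ((i + 1) * 2) (c * 2) (d * 2)) 0 (2 ^ A) := by
    intro i hi
    have h1 := hcon (i * 2) hi
    -- A group of two columns has no chain of length `3`, so with `s = 3` there is no wide group and
    -- coarsening costs just a factor `4`. From more than `8 * C` this leaves at least `2 * C + 1`,
    -- and the at least `2 ^ A / 2` disjoint pairs then exceed the density bound.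
    have h2 := chainLength_le_coarsen (hX.row (i * 2) (i * 2 + 2)) (T := 2) (s := 3) (by norm_num)
      (2 ^ A) (2 ^ A) 0 rfl (Nat.zero_le _)
    rw [Finset.filter_eq_empty_iff.2, Finset.card_empty] at h2
    · rw [zero_mul] at h2
      have e : (i + 1) * 2 = i * 2 + 2 := by ring
      rw [e]
      omega
    · intro c _
      have := chainLength_le (hX.row (i * 2) (i * 2 + 2)) (c * 2) ((c + 1) * 2)
      omega
  have hCp : 0 < C := by positivity
  have hle : ∑ i ∈ Finset.range (m / 2), (2 * C + 1) ≤ C * 2 ^ A := by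
    refine le_trans ((Finset.sum_le_sum fun i hi => hbig i ?_).trans
      (Finset.sum_le_sum_of_subset (Finset.range_subset_range.2 (by omega)))) hsum
    have := Finset.mem_range.1 hi
    omega
  rw [Finset.sum_const, Finset.card_range, smul_eq_mul] at hle
  have h1 : 2 ^ A ≤ 2 * (m / 2) := by omega
  have h2 : 1 ≤ m / 2 := by omega
  generalize m / 2 = h at *
  generalize 2 ^ A = B at *
  nlinarith

/-! ### Mixed blocks of a matrix -/

/-- The row `x` of the matrix `c`, restricted to the columns in `[p, q)`. -/
def rowOn (c : ℕ → ℕ → ℕ) (p q x : ℕ) : ℕ → ℕ := fun y => if p ≤ y ∧ y < q then c x y else 0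

theorem rowOn_eq_iff {c : ℕ → ℕ → ℕ} {p q x x' : ℕ} :
    rowOn c p q x = rowOn c p q x' ↔ ∀ y, p ≤ y → y < q → c x y = c x' y := by
  constructor
  · intro h y h1 h2
    have := congrFun h y
    simpa [rowOn, h1, h2] using this
  · intro h
    funext y
    simp only [rowOn]
    split_ifs with hy
    · exact h y hy.1 hy.2
    · rfl

open Classical in
/-- The number of distinct rows of the submatrix `[a, b) × [p, q)`. -/
noncomputable def rowCount (c : ℕ → ℕ → ℕ) (a b p q : ℕ) : ℕ :=
  ((Finset.Ico a b).image (rowOn c p q)).card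

theorem rowCount_mono {c : ℕ → ℕ → ℕ} {a b p q a' b' p' q' : ℕ} (ha : a' ≤ a) (hb : b ≤ b')
    (hp : p' ≤ p) (hq : q ≤ q') : rowCount c a b p q ≤ rowCount c a' b' p' q' := by
  classical
  have h : (Finset.Ico a b).image (rowOn c p q) ⊆
      ((Finset.Ico a' b').image (rowOn c p' q')).image
        (fun f y => if p ≤ y ∧ y < q then f y else 0) := by
    intro f hf
    obtain ⟨x, hx, rfl⟩ := Finset.mem_image.1 hf
    refine Finset.mem_image.2 ⟨rowOn c p' q' x, Finset.mem_image_of_mem _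
      (Finset.Ico_subset_Ico ha hb hx), ?_⟩
    funext y
    simp only [rowOn]
    split_ifs with h1 h2
    · rfl
    · omega
    · rfl
  exact (Finset.card_le_card h).trans Finset.card_image_le

/-- Each value is counted at its first occurrence. In this form the number of distinct rows is a
bounded count that a program can evaluate. -/
theorem card_image_eq_card_first {β : Type*} [DecidableEq β] (f : ℕ → β) (a b : ℕ) :
    ((Finset.Ico a b).image f).card =
      ((Finset.Ico a b).filter fun x => ∀ x' ∈ Finset.Ico a x, f x ≠ f x').card := by
  have h : (Finset.Ico a b).image f =
      ((Finset.Ico a b).filter fun x => ∀ x' ∈ Finset.Ico a x, f x ≠ f x').image f := by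
    refine Finset.Subset.antisymm ?_ (Finset.image_subset_image (Finset.filter_subset _ _))
    intro v hv
    obtain ⟨x, hx, rfl⟩ := Finset.mem_image.1 hv
    have hex : ∃ z, z ∈ Finset.Ico a b ∧ f z = f x := ⟨x, hx, rfl⟩
    refine Finset.mem_image.2 ⟨Nat.find hex, Finset.mem_filter.2
      ⟨(Nat.find_spec hex).1, fun x' hx' heq => ?_⟩, (Nat.find_spec hex).2⟩
    rw [Finset.mem_Ico] at hx'
    have h1 := Finset.mem_Ico.1 (Nat.find_spec hex).1
    exact Nat.find_min hex hx'.2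
      ⟨Finset.mem_Ico.2 ⟨hx'.1, by omega⟩, heq.symm.trans (Nat.find_spec hex).2⟩
  rw [h, Finset.card_image_of_injOn]
  intro x hx y hy hxy
  simp only [Finset.coe_filter, Set.mem_ofPred_eq, Finset.mem_Ico] at hx hy
  rcases lt_trichotomy x y with h | h | h
  · exact absurd hxy.symm (hy.2 x ⟨hx.1.1, h⟩)
  · exact h
  · exact absurd hxy (hx.2 y ⟨hy.1.1, h⟩)

theorem rowCount_eq_first (c : ℕ → ℕ → ℕ) (a b p q : ℕ) : rowCount c a b p q =
    ((Finset.Ico a b).filter fun x => ∀ x' ∈ Finset.Ico a x,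
      ∃ y ∈ Finset.Ico p q, c x y ≠ c x' y).card := by
  classical
  rw [rowCount, card_image_eq_card_first]
  congr 1
  ext x
  simp only [Finset.mem_filter, and_congr_right_iff, Ne, rowOn_eq_iff, Finset.mem_Ico]
  intro _
  refine forall₂_congr fun x' _ => ?_
  push Not
  constructor
  · rintro ⟨y, h1, h2, h3⟩; exact ⟨y, ⟨h1, h2⟩, h3⟩
  · rintro ⟨y, ⟨h1, h2⟩, h3⟩; exact ⟨y, h1, h2, h3⟩

/-- The submatrix `[a, b) × [p, q)` has at least `k` distinct rows or at least `k` distinct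
columns; the columns are counted as rows of the transposed position, which is the same for
matrices in which `c x y` determines `c y x`. -/
def Mixed (c : ℕ → ℕ → ℕ) (k a b p q : ℕ) : Prop :=
  k ≤ rowCount c a b p q ∨ k ≤ rowCount c p q a b

/-- The bound `2 ≤ k` makes empty intervals unmixed: over an empty set of columns all rows coincide,
which still leaves one distinct row. -/
theorem mixPred_mixed (c : ℕ → ℕ → ℕ) {k : ℕ} (hk : 2 ≤ k) : MixPred (Mixed c k) where
  mono h1 h2 h3 h4 h := h.imp (fun h => h.trans (rowCount_mono h1 h2 h3 h4))
    fun h => h.trans (rowCount_mono h3 h4 h1 h2)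
  symm h := h.symm
  lt {a b p q} h := by
    classical
    by_contra hpq
    rcases h with h | h
    · have : rowCount c a b p q ≤ 1 := by
        refine Finset.card_le_one.2 fun f hf g hg => ?_
        obtain ⟨x, -, rfl⟩ := Finset.mem_image.1 hf
        obtain ⟨y, -, rfl⟩ := Finset.mem_image.1 hg
        rw [rowOn_eq_iff]
        intro z hz hz'
        omega
      omega
    · rw [rowCount, Finset.Ico_eq_empty (by omega)] at h
      simp at h
      omega

/-- A single row is not mixed with anything if `k` exceeds the number of entries. -/
theorem not_mixed_single {c : ℕ → ℕ → ℕ} {k W : ℕ} (hc : ∀ x y, c x y < W) (hk : W < k)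
    (i p q : ℕ) : ¬ Mixed c k i (i + 1) p q := by
  classical
  have hW : 0 < W := (Nat.zero_le _).trans_lt (hc 0 0)
  rintro (h | h)
  · have : rowCount c i (i + 1) p q ≤ 1 := by
      rw [rowCount]
      simp
    omega
  · have : rowCount c p q i (i + 1) ≤ W := by
      have hsub : (Finset.Ico p q).image (rowOn c i (i + 1)) ⊆
          (Finset.range W).image fun v y => if i ≤ y ∧ y < i + 1 then v else 0 := by
        intro f hf
        obtain ⟨x, -, rfl⟩ := Finset.mem_image.1 hf
        refine Finset.mem_image.2 ⟨c x i, Finset.mem_range.2 (hc x i), ?_⟩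
        funext y
        simp only [rowOn]
        split_ifs with hy
        · obtain rfl : y = i := by omega
          rfl
        · rfl
      exact (Finset.card_le_card hsub).trans (Finset.card_image_le.trans (Finset.card_range W).le)
    omega

theorem exists_coloring_of_not_mixed {c : ℕ → ℕ → ℕ} {k a b p q : ℕ} (h : ¬ Mixed c k a b p q) :
    ∃ col : ℕ → ℕ, (∀ x, a ≤ x → x < b → col x < k) ∧ ∀ x x', a ≤ x → x < b → a ≤ x' → x' < b →
      col x = col x' → ∀ y, p ≤ y → y < q → c x y = c x' y := by
  classical
  have hlt : rowCount c a b p q < k := by by_contra h'; exact h (Or.inl (by omega))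
  set S := (Finset.Ico a b).image (rowOn c p q) with hS
  have hmem : ∀ x, a ≤ x → x < b → rowOn c p q x ∈ S := fun x h1 h2 =>
    Finset.mem_image_of_mem _ (Finset.mem_Ico.2 ⟨h1, h2⟩)
  refine ⟨fun x => if hx : rowOn c p q x ∈ S then (S.equivFin ⟨_, hx⟩ : ℕ) else 0, ?_, ?_⟩
  · intro x h1 h2
    simp only [hmem x h1 h2, dif_pos]
    exact (S.equivFin ⟨_, hmem x h1 h2⟩).2.trans hlt
  · intro x x' h1 h2 h3 h4 heq
    simp only [hmem x h1 h2, hmem x' h3 h4, dif_pos] at heq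
    have := S.equivFin.injective (Fin.ext heq)
    exact rowOn_eq_iff.1 (Subtype.ext_iff.1 this)

/-! ### Divisions into intervals -/

/-- `bd 0 < bd 1 < ⋯ < bd m` are the boundaries of a division of `[0, n)` into `m` intervals. -/
structure IsDivision (n m : ℕ) (bd : ℕ → ℕ) : Prop where
  zero : bd 0 = 0
  strict : ∀ i < m, bd i < bd (i + 1)
  top : ∀ i, m ≤ i → bd i = n

/-- The number of the interval that contains `x`. -/
def partIndex (n : ℕ) (bd : ℕ → ℕ) (x : ℕ) : ℕ :=
  ((Finset.range (2 * n + 1)).filter fun i => 0 < i ∧ bd i ≤ x).card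

namespace IsDivision

variable {n m : ℕ} {bd : ℕ → ℕ}

theorem monotone (h : IsDivision n m bd) : Monotone bd := by
  refine monotone_nat_of_le_succ fun i => ?_
  rcases Nat.lt_or_ge i m with hi | hi
  · exact (h.strict i hi).le
  · rw [h.top i hi, h.top (i + 1) (by omega)]

theorem le_bd (h : IsDivision n m bd) {i : ℕ} (hi : i ≤ m) : i ≤ bd i := by
  induction i with
  | zero => exact Nat.zero_le _
  | succ i ih => have := ih (by omega); have := h.strict i (by omega); omega

theorem bd_le (h : IsDivision n m bd) (i : ℕ) : bd i ≤ n := by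
  have := h.monotone (le_max_left i m)
  rwa [h.top _ (le_max_right i m)] at this

theorem le (h : IsDivision n m bd) : m ≤ n := by
  have := h.le_bd le_rfl
  rwa [h.top m le_rfl] at this

theorem bd_le_iff (h : IsDivision n m bd) {x : ℕ} (hx : x < n) (i : ℕ) :
    bd i ≤ x ↔ i ≤ partIndex n bd x := by
  have hex : ∃ j, x < bd j := ⟨m, by rwa [h.top m le_rfl]⟩
  obtain ⟨j, hj⟩ : ∃ j, Nat.find hex = j + 1 := by
    refine ⟨Nat.find hex - 1, ?_⟩
    have : Nat.find hex ≠ 0 := fun h0 => by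
      have := Nat.find_spec hex
      rw [h0, h.zero] at this
      omega
    omega
  have h1 : x < bd (j + 1) := by rw [← hj]; exact Nat.find_spec hex
  have h2 : bd j ≤ x := by
    have := Nat.find_min hex (m := j) (by omega)
    omega
  have hjm : j < m := by
    by_contra hcon
    rw [h.top j (by omega)] at h2
    omega
  have key : ∀ i, bd i ≤ x ↔ i ≤ j := fun i => by
    constructor
    · intro hi
      by_contra hcon
      have := h.monotone (show j + 1 ≤ i by omega)
      omega
    · intro hi
      exact (h.monotone hi).trans h2
  have hm := h.le
  have hp : partIndex n bd x = j := by
    rw [partIndex]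
    have : ((Finset.range (2 * n + 1)).filter fun i => 0 < i ∧ bd i ≤ x) = Finset.Ico 1 (j + 1) := by
      ext i
      simp only [Finset.mem_filter, Finset.mem_range, Finset.mem_Ico, key]
      omega
    rw [this, Nat.card_Ico]; omega
  rw [hp, key]

theorem lt_bd_iff (h : IsDivision n m bd) {x : ℕ} (hx : x < n) (i : ℕ) :
    x < bd i ↔ partIndex n bd x < i := by
  have := h.bd_le_iff hx i
  omega

theorem partIndex_lt (h : IsDivision n m bd) {x : ℕ} (hx : x < n) : partIndex n bd x < m := by
  rw [← h.lt_bd_iff hx, h.top m le_rfl]; exact hx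

theorem bd_partIndex_le (h : IsDivision n m bd) {x : ℕ} (hx : x < n) :
    bd (partIndex n bd x) ≤ x := (h.bd_le_iff hx _).2 le_rfl

theorem lt_bd_partIndex (h : IsDivision n m bd) {x : ℕ} (hx : x < n) :
    x < bd (partIndex n bd x + 1) := (h.lt_bd_iff hx _).2 (Nat.lt_succ_self _)

theorem partIndex_eq_iff (h : IsDivision n m bd) {x : ℕ} (hx : x < n) (i : ℕ) :
    partIndex n bd x = i ↔ bd i ≤ x ∧ x < bd (i + 1) := by
  rw [h.bd_le_iff hx, h.lt_bd_iff hx]; omega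

end IsDivision

/-- The intervals with numbers in `[a, b)` and in `[p, q)` form a mixed block. -/
def BlockMixed (c : ℕ → ℕ → ℕ) (k : ℕ) (bd : ℕ → ℕ) (a b p q : ℕ) : Prop :=
  Mixed c k (bd a) (bd b) (bd p) (bd q)

theorem IsDivision.mixPred {n m : ℕ} {bd : ℕ → ℕ} (h : IsDivision n m bd) (c : ℕ → ℕ → ℕ) {k : ℕ}
    (hk : 2 ≤ k) : MixPred (BlockMixed c k bd) :=
  (mixPred_mixed c hk).comap h.monotone

/-- All boundaries from `m` on equal `n`, so the ends of a chain may be moved back to `m`. The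
algorithm measures chains up to `2 * n`, the analysis up to `m`. -/
theorem IsDivision.chainLength_le_top {n m : ℕ} {bd : ℕ → ℕ} (h : IsDivision n m bd)
    (c : ℕ → ℕ → ℕ) {k : ℕ} (hk : 2 ≤ k) (a b hi : ℕ) :
    chainLength (BlockMixed c k bd a b) 0 hi ≤ chainLength (BlockMixed c k bd a b) 0 m := by
  have hP := (h.mixPred c hk).row a b
  rw [← intervalChain_iff hP]
  have key : ∀ r lo, IntervalChain (BlockMixed c k bd a b) hi r lo →
      IntervalChain (BlockMixed c k bd a b) m r lo := by
    intro r
    induction r with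
    | zero => intro lo _; trivial
    | succ r ih =>
      rintro lo ⟨e, he, h1, h2⟩
      refine ⟨min e m, min_le_right _ _, ?_, (ih e h2).mono_lo hP (min_le_left _ _)⟩
      have : bd (min e m) = bd e := by
        rcases le_total e m with hem | hem
        · rw [min_eq_left hem]
        · rw [min_eq_right hem, h.top e hem, h.top m le_rfl]
      simp only [BlockMixed, this]
      exact h1
  exact key _ _ (intervalChain_chainLength hP _ _)

/-- `x` and `x'` lie in the same interval and agree on the other intervals that do not form a mixed
block with it. -/
def SimilarRows (c : ℕ → ℕ → ℕ) (n k : ℕ) (bd : ℕ → ℕ) (x x' : ℕ) : Prop :=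
  partIndex n bd x = partIndex n bd x' ∧ ∀ y < n, partIndex n bd y ≠ partIndex n bd x →
    ¬ BlockMixed c k bd (partIndex n bd x) (partIndex n bd x + 1) (partIndex n bd y)
      (partIndex n bd y + 1) → c x y = c x' y

/-- Take the longest stretch `[lo, f)` that is not mixed with interval `i`; its rows need fewer than
`k` colours. The single interval `f` needs at most `k` more, or none if it is mixed. The stretch
together with `f` is mixed and uses one member of a chain, and the rest is coloured by induction. -/
theorem IsDivision.exists_coloring {n m : ℕ} {bd : ℕ → ℕ} (h : IsDivision n m bd)
    (c : ℕ → ℕ → ℕ) {k : ℕ} (hk : 2 ≤ k) (i : ℕ) : ∀ s lo, m - lo = s → lo ≤ m →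
    ∃ col : ℕ → ℕ, (∀ x, bd i ≤ x → x < bd (i + 1) →
        col x < k ^ (2 * chainLength (BlockMixed c k bd i (i + 1)) lo m + 1)) ∧
      ∀ x x', bd i ≤ x → x < bd (i + 1) → bd i ≤ x' → x' < bd (i + 1) → col x = col x' →
        ∀ j, lo ≤ j → j < m → ¬ BlockMixed c k bd i (i + 1) j (j + 1) →
          ∀ y, bd j ≤ y → y < bd (j + 1) → c x y = c x' y := by
  set P := BlockMixed c k bd i (i + 1) with hPdef
  have hP : IntervalPred P := (h.mixPred c hk).row i (i + 1)
  intro s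
  induction s using Nat.strong_induction_on with
  | _ s ih =>
    intro lo hs hlo
    by_cases hM : P lo m
    swap
    · obtain ⟨col, h1, h2⟩ := exists_coloring_of_not_mixed hM
      refine ⟨col, fun x hx hx' => (h1 x hx hx').trans_le ?_, ?_⟩
      · calc k = k ^ 1 := (pow_one k).symm
          _ ≤ _ := Nat.pow_le_pow_right (by omega) (by omega)
      · intro x x' hx1 hx2 hx3 hx4 heq j hj hjm _ y hy hy'
        exact h2 x x' hx1 hx2 hx3 hx4 heq y ((h.monotone hj).trans hy)
          (hy'.trans_le (h.monotone hjm))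
    classical
    have hex : ∃ e, P lo e := ⟨m, hM⟩
    have he1 := Nat.find_spec hex
    have heM : Nat.find hex ≤ m := Nat.find_min' hex hM
    obtain ⟨f, hf⟩ : ∃ f, Nat.find hex = f + 1 := ⟨Nat.find hex - 1, by have := hP.lt he1; omega⟩
    have hf1 : ¬ P lo f := Nat.find_min hex (by omega)
    rw [hf] at he1 heM
    have hlt := hP.lt he1
    obtain ⟨col₁, h11, h12⟩ := exists_coloring_of_not_mixed hf1
    obtain ⟨col₂, h21, h22⟩ : ∃ col : ℕ → ℕ, (∀ x, bd i ≤ x → x < bd (i + 1) → col x < k) ∧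
        ∀ x x', bd i ≤ x → x < bd (i + 1) → bd i ≤ x' → x' < bd (i + 1) → col x = col x' →
          ¬ P f (f + 1) → ∀ y, bd f ≤ y → y < bd (f + 1) → c x y = c x' y := by
      by_cases hff : P f (f + 1)
      · exact ⟨fun _ => 0, fun _ _ _ => show 0 < k by omega, fun _ _ _ _ _ _ _ hn => absurd hff hn⟩
      · obtain ⟨col, g1, g2⟩ := exists_coloring_of_not_mixed hff
        exact ⟨col, g1, fun x x' a1 a2 a3 a4 a5 _ => g2 x x' a1 a2 a3 a4 a5⟩
    obtain ⟨col₃, h31, h32⟩ := ih (m - (f + 1)) (by omega) (f + 1) rfl heM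
    have happ := chainLength_append hP hlt.le heM
    have hpos := chainLength_pos hP he1
    set v := chainLength P (f + 1) m
    -- The three colours are the digits of one number in base `k`. Each member of the chain
    -- contributes a factor `k * k`, and the extra `+ 1` in the exponent belongs to the final
    -- unmixed stretch.
    refine ⟨fun x => col₁ x + k * (col₂ x + k * col₃ x), ?_, ?_⟩
    · intro x hx hx'
      have a1 := h11 x hx hx'
      have a2 := h21 x hx hx'
      have a3 := h31 x hx hx'
      have a4 : col₂ x + k * col₃ x < k * k ^ (2 * v + 1) := by
        have := Nat.mul_le_mul_left k (Nat.succ_le_of_lt a3)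
        rw [Nat.mul_succ] at this
        omega
      calc col₁ x + k * (col₂ x + k * col₃ x) < k * (k * k ^ (2 * v + 1)) := by
            have := Nat.mul_le_mul_left k (Nat.succ_le_of_lt a4)
            rw [Nat.mul_succ] at this
            omega
        _ = k ^ (2 * (1 + v) + 1) := by ring
        _ ≤ _ := Nat.pow_le_pow_right (by omega) (by omega)
    · intro x x' a1 a2 a3 a4 heq j hj hjm hn y hy hy'
      dsimp only at heq
      have b1 := h11 x a1 a2
      have b1' := h11 x' a3 a4
      have b2 := h21 x a1 a2
      have b2' := h21 x' a3 a4
      have e1 : col₁ x = col₁ x' := by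
        have := congrArg (· % k) heq
        simpa [Nat.add_mul_mod_self_left, Nat.mod_eq_of_lt b1, Nat.mod_eq_of_lt b1'] using this
      have e23 : col₂ x + k * col₃ x = col₂ x' + k * col₃ x' :=
        Nat.eq_of_mul_eq_mul_left (show 0 < k by omega) (by omega)
      have e2 : col₂ x = col₂ x' := by
        have := congrArg (· % k) e23
        simpa [Nat.add_mul_mod_self_left, Nat.mod_eq_of_lt b2, Nat.mod_eq_of_lt b2'] using this
      have e3 : col₃ x = col₃ x' :=
        Nat.eq_of_mul_eq_mul_left (show 0 < k by omega) (by omega)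
      rcases lt_trichotomy j f with hjf | rfl | hjf
      · exact h12 x x' a1 a2 a3 a4 e1 y ((h.monotone hj).trans hy)
          (hy'.trans_le (h.monotone hjf))
      · exact h22 x x' a1 a2 a3 a4 e2 hn y hy hy'
      · exact h32 x x' a1 a2 a3 a4 e3 j hjf hjm hn y hy hy'

/-- A labelling that is constant on classes of similar elements uses few labels on each interval. -/
theorem IsDivision.card_labels_le {n m : ℕ} {bd : ℕ → ℕ} (h : IsDivision n m bd)
    (c : ℕ → ℕ → ℕ) {k d : ℕ} (hk : 2 ≤ k) {lab : ℕ → ℕ}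
    (hlab : ∀ x < n, ∀ x' < n, SimilarRows c n k bd x x' → lab x = lab x') {i : ℕ}
    (hd : chainLength (BlockMixed c k bd i (i + 1)) 0 m ≤ d) :
    ((Finset.Ico (bd i) (bd (i + 1))).image lab).card ≤ k ^ (2 * d + 1) := by
  classical
  obtain ⟨col, h1, h2⟩ := h.exists_coloring c hk i m 0 rfl (Nat.zero_le _)
  have hle : ∀ x, x < bd (i + 1) → x < n := fun x hx => hx.trans_le (h.bd_le _)
  have hfac : ∀ x ∈ Finset.Ico (bd i) (bd (i + 1)), ∀ x' ∈ Finset.Ico (bd i) (bd (i + 1)),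
      col x = col x' → lab x = lab x' := by
    intro x hx x' hx' heq
    rw [Finset.mem_Ico] at hx hx'
    have hxn := hle x hx.2
    have hxn' := hle x' hx'.2
    have p1 := (h.partIndex_eq_iff hxn i).2 hx
    have p2 := (h.partIndex_eq_iff hxn' i).2 hx'
    refine hlab x hxn x' hxn' ⟨p1.trans p2.symm, fun y hy hne hmix => ?_⟩
    rw [p1] at hne hmix
    exact h2 x x' hx.1 hx.2 hx'.1 hx'.2 heq _ (Nat.zero_le _) (h.partIndex_lt hy) hmix y
      (h.bd_partIndex_le hy) (h.lt_bd_partIndex hy)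
  set S := Finset.Ico (bd i) (bd (i + 1))
  have hg : ∀ x ∈ S, ∃ x' ∈ S, Function.invFunOn col S (col x) = x' ∧ col x' = col x := by
    intro x hx
    have hex : ∃ a ∈ (S : Set ℕ), col a = col x := ⟨x, hx, rfl⟩
    exact ⟨_, Function.invFunOn_mem hex, rfl, Function.invFunOn_eq hex⟩
  have hsub : S.image lab ⊆ (Finset.range (k ^ (2 * d + 1))).image
      fun v => lab (Function.invFunOn col S v) := by
    intro l hl
    obtain ⟨x, hx, rfl⟩ := Finset.mem_image.1 hl
    obtain ⟨x', hx', e1, e2⟩ := hg x hx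
    refine Finset.mem_image.2 ⟨col x, Finset.mem_range.2 ?_, ?_⟩
    · have := Finset.mem_Ico.1 hx
      exact (h1 x this.1 this.2).trans_le (Nat.pow_le_pow_right (by omega) (by omega))
    · simp only [e1]
      exact hfac x' hx' x hx e2
  exact (Finset.card_le_card hsub).trans (Finset.card_image_le.trans (Finset.card_range _).le)

/-! ### Red-degree of labellings -/

/-- The classes with labels `l` and `l'` are homogeneous. -/
def HomogeneousLabels (c : ℕ → ℕ → ℕ) (n : ℕ) (lab : ℕ → ℕ) (l l' : ℕ) : Prop :=
  ∀ x < n, ∀ x' < n, ∀ y < n, ∀ y' < n, lab x = l → lab x' = l → lab y = l' → lab y' = l' →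
    c x y = c x' y'

open Classical in
/-- The labels of the classes that are not homogeneous to the class with label `l`. -/
noncomputable def redLabels (c : ℕ → ℕ → ℕ) (n : ℕ) (lab : ℕ → ℕ) (l : ℕ) : Finset ℕ :=
  ((Finset.range n).image lab).filter fun l' => l' ≠ l ∧ ¬ HomogeneousLabels c n lab l l'

theorem IsDivision.card_mixed_le {n m : ℕ} {bd : ℕ → ℕ} (h : IsDivision n m bd)
    (c : ℕ → ℕ → ℕ) {k : ℕ} (hk : 2 ≤ k) (i : ℕ) (S : Finset ℕ)
    (hS : ∀ j ∈ S, j < m ∧ BlockMixed c k bd i (i + 1) j (j + 1)) :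
    S.card ≤ chainLength (BlockMixed c k bd i (i + 1)) 0 m := by
  have hP := (h.mixPred c hk).row i (i + 1)
  rw [← intervalChain_iff hP]
  exact IntervalChain.of_finset hP (z := fun j => j) monotone_id m S hS

/-- If the intervals of two classes are different and not mixed with each other, rows agree within
the first class and, by symmetry of the codes, columns agree within the second, so the classes are
homogeneous. Red labels therefore occur only in the interval of `x` and in at most `d` mixed ones.
-/
theorem IsDivision.card_redLabels_le {n m : ℕ} {bd : ℕ → ℕ} (h : IsDivision n m bd)
    {c : ℕ → ℕ → ℕ} (hsymm : ∀ x y x' y', c x y = c x' y' → c y x = c y' x') {k d K : ℕ}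
    (hk : 2 ≤ k) {lab : ℕ → ℕ}
    (hlab : ∀ x < n, ∀ x' < n, lab x = lab x' → SimilarRows c n k bd x x')
    (hd : ∀ i < m, chainLength (BlockMixed c k bd i (i + 1)) 0 m ≤ d)
    (hK : ∀ i < m, ((Finset.Ico (bd i) (bd (i + 1))).image lab).card ≤ K) {x : ℕ} (hx : x < n) :
    (redLabels c n lab (lab x)).card ≤ (d + 1) * K := by
  classical
  set i := partIndex n bd x with hi
  set J := (Finset.range m).filter fun j => BlockMixed c k bd i (i + 1) j (j + 1) with hJ
  have hJc : J.card ≤ d := (h.card_mixed_le c hk i J fun j hj => by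
    simpa [hJ] using hj).trans (hd i (h.partIndex_lt hx))
  have hsub : redLabels c n lab (lab x) ⊆
      (insert i J).biUnion fun j => (Finset.Ico (bd j) (bd (j + 1))).image lab := by
    intro l hl
    simp only [redLabels, Finset.mem_filter, Finset.mem_image, Finset.mem_range] at hl
    obtain ⟨⟨y, hy, rfl⟩, -, hnh⟩ := hl
    rw [Finset.mem_biUnion]
    refine ⟨partIndex n bd y, ?_, Finset.mem_image_of_mem _ (Finset.mem_Ico.2
      ⟨h.bd_partIndex_le hy, h.lt_bd_partIndex hy⟩)⟩
    by_contra hcon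
    simp only [Finset.mem_insert, hJ, Finset.mem_filter, Finset.mem_range, not_or, not_and] at hcon
    have hmix := hcon.2 (h.partIndex_lt hy)
    refine hnh fun x₁ h1 x₂ h2 y₁ h3 y₂ h4 e1 e2 e3 e4 => ?_
    have s1 := hlab x₁ h1 x₂ h2 (e1.trans e2.symm)
    have s2 := hlab y₁ h3 y₂ h4 (e3.trans e4.symm)
    have p1 : partIndex n bd x₁ = i := (hlab x₁ h1 x hx e1).1
    have p2 : partIndex n bd x₂ = i := (hlab x₂ h2 x hx e2).1
    have p3 : partIndex n bd y₁ = partIndex n bd y := (hlab y₁ h3 y hy e3).1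
    have g1 := s1.2 y₁ h3 (by rw [p1, p3]; exact hcon.1) (by rw [p1, p3]; exact hmix)
    have g2 := s2.2 x₂ h2 (by rw [p2, p3]; exact fun h => hcon.1 h.symm) (by
      rw [p2, p3]; exact fun h' => hmix ((h.mixPred c hk).symm h'))
    exact g1.trans (hsymm _ _ _ _ g2)
  refine (Finset.card_le_card hsub).trans (Finset.card_biUnion_le.trans ?_)
  refine (Finset.sum_le_sum (g := fun _ => K) fun j hj => hK j ?_).trans ?_
  · rw [Finset.mem_insert] at hj
    rcases hj with rfl | hj
    · exact h.partIndex_lt hx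
    · exact Finset.mem_range.1 (Finset.mem_filter.1 hj).1
  · rw [Finset.sum_const, smul_eq_mul]
    exact Nat.mul_le_mul_right _ ((Finset.card_insert_le _ _).trans (by omega))

/-! ### Merging two consecutive intervals -/

/-- The increasing enumeration of the numbers different from `p + 1`. -/
def skipIndex (p i : ℕ) : ℕ := if i ≤ p then i else i + 1

theorem skipIndex_monotone (p : ℕ) : Monotone (skipIndex p) := by
  intro i j hij
  simp only [skipIndex]
  split_ifs <;> omega

theorem IsDivision.merge {n m p : ℕ} {bd : ℕ → ℕ} (h : IsDivision n m bd) (hp : p + 2 ≤ m) :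
    IsDivision n (m - 1) (bd ∘ skipIndex p) where
  zero := by simp [skipIndex, h.zero]
  strict i hi := by
    simp only [Function.comp, skipIndex]
    split_ifs with h1 h2 h2
    · exact h.strict i (by omega)
    · exact (h.strict i (by omega)).trans (h.strict (i + 1) (by omega))
    · omega
    · exact h.strict (i + 1) (by omega)
  top i hi := by
    simp only [Function.comp, skipIndex]
    split_ifs with h1
    · omega
    · exact h.top _ (by omega)

/-- Groups of merged intervals are groups of old intervals, so chains do not grow for an interval
that is left alone. The merged interval is the only new one and is covered by `hpd`. -/
theorem IsDivision.chainLength_merge_le {n m p : ℕ} {bd : ℕ → ℕ} (h : IsDivision n m bd)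
    (c : ℕ → ℕ → ℕ) {k d : ℕ} (hk : 2 ≤ k) (hp : p + 2 ≤ m)
    (hd : ∀ i < m, chainLength (BlockMixed c k bd i (i + 1)) 0 m ≤ d)
    (hpd : chainLength (BlockMixed c k bd p (p + 2)) 0 m ≤ d) {i : ℕ} (hi : i < m - 1) :
    chainLength (BlockMixed c k (bd ∘ skipIndex p) i (i + 1)) 0 (m - 1) ≤ d := by
  have hP' := ((h.merge hp).mixPred c hk).row i (i + 1)
  have hP := (h.mixPred c hk).row (skipIndex p i) (skipIndex p (i + 1))
  have h1 : chainLength (BlockMixed c k (bd ∘ skipIndex p) i (i + 1)) 0 (m - 1) ≤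
      chainLength (BlockMixed c k bd (skipIndex p i) (skipIndex p (i + 1))) 0 m := by
    rw [← intervalChain_iff hP]
    have := IntervalChain.comap (P := BlockMixed c k bd (skipIndex p i) (skipIndex p (i + 1)))
      (skipIndex_monotone p) (intervalChain_chainLength hP' 0 (m - 1))
    have e1 : skipIndex p (m - 1) = m := by simp only [skipIndex]; split_ifs <;> omega
    have e2 : skipIndex p 0 = 0 := by simp [skipIndex]
    rwa [e1, e2] at this
  refine h1.trans ?_
  rcases lt_trichotomy i p with hip | rfl | hip
  · rw [skipIndex, if_pos hip.le, skipIndex, if_pos (show i + 1 ≤ p from hip)]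
    exact hd i (by omega)
  · rw [skipIndex, if_pos le_rfl, skipIndex, if_neg (by omega)]
    exact hpd
  · rw [skipIndex, if_neg (by omega), skipIndex, if_neg (by omega)]
    exact hd (i + 1) (by omega)

theorem IsDivision.partIndex_merge {n m p : ℕ} {bd : ℕ → ℕ} (h : IsDivision n m bd)
    (hp : p + 2 ≤ m) {x : ℕ} (hx : x < n) (i : ℕ) : partIndex n (bd ∘ skipIndex p) x = i ↔
      skipIndex p i ≤ partIndex n bd x ∧ partIndex n bd x < skipIndex p (i + 1) := by
  rw [(h.merge hp).partIndex_eq_iff hx, ← h.bd_le_iff hx, ← h.lt_bd_iff hx]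
  rfl

/-- Merging enlarges blocks, so a block unmixed afterwards consists of blocks that were unmixed
before: fewer agreements are demanded. -/
theorem IsDivision.similar_merge {n m p : ℕ} {bd : ℕ → ℕ} (h : IsDivision n m bd)
    (c : ℕ → ℕ → ℕ) {k : ℕ} (hk : 2 ≤ k) (hp : p + 2 ≤ m) {x x' : ℕ} (hx : x < n) (hx' : x' < n)
    (hs : SimilarRows c n k bd x x') : SimilarRows c n k (bd ∘ skipIndex p) x x' := by
  have hloc : ∀ z < n, bd (skipIndex p (partIndex n (bd ∘ skipIndex p) z)) ≤
      bd (partIndex n bd z) ∧ bd (partIndex n bd z + 1) ≤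
        bd (skipIndex p (partIndex n (bd ∘ skipIndex p) z + 1)) := fun z hz => by
    have := (h.partIndex_merge hp hz _).1 rfl
    exact ⟨h.monotone this.1, h.monotone this.2⟩
  refine ⟨?_, fun y hy hne hmix => hs.2 y hy ?_ ?_⟩
  · rw [h.partIndex_merge hp hx, hs.1, ← h.partIndex_merge hp hx']
  · intro heq
    apply hne
    rw [h.partIndex_merge hp hy, heq, ← h.partIndex_merge hp hx]
  · intro hm
    exact hmix ((mixPred_mixed c hk).mono (hloc x hx).1 (hloc x hx).2 (hloc y hy).1 (hloc y hy).2 hm)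

theorem card_labels_merge_le {m p : ℕ} {bd : ℕ → ℕ} (hp : p + 2 ≤ m) {lab : ℕ → ℕ} {K : ℕ}
    (hK : ∀ i < m, ((Finset.Ico (bd i) (bd (i + 1))).image lab).card ≤ K) {i : ℕ}
    (hi : i < m - 1) : ((Finset.Ico ((bd ∘ skipIndex p) i) ((bd ∘ skipIndex p) (i + 1))).image
      lab).card ≤ 2 * K := by
  classical
  have h0 : skipIndex p i + 1 ≤ skipIndex p (i + 1) ∧ skipIndex p (i + 1) ≤ m ∧
      (skipIndex p (i + 1) = skipIndex p i + 1 ∨ skipIndex p (i + 1) = skipIndex p i + 2) := by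
    simp only [skipIndex]
    split_ifs <;> omega
  simp only [Function.comp]
  rcases h0.2.2 with e | e
  · rw [e]
    have := hK (skipIndex p i) (by omega)
    omega
  · rw [e]
    have h1 := hK (skipIndex p i) (by omega)
    have h2 := hK (skipIndex p i + 1) (by omega)
    have hsub : (Finset.Ico (bd (skipIndex p i)) (bd (skipIndex p i + 2))).image lab ⊆
        (Finset.Ico (bd (skipIndex p i)) (bd (skipIndex p i + 1))).image lab ∪
        (Finset.Ico (bd (skipIndex p i + 1)) (bd (skipIndex p i + 1 + 1))).image lab := by
      rw [← Finset.image_union]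
      refine Finset.image_subset_image fun x hx => ?_
      simp only [Finset.mem_union, Finset.mem_Ico] at hx ⊢
      rw [show skipIndex p i + 1 + 1 = skipIndex p i + 2 from rfl]
      omega
    have := (Finset.card_le_card hsub).trans (Finset.card_union_le _ _)
    omega

/-- The red-degree of a labelling between the classes of similar elements for a division and those
for the division in which two intervals are merged. -/
theorem IsDivision.card_redLabels_merge_le {n m p : ℕ} {bd : ℕ → ℕ} (h : IsDivision n m bd)
    {c : ℕ → ℕ → ℕ} (hsymm : ∀ x y x' y', c x y = c x' y' → c y x = c y' x') {k d : ℕ}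
    (hk : 2 ≤ k) (hp : p + 2 ≤ m)
    (hd : ∀ i < m, chainLength (BlockMixed c k bd i (i + 1)) 0 m ≤ d)
    (hpd : chainLength (BlockMixed c k bd p (p + 2)) 0 m ≤ d) {lab : ℕ → ℕ}
    (hlab : ∀ x < n, ∀ x' < n, SimilarRows c n k bd x x' → lab x = lab x')
    (hlab' : ∀ x < n, ∀ x' < n, lab x = lab x' → SimilarRows c n k (bd ∘ skipIndex p) x x')
    {x : ℕ} (hx : x < n) :
    (redLabels c n lab (lab x)).card ≤ (d + 1) * (2 * k ^ (2 * d + 1)) :=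
  (h.merge hp).card_redLabels_le hsymm hk hlab'
    (fun _ hi => h.chainLength_merge_le c hk hp hd hpd hi)
    (fun _ hi => card_labels_merge_le (bd := bd) hp
      (fun j hj => h.card_labels_le c hk hlab (hd j hj)) hi) hx

/-! ### A language of bounded loops and its compilation -/

/-- Expressions over a list of local variables and the arrays of the machine. Loops run for a fixed
number `N` of rounds. -/
inductive RamExpr where
  | var (i : ℕ) : RamExpr
  | const (c : ℕ) : RamExpr
  | add (x y : RamExpr) : RamExpr
  | sub (x y : RamExpr) : RamExpr
  | read (a : ℕ) (x : RamExpr) : RamExpr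
  | ite (b x y : RamExpr) : RamExpr
  /-- The sum over all values `< N` of a new variable. -/
  | sum (x : RamExpr) : RamExpr
  /-- `N`-fold iteration; the round number and the current value are new variables. -/
  | iter (x y : RamExpr) : RamExpr
  /-- The value of `f` if the local variables are given the values of `x`, `y`, `z`, `w`. -/
  | call (f x y z w : RamExpr) : RamExpr

/-- Commands that change the arrays. -/
inductive RamCmd where
  | skip : RamCmd
  | write (a : ℕ) (x y : RamExpr) : RamCmd
  | seq (p q : RamCmd) : RamCmd
  | ite (b : RamExpr) (p q : RamCmd) : RamCmd
  /-- `p` is executed for all values `< N` of a new variable. -/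
  | loop (p : RamCmd) : RamCmd

/-- The value of an expression. -/
def RamExpr.eval (N : ℕ) (A : ℕ → ℕ → ℕ) : RamExpr → List ℕ → ℕ
  | var i, v => v.getD i 0
  | const c, _ => c
  | add x y, v => x.eval N A v + y.eval N A v
  | sub x y, v => x.eval N A v - y.eval N A v
  | read a x, v => A a (x.eval N A v)
  | ite b x y, v => if b.eval N A v ≠ 0 then x.eval N A v else y.eval N A v
  | sum x, v => ∑ i ∈ Finset.range N, x.eval N A (i :: v)
  | iter x y, v => Nat.rec (x.eval N A v) (fun i r => y.eval N A (i :: r :: v)) N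
  | call f x y z w, v =>
    f.eval N A [x.eval N A v, y.eval N A v, z.eval N A v, w.eval N A v]

/-- The array `A` with the contents of cell `i` of array `a` replaced. -/
def setCell (A : ℕ → ℕ → ℕ) (a i x : ℕ) : ℕ → ℕ → ℕ :=
  Function.update A a (Function.update (A a) i x)

/-- The effect of a command on the arrays. -/
def RamCmd.exec (N : ℕ) : RamCmd → List ℕ → (ℕ → ℕ → ℕ) → ℕ → ℕ → ℕ
  | skip, _, A => A
  | write a x y, v, A => setCell A a (x.eval N A v) (y.eval N A v)
  | seq p q, v, A => q.exec N v (p.exec N v A)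
  | ite b p q, v, A => if b.eval N A v ≠ 0 then p.exec N v A else q.exec N v A
  | loop p, v, A => Nat.rec A (fun i B => p.exec N (i :: v) B) N

/-- A loop in which register `i` counts from `0` to the contents of register `0`. Register `2`
contains `1`. -/
def countLoop (i f : ℕ) (p : RamProg) : RamProg :=
  .seq (.const i 0) (.seq (.sub f 0 i)
    (.loop f (.seq p (.seq (.add i i 2) (.sub f 0 i)))))

/-- The program that puts the value of an expression into register `tp`. The local variables are in
the registers `locs`, the registers from `tp` on may be used. -/
def RamExpr.compile : RamExpr → List ℕ → ℕ → RamProg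
  | var i, locs, tp => match locs[i]? with
    | some r => .add tp r 1
    | none => .const tp 0
  | const c, _, tp => .const tp c
  | add x y, locs, tp =>
    .seq (x.compile locs tp) (.seq (y.compile locs (tp + 1)) (.add tp tp (tp + 1)))
  | sub x y, locs, tp =>
    .seq (x.compile locs tp) (.seq (y.compile locs (tp + 1)) (.sub tp tp (tp + 1)))
  | read a x, locs, tp => .seq (x.compile locs tp) (.read tp a tp)
  | ite b x y, locs, tp =>
    .seq (b.compile locs tp) (.ite tp (x.compile locs tp) (y.compile locs tp))
  | sum x, locs, tp => .seq (.const tp 0) (countLoop (tp + 1) (tp + 2)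
      (.seq (x.compile ((tp + 1) :: locs) (tp + 2)) (.add tp tp (tp + 2))))
  | iter x y, locs, tp => .seq (x.compile locs tp) (countLoop (tp + 1) (tp + 2)
      (.seq (y.compile ((tp + 1) :: tp :: locs) (tp + 2)) (.add tp (tp + 2) 1)))
  | call f x y z w, locs, tp =>
    .seq (x.compile locs tp) (.seq (y.compile locs (tp + 1)) (.seq (z.compile locs (tp + 2))
      (.seq (w.compile locs (tp + 3)) (.seq (f.compile [tp, tp + 1, tp + 2, tp + 3] (tp + 4))
        (.add tp (tp + 4) 1)))))

/-- The program for a command. -/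
def RamCmd.compile : RamCmd → List ℕ → ℕ → RamProg
  | skip, _, _ => .skip
  | write a x y, locs, tp =>
    .seq (x.compile locs tp) (.seq (y.compile locs (tp + 1)) (.write a tp (tp + 1)))
  | seq p q, locs, tp => .seq (p.compile locs tp) (q.compile locs tp)
  | ite b p q, locs, tp =>
    .seq (b.compile locs tp) (.ite tp (p.compile locs tp) (q.compile locs tp))
  | loop p, locs, tp => countLoop tp (tp + 1) (p.compile (tp :: locs) (tp + 1))

open Polynomial in
/-- A bound on the running time of `RamExpr.compile`. -/
noncomputable def RamExpr.cost : RamExpr → Polynomial ℕ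
  | var _ => 1
  | const _ => 1
  | add x y => x.cost + y.cost + 1
  | sub x y => x.cost + y.cost + 1
  | read _ x => x.cost + 1
  | ite b x y => b.cost + x.cost + y.cost + 1
  | sum x => X * (x.cost + 4) + 4
  | iter x y => x.cost + X * (y.cost + 4) + 4
  | call f x y z w => f.cost + x.cost + y.cost + z.cost + w.cost + 1

open Polynomial in
/-- A bound on the running time of `RamCmd.compile`. -/
noncomputable def RamCmd.cost : RamCmd → Polynomial ℕ
  | skip => 1
  | write _ x y => x.cost + y.cost + 1
  | seq p q => p.cost + q.cost
  | ite b p q => b.cost + p.cost + q.cost + 1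
  | loop p => X * (p.cost + 3) + 3

/-- The constants that compiled programs rely on. -/
structure RamState.Ready (N : ℕ) (s : RamState) : Prop where
  bound : s.reg 0 = N
  zero : s.reg 1 = 0
  one : s.reg 2 = 1

theorem RamState.Ready.congr {N tp : ℕ} {s s' : RamState} (h : s.Ready N) (htp : 3 ≤ tp)
    (hs : ∀ r < tp, s'.reg r = s.reg r) : s'.Ready N :=
  ⟨(hs 0 (by omega)).trans h.bound, (hs 1 (by omega)).trans h.zero, (hs 2 (by omega)).trans h.one⟩

theorem RamState.setReg_reg (s : RamState) (x v r : ℕ) :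
    (s.setReg x v).reg r = if r = x then v else s.reg r := by
  simp [setReg, Function.update_apply]

theorem RamState.setReg_arr (s : RamState) (x v : ℕ) : (s.setReg x v).arr = s.arr := rfl

/-- Register `f` holds the number of remaining rounds, so a test for zero ends the loop. The
invariant is required after the update of `i` and for every value of `f`, which frees it from
describing `f`. -/
theorem runs_countLoop {N i f B : ℕ} {p : RamProg} (hif : i ≠ f) (hi : 3 ≤ i) (hf : 3 ≤ f)
    (I : ℕ → RamState → Prop)
    (hstep : ∀ j < N, ∀ s, I j s → s.reg i = j → s.Ready N → ∃ T s', p.Runs s T s' ∧ T ≤ B ∧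
      s'.reg i = j ∧ s'.Ready N ∧ ∀ v, I (j + 1) ((s'.setReg i (j + 1)).setReg f v))
    {s : RamState} (hs : s.Ready N) (h0 : ∀ v, I 0 ((s.setReg i 0).setReg f v)) :
    ∃ T s', (countLoop i f p).Runs s T s' ∧ T ≤ N * (B + 3) + 3 ∧ s'.Ready N ∧ I N s' := by
  have key : ∀ d j s, j + d = N → I j s → s.reg i = j → s.reg f = d → s.Ready N → ∃ T s',
      (RamProg.loop f (.seq p (.seq (.add i i 2) (.sub f 0 i)))).Runs s T s' ∧
        T ≤ d * (B + 3) + 1 ∧ s'.Ready N ∧ I N s' := by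
    intro d
    induction d with
    | zero =>
      intro j s hj hI _ hfd hr
      obtain rfl : j = N := by omega
      exact ⟨1, s, .loop_exit hfd, by omega, hr, hI⟩
    | succ d ih =>
      intro j s hj hI hij hfd hr
      obtain ⟨T, s', h1, h2, h3, h4, h5⟩ := hstep j (by omega) s hI hij hr
      have e1 := RamProg.Runs.add s' i i 2
      rw [h3, h4.one] at e1
      have e2 := RamProg.Runs.sub (s'.setReg i (j + 1)) f 0 i
      have e3 : (s'.setReg i (j + 1)).reg 0 = N := by
        rw [RamState.setReg_reg, if_neg (by omega), h4.bound]
      have e4 : (s'.setReg i (j + 1)).reg i = j + 1 := by rw [RamState.setReg_reg, if_pos rfl]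
      rw [e3, e4] at e2
      set s₂ := (s'.setReg i (j + 1)).setReg f (N - (j + 1)) with hs₂
      have hr2 : s₂.Ready N := by
        have : ∀ r < 3, s₂.reg r = s'.reg r := fun r hr => by
          rw [hs₂, RamState.setReg_reg, if_neg (by omega), RamState.setReg_reg, if_neg (by omega)]
        exact h4.congr le_rfl this
      obtain ⟨T', s₃, g1, g2, g3, g4⟩ := ih (j + 1) s₂ (by omega) (h5 _)
        (by rw [hs₂, RamState.setReg_reg, if_neg hif, e4])
        (by rw [hs₂, RamState.setReg_reg, if_pos rfl]; omega) hr2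
      refine ⟨_, s₃, .loop_step (by omega) (h1.seq (e1.seq e2)) g1, ?_, g3, g4⟩
      rw [add_mul, one_mul]
      omega
  have e1 := RamProg.Runs.const s i 0
  have e2 := RamProg.Runs.sub (s.setReg i 0) f 0 i
  have e3 : (s.setReg i 0).reg 0 = N := by
    rw [RamState.setReg_reg, if_neg (by omega), hs.bound]
  have e4 : (s.setReg i 0).reg i = 0 := by rw [RamState.setReg_reg, if_pos rfl]
  rw [e3, e4] at e2
  have hr2 : ((s.setReg i 0).setReg f (N - 0)).Ready N := by
    refine hs.congr le_rfl fun r hr => ?_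
    rw [RamState.setReg_reg, if_neg (by omega), RamState.setReg_reg, if_neg (by omega)]
  obtain ⟨T, s', g1, g2, g3, g4⟩ := key N 0 _ (by omega) (h0 (N - 0))
    (by rw [RamState.setReg_reg, if_neg hif, e4]) (by rw [RamState.setReg_reg, if_pos rfl]; omega)
    hr2
  exact ⟨_, s', e1.seq (e2.seq g1), by omega, g3, g4⟩

theorem map_reg_congr {s s' : RamState} {locs v : List ℕ} {tp : ℕ} (hl : ∀ r ∈ locs, r < tp)
    (hs : ∀ r < tp, s'.reg r = s.reg r) (h : locs.map s.reg = v) : locs.map s'.reg = v := by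
  rw [← h]
  exact List.map_congr_left fun r hr => hs r (hl r hr)

/-- Registers below `tp` are preserved, so local variables and earlier partial results survive the
evaluation of subexpressions at higher `tp`. This is what makes the induction compositional. -/
theorem RamExpr.compile_spec (N : ℕ) (x : RamExpr) : ∀ (v locs : List ℕ) (tp : ℕ) (s : RamState),
    s.Ready N → 3 ≤ tp → (∀ r ∈ locs, r < tp) → locs.map s.reg = v →
    ∃ T s', (x.compile locs tp).Runs s T s' ∧ T ≤ x.cost.eval N ∧ s'.arr = s.arr ∧
      s'.reg tp = x.eval N s.arr v ∧ ∀ r < tp, s'.reg r = s.reg r := by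
  induction x with
  | var i =>
    intro v locs tp s hs htp hl hv
    subst hv
    rcases h : locs[i]? with _ | r
    · refine ⟨1, s.setReg tp 0, ?_, by simp [cost], rfl, ?_, ?_⟩
      · simp only [compile, h]; exact .const _ _ _
      · simp [RamState.setReg_reg, eval, h]
      · intro r hr; rw [RamState.setReg_reg, if_neg (by omega)]
    · refine ⟨1, s.setReg tp (s.reg r + s.reg 1), ?_, by simp [cost], rfl, ?_, ?_⟩
      · simp only [compile, h]; exact .add _ _ _ _
      · simp [RamState.setReg_reg, eval, h, hs.zero]
      · intro r hr; rw [RamState.setReg_reg, if_neg (by omega)]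
  | const c =>
    intro v locs tp s hs htp hl hv
    refine ⟨1, s.setReg tp c, .const _ _ _, by simp [cost], rfl, ?_, ?_⟩
    · simp [RamState.setReg_reg, eval]
    · intro r hr; rw [RamState.setReg_reg, if_neg (by omega)]
  | add x y ihx ihy =>
    intro v locs tp s hs htp hl hv
    obtain ⟨T₁, s₁, a1, a2, a3, a4, a5⟩ := ihx v locs tp s hs htp hl hv
    obtain ⟨T₂, s₂, b1, b2, b3, b4, b5⟩ := ihy v locs (tp + 1) s₁ (hs.congr htp a5) (by omega)
      (fun r hr => (hl r hr).trans (Nat.lt_succ_self _)) (map_reg_congr hl a5 hv)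
    refine ⟨_, _, a1.seq (b1.seq (.add _ _ _ _)), ?_, ?_, ?_, ?_⟩
    · simp only [cost, Polynomial.eval_add, Polynomial.eval_one]; omega
    · rw [RamState.setReg_arr, b3, a3]
    · rw [RamState.setReg_reg, if_pos rfl, b4, b5 tp (by omega), a4, a3]; rfl
    · intro r hr; rw [RamState.setReg_reg, if_neg (by omega), b5 r (by omega), a5 r hr]
  | sub x y ihx ihy =>
    intro v locs tp s hs htp hl hv
    obtain ⟨T₁, s₁, a1, a2, a3, a4, a5⟩ := ihx v locs tp s hs htp hl hv
    obtain ⟨T₂, s₂, b1, b2, b3, b4, b5⟩ := ihy v locs (tp + 1) s₁ (hs.congr htp a5) (by omega)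
      (fun r hr => (hl r hr).trans (Nat.lt_succ_self _)) (map_reg_congr hl a5 hv)
    refine ⟨_, _, a1.seq (b1.seq (.sub _ _ _ _)), ?_, ?_, ?_, ?_⟩
    · simp only [cost, Polynomial.eval_add, Polynomial.eval_one]; omega
    · rw [RamState.setReg_arr, b3, a3]
    · rw [RamState.setReg_reg, if_pos rfl, b4, b5 tp (by omega), a4, a3]; rfl
    · intro r hr; rw [RamState.setReg_reg, if_neg (by omega), b5 r (by omega), a5 r hr]
  | read a x ihx =>
    intro v locs tp s hs htp hl hv
    obtain ⟨T₁, s₁, a1, a2, a3, a4, a5⟩ := ihx v locs tp s hs htp hl hv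
    refine ⟨_, _, a1.seq (.read _ _ _ _), ?_, ?_, ?_, ?_⟩
    · simp only [cost, Polynomial.eval_add, Polynomial.eval_one]; omega
    · rw [RamState.setReg_arr, a3]
    · rw [RamState.setReg_reg, if_pos rfl, a4, a3]; rfl
    · intro r hr; rw [RamState.setReg_reg, if_neg (by omega), a5 r hr]
  | ite b x y ihb ihx ihy =>
    intro v locs tp s hs htp hl hv
    obtain ⟨T₁, s₁, a1, a2, a3, a4, a5⟩ := ihb v locs tp s hs htp hl hv
    have hs1 := hs.congr htp a5
    have hv1 := map_reg_congr hl a5 hv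
    by_cases h : b.eval N s.arr v ≠ 0
    · obtain ⟨T₂, s₂, b1, b2, b3, b4, b5⟩ := ihx v locs tp s₁ hs1 htp hl hv1
      refine ⟨_, s₂, a1.seq (.ite_pos (by rwa [a4]) b1), ?_, by rw [b3, a3], ?_, ?_⟩
      · simp only [cost, Polynomial.eval_add, Polynomial.eval_one]; omega
      · rw [b4, a3, eval, if_pos h]
      · intro r hr; rw [b5 r hr, a5 r hr]
    · obtain ⟨T₂, s₂, b1, b2, b3, b4, b5⟩ := ihy v locs tp s₁ hs1 htp hl hv1
      refine ⟨_, s₂, a1.seq (.ite_neg (by rw [a4]; simpa using h) b1), ?_, by rw [b3, a3], ?_, ?_⟩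
      · simp only [cost, Polynomial.eval_add, Polynomial.eval_one]; omega
      · rw [b4, a3, eval, if_neg h]
      · intro r hr; rw [b5 r hr, a5 r hr]
  | sum x ihx =>
    intro v locs tp s hs htp hl hv
    have hs0 : (s.setReg tp 0).Ready N := hs.congr htp fun r hr => by
      rw [RamState.setReg_reg, if_neg (by omega)]
    obtain ⟨T, s', a1, a2, -, a3, a4, a5⟩ := runs_countLoop (N := N) (i := tp + 1) (f := tp + 2)
      (B := x.cost.eval N + 1)
      (p := .seq (x.compile ((tp + 1) :: locs) (tp + 2)) (.add tp tp (tp + 2)))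
      (by omega) (by omega) (by omega)
      (fun j q => q.arr = s.arr ∧ q.reg tp = ∑ i ∈ Finset.range j, x.eval N s.arr (i :: v) ∧
        ∀ r < tp, q.reg r = s.reg r)
      (by
        rintro j hj q ⟨h1, h2, h3⟩ h4 h5
        obtain ⟨T₂, s₂, b1, b2, b3, b4, b5⟩ := ihx (j :: v) ((tp + 1) :: locs) (tp + 2) q h5
          (by omega) (by
            intro r hr
            rcases List.mem_cons.1 hr with rfl | hr
            · omega
            · have := hl r hr; omega)
          (by rw [List.map_cons, h4, map_reg_congr hl h3 hv])
        have h5' := h5.congr (by omega) b5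
        refine ⟨_, _, b1.seq (.add _ _ _ _), by omega, ?_, ?_, fun w => ⟨?_, ?_, ?_⟩⟩
        · rw [RamState.setReg_reg, if_neg (by omega), b5 _ (by omega), h4]
        · refine h5'.congr (tp := tp) (by omega) fun r hr => ?_
          rw [RamState.setReg_reg, if_neg (by omega)]
        · simp only [RamState.setReg_arr, b3, h1]
        · rw [RamState.setReg_reg, if_neg (by omega), RamState.setReg_reg, if_neg (by omega),
            RamState.setReg_reg, if_pos rfl, b4, b5 tp (by omega), h2, h1, Finset.sum_range_succ]
        · intro r hr
          rw [RamState.setReg_reg, if_neg (by omega), RamState.setReg_reg, if_neg (by omega),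
            RamState.setReg_reg, if_neg (by omega), b5 r (by omega), h3 r hr])
      hs0 (by
        intro w
        refine ⟨rfl, ?_, ?_⟩
        · rw [RamState.setReg_reg, if_neg (by omega), RamState.setReg_reg, if_neg (by omega),
            RamState.setReg_reg, if_pos rfl, Finset.sum_range_zero]
        · intro r hr
          rw [RamState.setReg_reg, if_neg (by omega), RamState.setReg_reg, if_neg (by omega),
            RamState.setReg_reg, if_neg (by omega)])
    refine ⟨_, s', RamProg.Runs.seq (.const _ _ _) a1, ?_, a3, a4, a5⟩
    rw [add_assoc (Polynomial.eval N x.cost) 1 3, show 1 + 3 = 4 from rfl] at a2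
    simp only [cost, Polynomial.eval_add, Polynomial.eval_mul, Polynomial.eval_X,
      Polynomial.eval_ofNat]
    omega
  | iter x y ihx ihy =>
    intro v locs tp s hs htp hl hv
    obtain ⟨T₁, s₁, c1, c2, c3, c4, c5⟩ := ihx v locs tp s hs htp hl hv
    have hs0 : s₁.Ready N := hs.congr htp c5
    obtain ⟨T, s', a1, a2, -, a3, a4, a5⟩ := runs_countLoop (N := N) (i := tp + 1) (f := tp + 2)
      (B := y.cost.eval N + 1)
      (p := .seq (y.compile ((tp + 1) :: tp :: locs) (tp + 2)) (.add tp (tp + 2) 1))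
      (by omega) (by omega) (by omega)
      (fun j q => q.arr = s.arr ∧ q.reg tp = Nat.rec (x.eval N s.arr v)
          (fun i r => y.eval N s.arr (i :: r :: v)) j ∧ ∀ r < tp, q.reg r = s.reg r)
      (by
        rintro j hj q ⟨h1, h2, h3⟩ h4 h5
        obtain ⟨T₂, s₂, b1, b2, b3, b4, b5⟩ := ihy (j :: q.reg tp :: v) ((tp + 1) :: tp :: locs)
          (tp + 2) q h5 (by omega) (by
            intro r hr
            simp only [List.mem_cons] at hr
            rcases hr with rfl | rfl | hr
            · omega
            · omega
            · have := hl r hr; omega)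
          (by rw [List.map_cons, List.map_cons, h4, map_reg_congr hl h3 hv])
        have h5' := h5.congr (by omega) b5
        refine ⟨_, _, b1.seq (.add _ _ _ _), by omega, ?_, ?_, fun w => ⟨?_, ?_, ?_⟩⟩
        · rw [RamState.setReg_reg, if_neg (by omega), b5 _ (by omega), h4]
        · refine h5'.congr (tp := tp) (by omega) fun r hr => ?_
          rw [RamState.setReg_reg, if_neg (by omega)]
        · simp only [RamState.setReg_arr, b3, h1]
        · rw [RamState.setReg_reg, if_neg (by omega), RamState.setReg_reg, if_neg (by omega),
            RamState.setReg_reg, if_pos rfl, b4, h5'.zero, h2, h1, add_zero]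
        · intro r hr
          rw [RamState.setReg_reg, if_neg (by omega), RamState.setReg_reg, if_neg (by omega),
            RamState.setReg_reg, if_neg (by omega), b5 r (by omega), h3 r hr])
      hs0 (by
        intro w
        refine ⟨c3, ?_, ?_⟩
        · rw [RamState.setReg_reg, if_neg (by omega), RamState.setReg_reg, if_neg (by omega)]
          exact c4
        · intro r hr
          rw [RamState.setReg_reg, if_neg (by omega), RamState.setReg_reg, if_neg (by omega),
            c5 r hr])
    refine ⟨_, s', c1.seq a1, ?_, a3, a4, a5⟩
    rw [add_assoc (Polynomial.eval N y.cost) 1 3, show 1 + 3 = 4 from rfl] at a2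
    simp only [cost, Polynomial.eval_add, Polynomial.eval_mul, Polynomial.eval_X,
      Polynomial.eval_ofNat]
    omega
  | call f x y z w ihf ihx ihy ihz ihw =>
    intro v locs tp s hs htp hl hv
    obtain ⟨T₁, s₁, a1, a2, a3, a4, a5⟩ := ihx v locs tp s hs htp hl hv
    have hs1 := hs.congr htp a5
    obtain ⟨T₂, s₂, b1, b2, b3, b4, b5⟩ := ihy v locs (tp + 1) s₁ hs1 (by omega)
      (fun r hr => by have := hl r hr; omega) (map_reg_congr hl a5 hv)
    have hs2 := hs1.congr (by omega) b5
    have k2 : ∀ r < tp, s₂.reg r = s.reg r := fun r hr => by rw [b5 r (by omega), a5 r hr]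
    obtain ⟨T₃, s₃, c1, c2, c3, c4, c5⟩ := ihz v locs (tp + 2) s₂ hs2 (by omega)
      (fun r hr => by have := hl r hr; omega) (map_reg_congr hl k2 hv)
    have hs3 := hs2.congr (by omega) c5
    have k3 : ∀ r < tp, s₃.reg r = s.reg r := fun r hr => by rw [c5 r (by omega), k2 r hr]
    obtain ⟨T₄, s₄, d1, d2, d3, d4, d5⟩ := ihw v locs (tp + 3) s₃ hs3 (by omega)
      (fun r hr => by have := hl r hr; omega) (map_reg_congr hl k3 hv)
    have hs4 := hs3.congr (by omega) d5
    obtain ⟨T₅, s₅, e1, e2, e3, e4, e5⟩ := ihf _ [tp, tp + 1, tp + 2, tp + 3] (tp + 4) s₄ hs4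
      (by omega) (by simp) rfl
    have hs5 := hs4.congr (by omega) e5
    refine ⟨_, _, a1.seq (b1.seq (c1.seq (d1.seq (e1.seq (.add _ _ _ _))))), ?_, ?_, ?_, ?_⟩
    · simp only [cost, Polynomial.eval_add, Polynomial.eval_one]; omega
    · rw [RamState.setReg_arr, e3, d3, c3, b3, a3]
    · rw [RamState.setReg_reg, if_pos rfl, hs5.zero, e4, add_zero, eval]
      congr 1
      · rw [d3, c3, b3, a3]
      · simp only [List.map_cons, List.map_nil]
        rw [d4, d5 (tp + 2) (by omega), c4, d5 (tp + 1) (by omega), c5 (tp + 1) (by omega), b4,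
          d5 tp (by omega), c5 tp (by omega), b5 tp (by omega), a4, c3, b3, a3]
    · intro r hr
      rw [RamState.setReg_reg, if_neg (by omega), e5 r (by omega), d5 r (by omega), k3 r hr]

theorem RamCmd.compile_spec (N : ℕ) (p : RamCmd) : ∀ (v locs : List ℕ) (tp : ℕ) (s : RamState),
    s.Ready N → 3 ≤ tp → (∀ r ∈ locs, r < tp) → locs.map s.reg = v →
    ∃ T s', (p.compile locs tp).Runs s T s' ∧ T ≤ p.cost.eval N ∧
      s'.arr = p.exec N v s.arr ∧ ∀ r < tp, s'.reg r = s.reg r := by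
  induction p with
  | skip =>
    intro v locs tp s hs htp hl hv
    exact ⟨1, s, .skip s, by simp [cost], rfl, fun _ _ => rfl⟩
  | write a x y =>
    intro v locs tp s hs htp hl hv
    obtain ⟨T₁, s₁, a1, a2, a3, a4, a5⟩ := x.compile_spec N v locs tp s hs htp hl hv
    obtain ⟨T₂, s₂, b1, b2, b3, b4, b5⟩ := y.compile_spec N v locs (tp + 1) s₁ (hs.congr htp a5)
      (by omega) (fun r hr => (hl r hr).trans (Nat.lt_succ_self _)) (map_reg_congr hl a5 hv)
    refine ⟨_, _, a1.seq (b1.seq (.write _ _ _ _)), ?_, ?_, ?_⟩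
    · simp only [cost, Polynomial.eval_add, Polynomial.eval_one]; omega
    · rw [b4, b5 tp (by omega), a4, a3]
      simp only [RamState.setArr, b3, a3, exec, setCell]
    · intro r hr
      simp only [RamState.setArr]
      rw [b5 r (by omega), a5 r hr]
  | seq p q ihp ihq =>
    intro v locs tp s hs htp hl hv
    obtain ⟨T₁, s₁, a1, a2, a3, a4⟩ := ihp v locs tp s hs htp hl hv
    obtain ⟨T₂, s₂, b1, b2, b3, b4⟩ := ihq v locs tp s₁ (hs.congr htp a4) htp hl
      (map_reg_congr hl a4 hv)
    refine ⟨_, s₂, a1.seq b1, ?_, by rw [b3, a3]; rfl, fun r hr => by rw [b4 r hr, a4 r hr]⟩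
    simp only [cost, Polynomial.eval_add]; omega
  | ite b p q ihp ihq =>
    intro v locs tp s hs htp hl hv
    obtain ⟨T₁, s₁, a1, a2, a3, a4, a5⟩ := b.compile_spec N v locs tp s hs htp hl hv
    have hs1 := hs.congr htp a5
    have hv1 := map_reg_congr hl a5 hv
    by_cases h : b.eval N s.arr v ≠ 0
    · obtain ⟨T₂, s₂, b1, b2, b3, b4⟩ := ihp v locs tp s₁ hs1 htp hl hv1
      refine ⟨_, s₂, a1.seq (.ite_pos (by rwa [a4]) b1), ?_, ?_, ?_⟩
      · simp only [cost, Polynomial.eval_add, Polynomial.eval_one]; omega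
      · rw [b3, a3, exec, if_pos h]
      · intro r hr; rw [b4 r hr, a5 r hr]
    · obtain ⟨T₂, s₂, b1, b2, b3, b4⟩ := ihq v locs tp s₁ hs1 htp hl hv1
      refine ⟨_, s₂, a1.seq (.ite_neg (by rw [a4]; simpa using h) b1), ?_, ?_, ?_⟩
      · simp only [cost, Polynomial.eval_add, Polynomial.eval_one]; omega
      · rw [b3, a3, exec, if_neg h]
      · intro r hr; rw [b4 r hr, a5 r hr]
  | loop p ihp =>
    intro v locs tp s hs htp hl hv
    obtain ⟨T, s', a1, a2, -, a3, a4⟩ := runs_countLoop (N := N) (i := tp) (f := tp + 1)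
      (B := p.cost.eval N) (p := p.compile (tp :: locs) (tp + 1))
      (by omega) (by omega) (by omega)
      (fun j q => q.arr = Nat.rec s.arr (fun i B => p.exec N (i :: v) B) j ∧
        ∀ r < tp, q.reg r = s.reg r)
      (by
        rintro j hj q ⟨h1, h2⟩ h4 h5
        obtain ⟨T₂, s₂, b1, b2, b3, b4⟩ := ihp (j :: v) (tp :: locs) (tp + 1) q h5
          (by omega) (by
            intro r hr
            rcases List.mem_cons.1 hr with rfl | hr
            · omega
            · have := hl r hr; omega)
          (by rw [List.map_cons, h4, map_reg_congr hl h2 hv])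
        refine ⟨_, _, b1, b2, by rw [b4 _ (by omega), h4], h5.congr (by omega) b4,
          fun w => ⟨?_, ?_⟩⟩
        · simp only [RamState.setReg_arr, b3, h1]
        · intro r hr
          rw [RamState.setReg_reg, if_neg (by omega), RamState.setReg_reg, if_neg (by omega),
            b4 r (by omega), h2 r hr])
      hs (by
        intro w
        refine ⟨rfl, ?_⟩
        intro r hr
        rw [RamState.setReg_reg, if_neg (by omega), RamState.setReg_reg, if_neg (by omega)])
    refine ⟨_, s', a1, ?_, a3, a4⟩
    simp only [cost, Polynomial.eval_add, Polynomial.eval_mul, Polynomial.eval_X,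
      Polynomial.eval_ofNat]
    omega

/-! ### Expressions for the algorithm -/

open Classical in
/-- The least end of an interval with property `P` that starts at `x`, or `N` if there is none. -/
noncomputable def nextEnd (P : ℕ → ℕ → Prop) (N x : ℕ) : ℕ :=
  ((Finset.range N).filter fun e => ¬ P x e).card

/-- By monotonicity the ends that fail form an initial segment, so their number is the least end
that succeeds. -/
theorem nextEnd_le_iff {P : ℕ → ℕ → Prop} (hP : IntervalPred P) {N x e : ℕ} (he : e < N) :
    nextEnd P N x ≤ e ↔ P x e := by
  classical
  constructor
  · intro h
    by_contra hn
    have : Finset.range (e + 1) ⊆ (Finset.range N).filter fun e => ¬ P x e := by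
      intro i hi
      rw [Finset.mem_range] at hi
      rw [Finset.mem_filter, Finset.mem_range]
      exact ⟨by omega, fun h' => hn (hP.mono le_rfl (by omega) h')⟩
    have := Finset.card_le_card this
    rw [Finset.card_range] at this
    unfold nextEnd at h
    omega
  · intro h
    have : ((Finset.range N).filter fun e => ¬ P x e) ⊆ Finset.range e := by
      intro i hi
      rw [Finset.mem_filter, Finset.mem_range] at hi
      rw [Finset.mem_range]
      by_contra hcon
      exact hi.2 (hP.mono le_rfl (by omega) h)
    exact (Finset.card_le_card this).trans (Finset.card_range e).le

theorem nextEnd_spec {P : ℕ → ℕ → Prop} (hP : IntervalPred P) {N x : ℕ} (h : nextEnd P N x < N) :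
    P x (nextEnd P N x) := (nextEnd_le_iff hP h).1 le_rfl

/-- The default value `N`, which signals that no end exists, is absorbing under further iteration.
-/
theorem le_iterate_nextEnd {P : ℕ → ℕ → Prop} (hP : IntervalPred P) {N : ℕ} (r : ℕ) {x : ℕ}
    (hx : N ≤ x) : N ≤ (nextEnd P N)^[r] x := by
  induction r generalizing x with
  | zero => exact hx
  | succ r ih =>
    rw [Function.iterate_succ_apply]
    apply ih
    by_contra hcon
    have := hP.lt (nextEnd_spec hP (not_le.1 hcon))
    omega

/-- Choosing the earliest end is optimal, since the rest of a chain may be started earlier. Scanning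
ends below `N + 1` makes `N` a legal end and `N + 1` the sign of failure. -/
theorem intervalChain_iff_iterate {P : ℕ → ℕ → Prop} (hP : IntervalPred P) {N r x : ℕ}
    (hx : x ≤ N) : IntervalChain P N r x ↔ (nextEnd P (N + 1))^[r] x ≤ N := by
  induction r generalizing x with
  | zero => simpa [IntervalChain] using hx
  | succ r ih =>
    rw [Function.iterate_succ_apply]
    rcases Nat.lt_or_ge (nextEnd P (N + 1) x) (N + 1) with h | h
    · rw [← ih (by omega)]
      constructor
      · rintro ⟨e, he, h1, h2⟩
        exact h2.mono_lo hP ((nextEnd_le_iff hP (by omega)).2 h1)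
      · intro h2
        exact ⟨_, by omega, nextEnd_spec hP h, h2⟩
    · have := le_iterate_nextEnd hP r h
      constructor
      · rintro ⟨e, he, h1, h2⟩
        have := (nextEnd_le_iff hP (N := N + 1) (by omega)).2 h1
        omega
      · intro h'
        omega

/-- Loops always run for `N` rounds; the guard `i < j` turns them into `j` iterations, provided that
`j ≤ N`. -/
theorem rec_ite_eq_iterate (f : ℕ → ℕ) (x j N : ℕ) :
    (Nat.rec x (fun i r => if i < j then f r else r) N : ℕ) = f^[min j N] x := by
  induction N with
  | zero => simp
  | succ N ih =>
    simp only [ih]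
    split_ifs with h
    · rw [min_eq_right (by omega), min_eq_right (by omega), Function.iterate_succ_apply']
    · rw [min_eq_left (by omega), min_eq_left (by omega)]

namespace RamExpr

/-- `x < y` (nonzero values represent truth) -/
def lt (x y : RamExpr) : RamExpr := sub y x
/-- `x ≤ y` -/
def le (x y : RamExpr) : RamExpr := sub (add y (const 1)) x
/-- negation -/
def not (x : RamExpr) : RamExpr := sub (const 1) x
/-- conjunction -/
def and (x y : RamExpr) : RamExpr := ite x y (const 0)
/-- disjunction -/
def or (x y : RamExpr) : RamExpr := ite x (const 1) y
/-- `x = y` -/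
def eq (x y : RamExpr) : RamExpr := not (add (sub x y) (sub y x))
/-- the number of values of a new variable with property `x` -/
def count (x : RamExpr) : RamExpr := sum (ite x (const 1) (const 0))
/-- for all values of a new variable -/
def all (x : RamExpr) : RamExpr := not (sum (not x))

variable {N : ℕ} {A : ℕ → ℕ → ℕ} {v : List ℕ}

theorem lt_ne {x y : RamExpr} : (lt x y).eval N A v ≠ 0 ↔ x.eval N A v < y.eval N A v := by
  simp only [lt, eval]; omega

theorem le_ne {x y : RamExpr} : (le x y).eval N A v ≠ 0 ↔ x.eval N A v ≤ y.eval N A v := by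
  simp only [le, eval]; omega

theorem not_ne {x : RamExpr} : (not x).eval N A v ≠ 0 ↔ ¬ x.eval N A v ≠ 0 := by
  simp only [not, eval]; omega

theorem and_ne {x y : RamExpr} :
    (and x y).eval N A v ≠ 0 ↔ x.eval N A v ≠ 0 ∧ y.eval N A v ≠ 0 := by
  simp only [and, eval]; split_ifs <;> tauto

theorem or_ne {x y : RamExpr} :
    (or x y).eval N A v ≠ 0 ↔ x.eval N A v ≠ 0 ∨ y.eval N A v ≠ 0 := by
  simp only [or, eval]; split_ifs <;> simp_all

theorem eq_ne {x y : RamExpr} : (eq x y).eval N A v ≠ 0 ↔ x.eval N A v = y.eval N A v := by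
  simp only [eq, not, eval]; omega

theorem sum_ne {x : RamExpr} :
    (sum x).eval N A v ≠ 0 ↔ ∃ i < N, x.eval N A (i :: v) ≠ 0 := by
  simp [eval, Finset.sum_eq_zero_iff]

theorem all_ne {x : RamExpr} :
    (all x).eval N A v ≠ 0 ↔ ∀ i < N, x.eval N A (i :: v) ≠ 0 := by
  rw [all, not_ne, sum_ne]
  push Not
  refine forall₂_congr fun i _ => ?_
  simp only [not, eval]; omega

theorem eval_count {x : RamExpr} (P : ℕ → Prop) [DecidablePred P]
    (h : ∀ i < N, x.eval N A (i :: v) ≠ 0 ↔ P i) :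
    (count x).eval N A v = ((Finset.range N).filter P).card := by
  simp only [count, eval]
  rw [← Finset.card_filter]
  congr 1
  refine Finset.filter_congr fun i hi => h i (Finset.mem_range.1 hi)

theorem eval_call {f x y z w : RamExpr} : (call f x y z w).eval N A v =
    f.eval N A [x.eval N A v, y.eval N A v, z.eval N A v, w.eval N A v] := rfl

theorem eval_ite {b x y : RamExpr} : (ite b x y).eval N A v =
    if b.eval N A v ≠ 0 then x.eval N A v else y.eval N A v := rfl

theorem eval_iter_iterate {x y b : RamExpr} (f : ℕ → ℕ) (j : ℕ)
    (hb : ∀ i r, b.eval N A (i :: r :: v) ≠ 0 ↔ i < j)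
    (hy : ∀ i r, y.eval N A (i :: r :: v) = f r) :
    (iter x (ite b y (var 1))).eval N A v = f^[min j N] (x.eval N A v) := by
  rw [← rec_ite_eq_iterate]
  simp only [eval]
  congr 1
  funext i r
  simp only [hb, hy, List.getD_cons_succ, List.getD_cons_zero]

end RamExpr

/-- The size `n` of the structure, the bounds `k` and `t` and a matrix of codes are stored in the
arrays `o`, `o + 1`, `o + 2` and `o + 8`. -/
structure StoresMatrix (o : ℕ) (A : ℕ → ℕ → ℕ) (n k t : ℕ) (c : ℕ → ℕ → ℕ) : Prop where
  size : A o 0 = n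
  rows : A (o + 1) 0 = k
  parts : A (o + 2) 0 = t
  code : ∀ p < n, ∀ q < n, A (o + 8) (n * p + q) = c p q

/-- The boundaries of a division are stored in array `o + 9`. -/
def StoresDivision (o : ℕ) (A : ℕ → ℕ → ℕ) (n : ℕ) (bd : ℕ → ℕ) : Prop :=
  ∀ i, (if i < n then A (o + 9) i else n) = bd i

namespace RamExpr

variable (o : ℕ)

/-- `n` -/
def sizeE : RamExpr := read o (const 0)
/-- `2 * n` -/
def topE : RamExpr := add (sizeE o) (sizeE o)
/-- `n * x` -/
def mulE : RamExpr := sum (ite (lt (var 0) (sizeE o)) (var 1) (const 0))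
/-- `c x y` -/
def codeE (x y : RamExpr) : RamExpr :=
  read (o + 8) (add (call (mulE o) x (const 0) (const 0) (const 0)) y)
/-- `rowCount c a b p q` -/
def rowCountE : RamExpr :=
  count (and (and (le (var 1) (var 0)) (lt (var 0) (var 2)))
    (all (or (not (and (le (var 2) (var 0)) (lt (var 0) (var 1))))
      (sum (and (and (le (var 5) (var 0)) (lt (var 0) (var 6)))
        (not (eq (codeE o (var 2) (var 0)) (codeE o (var 1) (var 0)))))))))
/-- `Mixed c k a b p q` -/
def mixedE : RamExpr :=
  or (le (read (o + 1) (const 0)) (call (rowCountE o) (var 0) (var 1) (var 2) (var 3)))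
    (le (read (o + 1) (const 0)) (call (rowCountE o) (var 2) (var 3) (var 0) (var 1)))
/-- `bd x` -/
def bdE (x : RamExpr) : RamExpr := ite (lt x (sizeE o)) (read (o + 9) x) (sizeE o)
/-- `BlockMixed c k bd a b p q` -/
def blockE : RamExpr :=
  call (mixedE o) (bdE o (var 0)) (bdE o (var 1)) (bdE o (var 2)) (bdE o (var 3))
/-- `partIndex n bd x` -/
def partE (x : RamExpr) : RamExpr :=
  call (count (and (lt (const 0) (var 0)) (le (bdE o (var 0)) (var 1)))) x
    (const 0) (const 0) (const 0)
/-- the next end of a chain for the intervals `p` and `p + 1` -/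
def pairNextE : RamExpr :=
  count (not (call (blockE o) (var 2) (add (var 2) (const 2)) (var 1) (var 0)))
/-- the `j`-th end of a chain for the intervals `p` and `p + 1` -/
def pairIterE : RamExpr :=
  iter (const 0) (ite (lt (var 0) (var 3))
    (call (pairNextE o) (var 1) (var 2) (const 0) (const 0)) (var 1))
/-- the length of a longest chain for the intervals `p` and `p + 1` -/
def pairLengthE (x : RamExpr) : RamExpr :=
  call (count (le (call (pairIterE o) (var 1) (add (var 0) (const 1)) (const 0) (const 0))
    (topE o))) x (const 0) (const 0) (const 0)
/-- a pair of consecutive intervals with number at most `m - 2` with the shortest chains -/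
def bestE : RamExpr :=
  iter (const 0) (ite (and (le (add (var 0) (const 2)) (var 2))
    (lt (pairLengthE o (var 0)) (pairLengthE o (var 1)))) (var 0) (var 1))

variable {o} {A : ℕ → ℕ → ℕ} {n k t : ℕ} {c : ℕ → ℕ → ℕ} {bd : ℕ → ℕ}

theorem eval_sizeE (h : StoresMatrix o A n k t c) {N : ℕ} {v : List ℕ} :
    (sizeE o).eval N A v = n := h.size

theorem eval_topE (h : StoresMatrix o A n k t c) {N : ℕ} {v : List ℕ} :
    (topE o).eval N A v = 2 * n := by
  rw [topE, eval, eval_sizeE h]; omega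

/-- A product by repeated addition: `n` of the `N` summands equal `x`, the others vanish. -/
theorem eval_mulE {N : ℕ} (hs : A o 0 = n) (hN : n ≤ N) (x : ℕ) (v : List ℕ) :
    (mulE o).eval N A (x :: v) = n * x := by
  have : ∀ i, (lt (var 0) (sizeE o)).eval N A (i :: x :: v) ≠ 0 ↔ i < n := fun i => by
    rw [lt_ne, sizeE, eval, eval, eval, hs]; rfl
  simp only [mulE, eval, this, List.getD_cons_succ, List.getD_cons_zero]
  rw [← Finset.sum_filter, Finset.sum_const, smul_eq_mul]
  congr 1
  have : (Finset.range N).filter (fun i => i < n) = Finset.range n := by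
    ext i; simp only [Finset.mem_filter, Finset.mem_range]; omega
  rw [this, Finset.card_range]

theorem eval_codeE {N : ℕ} (h : StoresMatrix o A n k t c) (hN : n ≤ N) {x y : RamExpr}
    {v : List ℕ} (hx : x.eval N A v < n) (hy : y.eval N A v < n) :
    (codeE o x y).eval N A v = c (x.eval N A v) (y.eval N A v) := by
  rw [codeE, eval, eval, eval_call, eval_mulE h.size hN]
  exact h.code _ hx _ hy

theorem eval_rowCountE {N : ℕ} (h : StoresMatrix o A n k t c) (hN : n ≤ N) {a b p q : ℕ}
    (hb : b ≤ n) (hq : q ≤ n) : (rowCountE o).eval N A [a, b, p, q] = rowCount c a b p q := by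
  rw [rowCount_eq_first, rowCountE, eval_count (fun x => (a ≤ x ∧ x < b) ∧
    ∀ x' ∈ Finset.Ico a x, ∃ y ∈ Finset.Ico p q, c x y ≠ c x' y)]
  · congr 1
    ext x
    simp only [Finset.mem_filter, Finset.mem_range, Finset.mem_Ico]
    constructor
    · rintro ⟨-, h⟩; exact h
    · intro h; exact ⟨by omega, h⟩
  · intro x hx
    rw [and_ne, and_ne, le_ne, lt_ne, all_ne]
    refine and_congr_right fun hx' => ?_
    simp only [eval, List.getD_cons_succ, List.getD_cons_zero] at hx'
    constructor
    · intro hall x' hx''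
      rw [Finset.mem_Ico] at hx''
      have := hall x' (by omega)
      rw [or_ne, not_ne, and_ne, le_ne, lt_ne, sum_ne] at this
      simp only [eval, List.getD_cons_succ, List.getD_cons_zero] at this
      obtain ⟨y, hy, h1⟩ := this.resolve_left (by tauto)
      rw [and_ne, and_ne, le_ne, lt_ne, not_ne, eq_ne] at h1
      obtain ⟨h1, h2⟩ := h1
      simp only [eval, List.getD_cons_succ, List.getD_cons_zero] at h1
      rw [eval_codeE h hN (by simp only [eval, List.getD_cons_succ, List.getD_cons_zero]; omega)
        (by simp only [eval, List.getD_cons_zero]; omega),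
        eval_codeE h hN (by simp only [eval, List.getD_cons_succ, List.getD_cons_zero]; omega)
        (by simp only [eval, List.getD_cons_zero]; omega)] at h2
      exact ⟨y, Finset.mem_Ico.2 h1, h2⟩
    · intro hall x' hx''
      rw [or_ne, not_ne, and_ne, le_ne, lt_ne, sum_ne]
      simp only [eval, List.getD_cons_succ, List.getD_cons_zero]
      by_cases hcase : a ≤ x' ∧ x' < x
      · right
        obtain ⟨y, hy, hne⟩ := hall x' (Finset.mem_Ico.2 hcase)
        rw [Finset.mem_Ico] at hy
        refine ⟨y, by omega, ?_⟩
        rw [and_ne, and_ne, le_ne, lt_ne, not_ne, eq_ne,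
          eval_codeE h hN (by simp only [eval, List.getD_cons_succ, List.getD_cons_zero]; omega)
          (by simp only [eval, List.getD_cons_zero]; omega),
          eval_codeE h hN (by simp only [eval, List.getD_cons_succ, List.getD_cons_zero]; omega)
          (by simp only [eval, List.getD_cons_zero]; omega)]
        exact ⟨hy, hne⟩
      · left; exact hcase

theorem mixedE_ne {N : ℕ} (h : StoresMatrix o A n k t c) (hN : n ≤ N) {a b p q : ℕ}
    (hb : b ≤ n) (hq : q ≤ n) : (mixedE o).eval N A [a, b, p, q] ≠ 0 ↔ Mixed c k a b p q := by
  rw [mixedE, or_ne, le_ne, le_ne, eval_call, eval_call]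
  simp only [eval, List.getD_cons_succ, List.getD_cons_zero, h.rows, eval_rowCountE h hN hb hq,
    eval_rowCountE h hN hq hb]
  rfl

theorem eval_bdE {N : ℕ} {v : List ℕ} (h : StoresMatrix o A n k t c)
    (hbd : StoresDivision o A n bd) {x : RamExpr} :
    (bdE o x).eval N A v = bd (x.eval N A v) := by
  rw [← hbd]
  simp only [bdE, eval_ite, lt_ne, eval_sizeE h]
  rfl

theorem blockE_ne {N m : ℕ} (h : StoresMatrix o A n k t c) (hbd : StoresDivision o A n bd)
    (hd : IsDivision n m bd) (hN : n ≤ N) (a b p q : ℕ) :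
    (blockE o).eval N A [a, b, p, q] ≠ 0 ↔ BlockMixed c k bd a b p q := by
  rw [blockE, eval_call, eval_bdE h hbd, eval_bdE h hbd, eval_bdE h hbd, eval_bdE h hbd,
    mixedE_ne h hN (hd.bd_le _) (hd.bd_le _)]
  rfl

theorem eval_partE (h : StoresMatrix o A n k t c) (hbd : StoresDivision o A n bd) {x : RamExpr}
    {v : List ℕ} :
    (partE o x).eval (2 * n + 1) A v = partIndex n bd (x.eval (2 * n + 1) A v) := by
  rw [partE, eval_call, eval_count (fun i => 0 < i ∧ bd i ≤ x.eval (2 * n + 1) A v)]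
  · rfl
  · intro i _
    rw [and_ne, lt_ne, le_ne, eval_bdE h hbd]
    rfl

theorem eval_pairNextE {N m : ℕ} (h : StoresMatrix o A n k t c) (hbd : StoresDivision o A n bd)
    (hd : IsDivision n m bd) (hN : n ≤ N) (x p : ℕ) (v : List ℕ) :
    (pairNextE o).eval N A (x :: p :: v) = nextEnd (BlockMixed c k bd p (p + 2)) N x := by
  classical
  rw [pairNextE, eval_count (fun i => ¬ BlockMixed c k bd p (p + 2) x i)]
  · rfl
  · intro i _
    rw [not_ne, eval_call]
    exact not_congr (blockE_ne h hbd hd hN _ _ _ _)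

theorem eval_pairIterE {N m : ℕ} (h : StoresMatrix o A n k t c) (hbd : StoresDivision o A n bd)
    (hd : IsDivision n m bd) (hN : n ≤ N) (p j : ℕ) (v : List ℕ) :
    (pairIterE o).eval N A (p :: j :: v) =
      (nextEnd (BlockMixed c k bd p (p + 2)) N)^[min j N] 0 := by
  rw [pairIterE, eval_iter_iterate (nextEnd (BlockMixed c k bd p (p + 2)) N) j]
  · rfl
  · intro i r; rw [lt_ne]; rfl
  · intro i r
    rw [eval_call]
    exact eval_pairNextE h hbd hd hN _ _ _

/-- The length of a longest chain is the number of `j` for which a chain of length `j + 1` exists,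
and each existence question is settled by greedy iteration. -/
theorem eval_pairLengthE {m : ℕ} (h : StoresMatrix o A n k t c) (hbd : StoresDivision o A n bd)
    (hd : IsDivision n m bd) (hk : 2 ≤ k) {x : RamExpr} {v : List ℕ} :
    (pairLengthE o x).eval (2 * n + 1) A v = chainLength (BlockMixed c k bd
      (x.eval (2 * n + 1) A v) (x.eval (2 * n + 1) A v + 2)) 0 (2 * n) := by
  set p := x.eval (2 * n + 1) A v with hp
  have hP := (hd.mixPred c hk).row p (p + 2)
  have hle := chainLength_le hP 0 (2 * n)
  rw [pairLengthE, eval_call, ← hp,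
    eval_count (fun j => j < chainLength (BlockMixed c k bd p (p + 2)) 0 (2 * n))]
  · have : (Finset.range (2 * n + 1)).filter
        (fun j => j < chainLength (BlockMixed c k bd p (p + 2)) 0 (2 * n)) =
        Finset.range (chainLength (BlockMixed c k bd p (p + 2)) 0 (2 * n)) := by
      ext j; simp only [Finset.mem_filter, Finset.mem_range]; omega
    rw [this, Finset.card_range]
  · intro j hj
    rw [le_ne, eval_call, eval_topE h, ← Nat.succ_le_iff, ← intervalChain_iff hP,
      intervalChain_iff_iterate hP (Nat.zero_le _)]
    have := eval_pairIterE h hbd hd (N := 2 * n + 1) (by omega) p (j + 1) [0, 0]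
    rw [min_eq_left (by omega)] at this
    rw [← this]
    rfl

/-- A running minimum. The initial value `0` is an admissible pair because `2 ≤ m`. -/
theorem eval_bestE {m : ℕ} (h : StoresMatrix o A n k t c) (hbd : StoresDivision o A n bd)
    (hd : IsDivision n m bd) (hk : 2 ≤ k) (hm : 2 ≤ m) (v : List ℕ) :
    ∃ p, (bestE o).eval (2 * n + 1) A (m :: v) = p ∧ p + 2 ≤ m ∧ ∀ i, i + 2 ≤ m →
      chainLength (BlockMixed c k bd p (p + 2)) 0 (2 * n) ≤
        chainLength (BlockMixed c k bd i (i + 2)) 0 (2 * n) := by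
  set L := fun p => chainLength (BlockMixed c k bd p (p + 2)) 0 (2 * n) with hL
  have key : ∀ N', ∃ p, (Nat.rec 0 (fun i r => if i + 2 ≤ m ∧ L i < L r then i else r) N' : ℕ) = p ∧
      p + 2 ≤ m ∧ ∀ i < N', i + 2 ≤ m → L p ≤ L i := by
    intro N'
    induction N' with
    | zero => exact ⟨0, rfl, hm, fun i hi => by omega⟩
    | succ N' ih =>
      obtain ⟨p, h1, h2, h3⟩ := ih
      simp only [h1]
      split_ifs with hc
      · refine ⟨N', rfl, hc.1, fun i hi him => ?_⟩
        rcases Nat.lt_or_ge i N' with h | h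
        · exact hc.2.le.trans (h3 i h him)
        · obtain rfl : i = N' := by omega
          exact le_rfl
      · refine ⟨p, rfl, h2, fun i hi him => ?_⟩
        rcases Nat.lt_or_ge i N' with h | h
        · exact h3 i h him
        · obtain rfl : i = N' := by omega
          by_contra hcon
          exact hc ⟨him, by omega⟩
  obtain ⟨p, h1, h2, h3⟩ := key (2 * n + 1)
  refine ⟨p, ?_, h2, fun i hi => h3 i ?_ hi⟩
  · rw [← h1, bestE]
    simp only [eval, and_ne, le_ne, lt_ne, eval_pairLengthE h hbd hd hk,
      List.getD_cons_succ, List.getD_cons_zero, hL]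
  · have := hd.le; omega

end RamExpr

/-! ### Expressions for the search of minors and the merging of classes -/

namespace RamExpr

/-- `x / 2` -/
def halfE (x : RamExpr) : RamExpr :=
  call (count (le (add (add (var 0) (var 0)) (const 2)) (var 1))) x (const 0) (const 0) (const 0)
/-- `x / 2 ^ b` -/
def shrE (x b : RamExpr) : RamExpr :=
  call (iter (var 0) (ite (lt (var 0) (var 3)) (halfE (var 1)) (var 1))) x b (const 0) (const 0)
/-- `x * 2 ^ b` -/
def shlE (x b : RamExpr) : RamExpr :=
  call (iter (var 0) (ite (lt (var 0) (var 3)) (add (var 1) (var 1)) (var 1))) x b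
    (const 0) (const 0)
/-- `x` is odd -/
def oddE (x : RamExpr) : RamExpr := sub x (add (halfE x) (halfE x))
/-- `u ∈ cutSet x y` -/
def cutE (u x y : RamExpr) : RamExpr :=
  call (sum (and (oddE (shrE (var 3) (var 0))) (eq (var 1)
    (shlE (add (add (shrE (var 2) (add (var 0) (const 1))) (shrE (var 2) (add (var 0) (const 1))))
      (const 1)) (var 0))))) u x y (const 0)

variable (o : ℕ)

/-- `u` is an end of one of the intervals into which the cuts divide `[0, 2 * n)` -/
def cutOrEndE (u x y : RamExpr) : RamExpr := or (eq u (const 0)) (or (eq u (topE o)) (cutE u x y))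
/-- the intervals with numbers in `[a, b)` are mixed with all intervals between cuts -/
def goodE : RamExpr :=
  all (all (or (not (and (lt (var 1) (var 0))
      (and (cutOrEndE o (var 1) (var 4) (var 5)) (cutOrEndE o (var 0) (var 4) (var 5)))))
    (call (blockE o) (var 2) (var 3) (var 1) (var 0))))
/-- the next end of a chain of such intervals -/
def rowNextE : RamExpr := count (not (call (goodE o) (var 1) (var 0) (var 2) (var 3)))
/-- the `j`-th end of a chain of such intervals -/
def rowIterE (j x y : RamExpr) : RamExpr :=
  call (iter (const 0) (ite (lt (var 0) (var 2))
    (call (rowNextE o) (var 1) (var 3) (var 4) (const 0)) (var 1))) j x y (const 0)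
/-- the cuts `x, y` admit a minor -/
def foundE : RamExpr :=
  and (le (read (o + 2) (const 0)) (add (const 1)
      (count (and (lt (var 0) (topE o)) (cutE (var 0) (var 1) (var 2))))))
    (le (rowIterE o (read (o + 2) (const 0)) (var 0) (var 1)) (topE o))
/-- the minimum of `x` and `t - 1` -/
def capE (x : RamExpr) : RamExpr :=
  sub (sub (read (o + 2) (const 0)) (const 1))
    (sub (sub (read (o + 2) (const 0)) (const 1)) x)
/-- the number of the part of a row of the minor -/
def rowLabelE : RamExpr :=
  capE o (count (le (bdE o (rowIterE o (add (var 0) (const 1)) (var 2) (var 3))) (var 1)))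
/-- the number of the part of a column of the minor -/
def colLabelE : RamExpr :=
  capE o (count (and (and (lt (var 0) (topE o)) (cutE (var 0) (var 2) (var 3)))
    (le (bdE o (var 0)) (var 1))))
/-- `SimilarRows c n k bd x x'` -/
def similarE : RamExpr :=
  and (eq (partE o (var 0)) (partE o (var 1)))
    (all (or (not (lt (var 0) (sizeE o))) (or (eq (partE o (var 0)) (partE o (var 1)))
      (or (call (blockE o) (partE o (var 1)) (add (partE o (var 1)) (const 1)) (partE o (var 0))
        (add (partE o (var 0)) (const 1))) (eq (codeE o (var 1) (var 0)) (codeE o (var 2) (var 0)))))))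

variable {o} {A : ℕ → ℕ → ℕ} {n k t : ℕ} {c : ℕ → ℕ → ℕ} {bd : ℕ → ℕ} {v : List ℕ}

/-- The condition `2 * i + 2 ≤ x` holds for exactly `x / 2` values of `i`; the assumption `x ≤ 2 *
N` ensures that all of them are below `N`. -/
theorem eval_halfE {N : ℕ} {x : RamExpr} (hx : x.eval N A v ≤ 2 * N) :
    (halfE x).eval N A v = x.eval N A v / 2 := by
  rw [halfE, eval_call, eval_count (fun i => i < x.eval N A v / 2)]
  · have : (Finset.range N).filter (fun i => i < x.eval N A v / 2) =
        Finset.range (x.eval N A v / 2) := by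
      ext i; simp only [Finset.mem_filter, Finset.mem_range]; omega
    rw [this, Finset.card_range]
  · intro i _
    rw [le_ne]
    simp only [eval, List.getD_cons_succ, List.getD_cons_zero]
    omega

theorem iterate_half (b x : ℕ) : (fun r => r / 2)^[b] x = x / 2 ^ b := by
  induction b generalizing x with
  | zero => simp
  | succ b ih => rw [Function.iterate_succ_apply, ih, Nat.div_div_eq_div_mul, pow_succ']

theorem rec_half_le {N b x : ℕ} (i : ℕ) (hx : x ≤ 2 * N) :
    (Nat.rec x (fun i r => if i < b then r / 2 else r) i : ℕ) ≤ 2 * N := by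
  induction i with
  | zero => exact hx
  | succ i ih =>
    simp only
    split_ifs
    · exact (Nat.div_le_self _ _).trans ih
    · exact ih

/-- Halving is evaluated correctly only for arguments up to `2 * N`, so `eval_iter_iterate`, which
asks for correctness at every value, does not apply. The bound is carried through the iteration by
`rec_half_le`. -/
theorem eval_shrE {N : ℕ} {x b : RamExpr} (hx : x.eval N A v ≤ 2 * N) (hb : b.eval N A v ≤ N) :
    (shrE x b).eval N A v = x.eval N A v / 2 ^ b.eval N A v := by
  rw [← iterate_half, ← min_eq_left hb, ← rec_ite_eq_iterate]
  have key : ∀ M, (Nat.rec (x.eval N A v) (fun i r => (ite (lt (var 0) (var 3)) (halfE (var 1))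
      (var 1)).eval N A (i :: r :: [x.eval N A v, b.eval N A v, 0, 0])) M : ℕ) =
      Nat.rec (x.eval N A v) (fun i r => if i < b.eval N A v then r / 2 else r) M := by
    intro M
    induction M with
    | zero => rfl
    | succ M ih =>
      simp only [ih]
      have hle := rec_half_le (b := b.eval N A v) M hx
      generalize (Nat.rec (x.eval N A v) (fun i r => if i < b.eval N A v then r / 2 else r) M : ℕ) = r
        at hle
      have h1 := eval_halfE (x := var 1) (A := A) (v := M :: r :: [x.eval N A v, b.eval N A v, 0, 0])
        (N := N) (by simpa [eval] using hle)
      simp only [eval_ite, lt_ne, h1]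
      rfl
  exact key N

theorem eval_shlE {N : ℕ} {x b : RamExpr} (hb : b.eval N A v ≤ N) :
    (shlE x b).eval N A v = x.eval N A v * 2 ^ b.eval N A v := by
  have h : ∀ b x, (fun r : ℕ => r + r)^[b] x = x * 2 ^ b := by
    intro b
    induction b with
    | zero => simp
    | succ b ih => intro x; rw [Function.iterate_succ_apply, ih, pow_succ]; ring
  rw [shlE, eval_call, eval_iter_iterate (fun r => r + r) (b.eval N A v), min_eq_left hb, h]
  · rfl
  · intro i r; rw [lt_ne]; rfl
  · intro i r; rfl

theorem oddE_ne {N : ℕ} {x : RamExpr} (hx : x.eval N A v ≤ 2 * N) :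
    (oddE x).eval N A v ≠ 0 ↔ x.eval N A v % 2 = 1 := by
  simp only [oddE, eval, eval_halfE hx]; omega

theorem cutE_ne {N : ℕ} {u x y : RamExpr} (hx : x.eval N A v < N) (hy : y.eval N A v < N) :
    (cutE u x y).eval N A v ≠ 0 ↔ u.eval N A v ∈ cutSet (x.eval N A v) (y.eval N A v) := by
  rw [cutE, eval_call, sum_ne, mem_cutSet]
  set U := u.eval N A v
  set X := x.eval N A v
  set Y := y.eval N A v
  have key : ∀ b < N, ((and (oddE (shrE (var 3) (var 0))) (eq (var 1)
    (shlE (add (add (shrE (var 2) (add (var 0) (const 1))) (shrE (var 2) (add (var 0) (const 1))))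
      (const 1)) (var 0)))).eval N A (b :: [U, X, Y, 0]) ≠ 0 ↔
      Y.testBit b ∧ U = cutPoint X b) := by
    intro b hb
    have e1 : (shrE (var 3) (var 0)).eval N A (b :: [U, X, Y, 0]) =
        Y / 2 ^ b := eval_shrE (by simp [eval]; omega) (by simp [eval]; omega)
    have e2 : (shrE (var 2) (add (var 0) (const 1))).eval N A
        (b :: [U, X, Y, 0]) = X / 2 ^ (b + 1) :=
      eval_shrE (by simp [eval]; omega) (by simp [eval]; omega)
    have hle : Y / 2 ^ b ≤ Y := Nat.div_le_self _ _
    rw [and_ne, oddE_ne (by rw [e1]; omega), e1, eq_ne, eval_shlE (by simp [eval]; omega),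
      Nat.testBit_eq_decide_div_mod_eq, decide_eq_true_eq, cutPoint]
    simp only [eval, e2, List.getD_cons_succ, List.getD_cons_zero]
    rw [two_mul]
  constructor
  · rintro ⟨b, hb, h⟩; exact ⟨b, (key b hb).1 h⟩
  · rintro ⟨b, h1, h2⟩
    -- A binary digit `b` that is set in `Y` satisfies `b < 2 ^ b ≤ Y < N`, so the loop over `b`
    -- reaches every relevant level.
    have hb : b < N := by
      have := Nat.lt_two_pow_self.trans_le (Nat.ge_two_pow_of_testBit h1)
      omega
    exact ⟨b, hb, (key b hb).2 ⟨h1, h2⟩⟩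

end RamExpr

/-- The cuts below `top`. -/
def cutsBelow (top x y : ℕ) : Finset ℕ := (cutSet x y).filter fun u => u < top

namespace RamExpr

variable {o : ℕ} {A : ℕ → ℕ → ℕ} {n k t : ℕ} {c : ℕ → ℕ → ℕ} {bd : ℕ → ℕ} {v : List ℕ}

theorem goodE_ne {m : ℕ} (h : StoresMatrix o A n k t c) (hbd : StoresDivision o A n bd)
    (hd : IsDivision n m bd) {x y : ℕ} (hx : x < 2 * n + 1) (hy : y < 2 * n + 1) (a b : ℕ) :
    (goodE o).eval (2 * n + 1) A [a, b, x, y] ≠ 0 ↔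
      MixedWithAll (BlockMixed c k bd) (cutsBelow (2 * n) x y) (2 * n) a b := by
  have hend : ∀ {w : RamExpr} {l : List ℕ}, w.eval (2 * n + 1) A l < 2 * n + 1 →
      l.getD 4 0 = x → l.getD 5 0 = y →
      ((cutOrEndE o w (var 4) (var 5)).eval (2 * n + 1) A l ≠ 0 ↔
        w.eval (2 * n + 1) A l ∈ insert 0 (insert (2 * n) (cutsBelow (2 * n) x y))) := by
    intro w l hw h4 h5
    have e4 : (var 4).eval (2 * n + 1) A l = x := h4
    have e5 : (var 5).eval (2 * n + 1) A l = y := h5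
    rw [cutOrEndE, or_ne, or_ne, eq_ne, eq_ne, cutE_ne (by rwa [e4]) (by rwa [e5]), e4, e5,
      eval_topE h, Finset.mem_insert, Finset.mem_insert, cutsBelow, Finset.mem_filter]
    simp only [eval]
    constructor
    · rintro (h | h | h)
      · exact Or.inl h
      · exact Or.inr (Or.inl h)
      · by_cases h' : w.eval (2 * n + 1) A l = 2 * n
        · exact Or.inr (Or.inl h')
        · exact Or.inr (Or.inr ⟨h, by omega⟩)
    · tauto
  have key : ∀ u < 2 * n + 1, ∀ w < 2 * n + 1,
      ((or (not (and (lt (var 1) (var 0))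
        (and (cutOrEndE o (var 1) (var 4) (var 5)) (cutOrEndE o (var 0) (var 4) (var 5)))))
        (call (blockE o) (var 2) (var 3) (var 1) (var 0))).eval (2 * n + 1) A [w, u, a, b, x, y] ≠ 0 ↔
      (u ∈ insert 0 (insert (2 * n) (cutsBelow (2 * n) x y)) →
        w ∈ insert 0 (insert (2 * n) (cutsBelow (2 * n) x y)) → u < w →
          BlockMixed c k bd a b u w)) := by
    intro u hu w hw
    have e1 := hend (w := var 1) (l := [w, u, a, b, x, y]) hu rfl rfl
    have e0 := hend (w := var 0) (l := [w, u, a, b, x, y]) hw rfl rfl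
    have e2 := blockE_ne h hbd hd (N := 2 * n + 1) (by omega) a b u w
    rw [or_ne, not_ne, and_ne, and_ne, lt_ne, e1, e0, eval_call]
    simp only [eval, List.getD_cons_succ, List.getD_cons_zero]
    rw [e2]
    tauto
  have hmem : ∀ u ∈ insert 0 (insert (2 * n) (cutsBelow (2 * n) x y)), u < 2 * n + 1 := by
    intro u hu
    simp only [Finset.mem_insert, cutsBelow, Finset.mem_filter] at hu
    omega
  rw [goodE, all_ne]
  simp only [all_ne]
  constructor
  · intro hall u hu w hw huw
    exact (key u (hmem u hu) w (hmem w hw)).1 (hall u (hmem u hu) w (hmem w hw)) hu hw huw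
  · intro hall u hu w hw
    exact (key u hu w hw).2 fun h1 h2 h3 => hall u h1 w h2 h3

theorem eval_rowNextE {m : ℕ} (h : StoresMatrix o A n k t c) (hbd : StoresDivision o A n bd)
    (hd : IsDivision n m bd) {x y : ℕ} (hx : x < 2 * n + 1) (hy : y < 2 * n + 1) (a : ℕ) :
    (rowNextE o).eval (2 * n + 1) A (a :: x :: y :: v) =
      nextEnd (MixedWithAll (BlockMixed c k bd) (cutsBelow (2 * n) x y) (2 * n)) (2 * n + 1) a := by
  classical
  rw [rowNextE, eval_count (fun e =>
    ¬ MixedWithAll (BlockMixed c k bd) (cutsBelow (2 * n) x y) (2 * n) a e)]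
  · rfl
  · intro e _
    rw [not_ne, eval_call]
    exact not_congr (goodE_ne h hbd hd hx hy a e)

theorem eval_rowIterE {m : ℕ} (h : StoresMatrix o A n k t c) (hbd : StoresDivision o A n bd)
    (hd : IsDivision n m bd) {j x y : RamExpr} (hx : x.eval (2 * n + 1) A v < 2 * n + 1)
    (hy : y.eval (2 * n + 1) A v < 2 * n + 1) (hj : j.eval (2 * n + 1) A v ≤ 2 * n + 1) :
    (rowIterE o j x y).eval (2 * n + 1) A v =
      (nextEnd (MixedWithAll (BlockMixed c k bd) (cutsBelow (2 * n) (x.eval (2 * n + 1) A v)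
        (y.eval (2 * n + 1) A v)) (2 * n)) (2 * n + 1))^[j.eval (2 * n + 1) A v] 0 := by
  rw [rowIterE, eval_call, eval_iter_iterate (nextEnd (MixedWithAll (BlockMixed c k bd)
    (cutsBelow (2 * n) (x.eval (2 * n + 1) A v) (y.eval (2 * n + 1) A v)) (2 * n)) (2 * n + 1))
    (j.eval (2 * n + 1) A v), min_eq_left hj]
  · rfl
  · intro i r; rw [lt_ne]; rfl
  · intro i r
    rw [eval_call]
    exact eval_rowNextE h hbd hd hx hy r

theorem eval_countCuts (h : StoresMatrix o A n k t c) {x y : RamExpr} {x₀ y₀ : ℕ}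
    (hx : ∀ i, x.eval (2 * n + 1) A (i :: v) = x₀) (hy : ∀ i, y.eval (2 * n + 1) A (i :: v) = y₀)
    (hx₀ : x₀ < 2 * n + 1) (hy₀ : y₀ < 2 * n + 1) :
    (count (and (lt (var 0) (topE o)) (cutE (var 0) x y))).eval (2 * n + 1) A v =
      (cutsBelow (2 * n) x₀ y₀).card := by
  rw [eval_count (fun u => u < 2 * n ∧ u ∈ cutSet x₀ y₀)]
  · congr 1
    ext u
    simp only [cutsBelow, Finset.mem_filter, Finset.mem_range]
    constructor
    · tauto
    · rintro ⟨h1, h2⟩; exact ⟨by omega, h2, h1⟩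
  · intro u _
    rw [and_ne, lt_ne, eval_topE h, cutE_ne (by rw [hx]; exact hx₀) (by rw [hy]; exact hy₀), hx, hy]
    rfl

theorem foundE_ne {m : ℕ} (h : StoresMatrix o A n k t c) (hbd : StoresDivision o A n bd)
    (hd : IsDivision n m bd) (hk : 2 ≤ k) (hn : 0 < n) {x y : ℕ} (hx : x < 2 * n + 1)
    (hy : y < 2 * n + 1) :
    (foundE o).eval (2 * n + 1) A (x :: y :: v) ≠ 0 ↔
      t ≤ (cutsBelow (2 * n) x y).card + 1 ∧ IntervalChain (MixedWithAll (BlockMixed c k bd)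
        (cutsBelow (2 * n) x y) (2 * n)) (2 * n) t 0 := by
  have hM := (hd.mixPred c hk).mixedWithAll (cutsBelow (2 * n) x y) (top := 2 * n) (by omega)
  rw [foundE, and_ne, le_ne, le_ne, eval, eval_countCuts h (x₀ := x) (y₀ := y) (fun _ => rfl)
    (fun _ => rfl) hx hy, eval_topE h, intervalChain_iff_iterate hM (Nat.zero_le _)]
  simp only [eval, h.parts]
  rw [add_comm 1]
  -- The first condition gives `t ≤ 2 * n + 1`, so the bounded loop has enough rounds for `t`
  -- iterations.
  refine and_congr_right fun ht => ?_
  have hcard : (cutsBelow (2 * n) x y).card ≤ 2 * n := by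
    have : cutsBelow (2 * n) x y ⊆ Finset.range (2 * n) := fun u hu => by
      simpa using (Finset.mem_filter.1 hu).2
    simpa using Finset.card_le_card this
  have e : (read (o + 2) (const 0)).eval (2 * n + 1) A (x :: y :: v) = t := h.parts
  rw [eval_rowIterE h hbd hd (v := x :: y :: v) (x := var 0) (y := var 1) hx hy (by rw [e]; omega), e]
  rfl

theorem eval_capE {N : ℕ} (h : StoresMatrix o A n k t c) {x : RamExpr} :
    (capE o x).eval N A v = min (x.eval N A v) (t - 1) := by
  simp only [capE, eval, h.parts]; omega

theorem eval_rowLabelE {m : ℕ} (h : StoresMatrix o A n k t c) (hbd : StoresDivision o A n bd)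
    (hd : IsDivision n m bd) {x y : ℕ} (hx : x < 2 * n + 1) (hy : y < 2 * n + 1) (p : ℕ) :
    (rowLabelE o).eval (2 * n + 1) A (p :: x :: y :: v) =
      min ((Finset.range (2 * n + 1)).filter fun j =>
        bd ((nextEnd (MixedWithAll (BlockMixed c k bd) (cutsBelow (2 * n) x y) (2 * n))
          (2 * n + 1))^[j + 1] 0) ≤ p).card (t - 1) := by
  rw [rowLabelE, eval_capE h, eval_count (fun j =>
    bd ((nextEnd (MixedWithAll (BlockMixed c k bd) (cutsBelow (2 * n) x y) (2 * n))
      (2 * n + 1))^[j + 1] 0) ≤ p)]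
  intro j hj
  rw [le_ne, eval_bdE h hbd, eval_rowIterE h hbd hd (v := j :: p :: x :: y :: v)
    (x := var 2) (y := var 3) hx hy
    (by simp [eval]; omega)]
  rfl

theorem eval_colLabelE (h : StoresMatrix o A n k t c) (hbd : StoresDivision o A n bd)
    {x y : ℕ} (hx : x < 2 * n + 1) (hy : y < 2 * n + 1) (p : ℕ) :
    (colLabelE o).eval (2 * n + 1) A (p :: x :: y :: v) =
      min ((cutsBelow (2 * n) x y).filter fun u => bd u ≤ p).card (t - 1) := by
  rw [colLabelE, eval_capE h, eval_count (fun u => (u < 2 * n ∧ u ∈ cutSet x y) ∧ bd u ≤ p)]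
  · congr 2
    ext u
    simp only [cutsBelow, Finset.mem_filter, Finset.mem_range]
    constructor
    · tauto
    · rintro ⟨⟨h1, h2⟩, h3⟩; exact ⟨by omega, ⟨h2, h1⟩, h3⟩
  · intro u _
    rw [and_ne, and_ne, lt_ne, le_ne, eval_topE h, cutE_ne hx hy, eval_bdE h hbd]
    rfl

theorem similarE_ne {m : ℕ} (h : StoresMatrix o A n k t c) (hbd : StoresDivision o A n bd)
    (hd : IsDivision n m bd) {x x' : ℕ} (hx : x < n) (hx' : x' < n) :
    (similarE o).eval (2 * n + 1) A (x :: x' :: v) ≠ 0 ↔ SimilarRows c n k bd x x' := by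
  rw [similarE, and_ne, eq_ne, eval_partE h hbd, eval_partE h hbd, all_ne]
  refine and_congr Iff.rfl ?_
  have key : ∀ y < n, ((or (not (lt (var 0) (sizeE o))) (or (eq (partE o (var 0)) (partE o (var 1)))
      (or (call (blockE o) (partE o (var 1)) (add (partE o (var 1)) (const 1)) (partE o (var 0))
        (add (partE o (var 0)) (const 1))) (eq (codeE o (var 1) (var 0))
          (codeE o (var 2) (var 0)))))).eval (2 * n + 1) A (y :: x :: x' :: v) ≠ 0 ↔
      (partIndex n bd y ≠ partIndex n bd x →
        ¬ BlockMixed c k bd (partIndex n bd x) (partIndex n bd x + 1) (partIndex n bd y)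
          (partIndex n bd y + 1) → c x y = c x' y)) := by
    intro y hy
    rw [or_ne, or_ne, or_ne, not_ne, lt_ne, eq_ne, eq_ne, eval_call, blockE_ne h hbd hd (by omega),
      eval_codeE h (by omega) (by simpa [eval] using hx) (by simpa [eval] using hy),
      eval_codeE h (by omega) (by simpa [eval] using hx') (by simpa [eval] using hy)]
    simp only [eval_partE h hbd, eval, eval_sizeE h, List.getD_cons_succ, List.getD_cons_zero]
    tauto
  constructor
  · intro hall y hy
    exact (key y hy).1 (hall y (by omega))
  · intro hall y hy
    by_cases hyn : y < n
    · exact (key y hyn).2 (hall y hyn)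
    · rw [or_ne, not_ne, lt_ne, eval_sizeE h]
      left
      exact hyn

end RamExpr

/-! ### The commands of the algorithm -/

theorem setCell_of_ne {A : ℕ → ℕ → ℕ} {a b i x : ℕ} (h : b ≠ a) : setCell A a i x b = A b :=
  Function.update_of_ne h _ _

theorem setCell_apply (A : ℕ → ℕ → ℕ) (a i x j : ℕ) :
    setCell A a i x a j = if j = i then x else A a j := by
  simp [setCell, Function.update_apply]

theorem StoresMatrix.congr {o n k t : ℕ} {A B : ℕ → ℕ → ℕ} {c : ℕ → ℕ → ℕ}
    (h : StoresMatrix o A n k t c) (h0 : B o = A o) (h1 : B (o + 1) = A (o + 1))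
    (h2 : B (o + 2) = A (o + 2)) (h8 : B (o + 8) = A (o + 8)) : StoresMatrix o B n k t c :=
  ⟨by rw [h0, h.size], by rw [h1, h.rows], by rw [h2, h.parts],
    fun p hp q hq => by rw [h8, h.code p hp q hq]⟩

theorem StoresDivision.congr {o n : ℕ} {A B : ℕ → ℕ → ℕ} {bd : ℕ → ℕ}
    (h : StoresDivision o A n bd) (h9 : B (o + 9) = A (o + 9)) : StoresDivision o B n bd :=
  fun i => by rw [h9]; exact h i

namespace RamCmd

open RamExpr

theorem exec_loop_induction {N : ℕ} {p : RamCmd} {v : List ℕ} {A : ℕ → ℕ → ℕ}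
    (I : ℕ → (ℕ → ℕ → ℕ) → Prop) (h0 : I 0 A)
    (hs : ∀ i < N, ∀ B, I i B → I (i + 1) (p.exec N (i :: v) B)) :
    I N ((loop p).exec N v A) := by
  have : ∀ j ≤ N, I j (Nat.rec A (fun i B => p.exec N (i :: v) B) j) := by
    intro j
    induction j with
    | zero => intro _; exact h0
    | succ j ih => intro hj; exact hs j (by omega) _ (ih (by omega))
  exact this N le_rfl

/-- For all `z < n`, the cell `x` of array `a` is set to `y`. -/
def fill (o a : ℕ) (x y : RamExpr) : RamCmd :=
  loop (ite (RamExpr.lt (var 0) (sizeE o)) (write a x y) skip)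

/-- The loop alters array `a` while it runs, so the expressions must have the stated values for all
memories that agree with `A` outside `a`. -/
theorem exec_fill {o a n N : ℕ} {x y : RamExpr} {A : ℕ → ℕ → ℕ} {v : List ℕ} (idx val : ℕ → ℕ)
    (hn : A o 0 = n) (ha : a ≠ o) (hN : n ≤ N)
    (hx : ∀ B : ℕ → ℕ → ℕ, (∀ b ≠ a, B b = A b) → ∀ z < n, x.eval N B (z :: v) = idx z)
    (hy : ∀ B : ℕ → ℕ → ℕ, (∀ b ≠ a, B b = A b) → ∀ z < n, y.eval N B (z :: v) = val z)
    (hinj : ∀ z < n, ∀ z' < n, idx z = idx z' → z = z') {B : ℕ → ℕ → ℕ}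
    (hB : (fill o a x y).exec N v A = B) :
    (∀ b ≠ a, B b = A b) ∧ (∀ z < n, B a (idx z) = val z) ∧
      ∀ i, (∀ z < n, i ≠ idx z) → B a i = A a i := by
  subst hB
  have h := exec_loop_induction (N := N) (v := v) (A := A)
    (p := ite (RamExpr.lt (var 0) (sizeE o)) (write a x y) skip)
    (fun i B => (∀ b ≠ a, B b = A b) ∧ (∀ z < n, z < i → B a (idx z) = val z) ∧
      ∀ i, (∀ z < n, i ≠ idx z) → B a i = A a i)
    ⟨fun _ _ => rfl, fun _ _ h => absurd h (by omega), fun _ _ => rfl⟩ (by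
      rintro i hi B ⟨h1, h2, h3⟩
      have hc : (RamExpr.lt (var 0) (sizeE o)).eval N B (i :: v) ≠ 0 ↔ i < n := by
        rw [lt_ne, sizeE]
        simp only [RamExpr.eval, List.getD_cons_zero]
        rw [h1 o ha.symm, hn]
      rw [exec]
      by_cases hin : i < n
      · rw [if_pos (hc.2 hin), exec, hx B h1 i hin, hy B h1 i hin]
        refine ⟨fun b hb => by rw [setCell_of_ne hb, h1 b hb], fun z hz hzi => ?_, fun j hj => ?_⟩
        · rw [setCell_apply]
          split_ifs with heq
          · rw [hinj z hz i hin heq]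
          · exact h2 z hz (by
              rcases Nat.lt_or_ge z i with h | h
              · exact h
              · obtain rfl : z = i := by omega
                exact absurd rfl heq)
        · rw [setCell_apply, if_neg (hj i hin), h3 j hj]
      · rw [if_neg (fun h => hin (hc.1 h)), exec]
        exact ⟨h1, fun z hz hzi => h2 z hz (by omega), h3⟩)
  exact ⟨h.1, fun z hz => h.2.1 z hz (by omega), h.2.2⟩

variable (o : ℕ)

/-- The label in cell `o + 6` is replaced by the label in cell `o + 5`. -/
def relabel : RamCmd :=
  loop (ite (RamExpr.eq (read (o + 10) (var 0)) (read (o + 6) (const 0)))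
    (write (o + 10) (var 0) (read (o + 5) (const 0))) skip)

/-- Cells not yet visited keep their old labels and the two compared labels are stored outside the
label array, so every comparison refers to the labels before the loop. -/
theorem exec_relabel {N : ℕ} {A B : ℕ → ℕ → ℕ} {v : List ℕ} (hB : (relabel o).exec N v A = B) :
    (∀ b ≠ o + 10, B b = A b) ∧ ∀ z < N, B (o + 10) z =
      if A (o + 10) z = A (o + 6) 0 then A (o + 5) 0 else A (o + 10) z := by
  subst hB
  have h := exec_loop_induction (N := N) (v := v) (A := A)
    (p := ite (RamExpr.eq (read (o + 10) (var 0)) (read (o + 6) (const 0)))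
      (write (o + 10) (var 0) (read (o + 5) (const 0))) skip)
    (fun i B => (∀ b ≠ o + 10, B b = A b) ∧ (∀ z < i, B (o + 10) z =
      if A (o + 10) z = A (o + 6) 0 then A (o + 5) 0 else A (o + 10) z) ∧
      ∀ z, i ≤ z → B (o + 10) z = A (o + 10) z)
    ⟨fun _ _ => rfl, fun _ h => absurd h (by omega), fun _ _ => rfl⟩ (by
      rintro i hi B ⟨h1, h2, h3⟩
      have hc : (RamExpr.eq (read (o + 10) (var 0)) (read (o + 6) (const 0))).eval N B (i :: v) ≠ 0 ↔
          A (o + 10) i = A (o + 6) 0 := by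
        rw [eq_ne]
        simp only [RamExpr.eval, List.getD_cons_zero]
        rw [h1 (o + 6) (by omega), h3 i le_rfl]
      rw [exec]
      by_cases hi : A (o + 10) i = A (o + 6) 0
      · rw [if_pos (hc.2 hi), exec]
        simp only [RamExpr.eval, List.getD_cons_zero]
        rw [h1 (o + 5) (by omega)]
        refine ⟨fun b hb => by rw [setCell_of_ne hb, h1 b hb], fun z hz => ?_, fun z hz => ?_⟩
        · rw [setCell_apply]
          split_ifs with e1 e2 e2
          · rfl
          · rw [e1] at e2; exact absurd hi e2
          · rw [h2 z (by omega), if_pos e2]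
          · rw [h2 z (by omega), if_neg e2]
        · rw [setCell_apply, if_neg (by omega), h3 z (by omega)]
      · rw [if_neg (fun h => hi (hc.1 h)), exec]
        refine ⟨h1, fun z hz => ?_, fun z hz => h3 z (by omega)⟩
        rcases Nat.lt_or_ge z i with h | h
        · exact h2 z h
        · obtain rfl : z = i := by omega
          rw [h3 z le_rfl, if_neg hi])
  exact ⟨h.1, h.2.1⟩

/-- The classes of `x` and `x'` are merged and the new labels are written to the output. -/
def mergeStep : RamCmd :=
  seq (write (o + 5) (const 0) (read (o + 10) (var 0)))
    (seq (write (o + 6) (const 0) (read (o + 10) (var 1)))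
      (seq (relabel o) (seq (write (o + 4) (const 0) (sub (read (o + 4) (const 0)) (const 1)))
        (fill o 0 (add (call (mulE o) (read (o + 4) (const 0)) (const 0) (const 0) (const 0))
          (read (o + 11) (var 0))) (read (o + 10) (var 0))))))

/-- All arrays except for those with the labels and the output are equal. -/
def Agree (A B : ℕ → ℕ → ℕ) : Prop :=
  ∀ a, a ∈ [o, o + 1, o + 2, o + 3, o + 8, o + 9, o + 11] → B a = A a

variable {o}

theorem Agree.trans {A B C : ℕ → ℕ → ℕ} (h1 : Agree o A B) (h2 : Agree o B C) : Agree o A C :=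
  fun a ha => (h2 a ha).trans (h1 a ha)

theorem Agree.storesMatrix {n k t : ℕ} {A B : ℕ → ℕ → ℕ} {c : ℕ → ℕ → ℕ}
    (h : Agree o A B) (hA : StoresMatrix o A n k t c) : StoresMatrix o B n k t c :=
  hA.congr (h _ (by simp)) (h _ (by simp)) (h _ (by simp)) (h _ (by simp))

theorem Agree.storesDivision {n : ℕ} {A B : ℕ → ℕ → ℕ} {bd : ℕ → ℕ}
    (h : Agree o A B) (hA : StoresDivision o A n bd) : StoresDivision o B n bd :=
  hA.congr (h _ (by simp))

/-- Rows of the output are filled downwards: the row number is decreased before the new labelling is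
written, with positions translated to element numbers by `elem`. -/
theorem exec_mergeStep {n N : ℕ} {A B : ℕ → ℕ → ℕ} {elem : ℕ → ℕ} {x x' : ℕ} {v : List ℕ}
    (ho : 2 ≤ o) (hn : A o 0 = n) (hN : n ≤ N) (helem : ∀ z < n, A (o + 11) z = elem z)
    (hinj : ∀ z < n, ∀ z' < n, elem z = elem z' → z = z')
    (hB : (mergeStep o).exec N (x :: x' :: v) A = B) :
    Agree o A B ∧ B (o + 4) 0 = A (o + 4) 0 - 1 ∧
    (∀ z < n, B (o + 10) z =
      if A (o + 10) z = A (o + 10) x' then A (o + 10) x else A (o + 10) z) ∧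
    (∀ z < n, B 0 (n * B (o + 4) 0 + elem z) = B (o + 10) z) ∧
    ∀ i, (∀ z < n, i ≠ n * B (o + 4) 0 + elem z) → B 0 i = A 0 i := by
  simp only [mergeStep, exec] at hB
  generalize hA1 : setCell A (o + 5) _ _ = A₁ at hB
  generalize hA2 : setCell A₁ (o + 6) _ _ = A₂ at hB
  generalize hA3 : (relabel o).exec _ _ _ = A₃ at hB
  generalize hA4 : setCell A₃ (o + 4) _ _ = A₄ at hB
  simp only [RamExpr.eval, List.getD_cons_zero, List.getD_cons_succ] at hA1 hA2 hA4
  obtain ⟨r1, r2⟩ := exec_relabel o hA3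
  have a1 : ∀ b ≠ o + 5, A₁ b = A b := fun b hb => by rw [← hA1, setCell_of_ne hb]
  have a2 : ∀ b ≠ o + 6, A₂ b = A₁ b := fun b hb => by rw [← hA2, setCell_of_ne hb]
  have a4 : ∀ b ≠ o + 4, A₄ b = A₃ b := fun b hb => by rw [← hA4, setCell_of_ne hb]
  have a04 : ∀ b, b ≠ o + 4 → b ≠ o + 5 → b ≠ o + 6 → b ≠ o + 10 → A₄ b = A b :=
    fun b h4 h5 h6 h10 => by rw [a4 b h4, r1 b h10, a2 b h6, a1 b h5]
  have e5 : A₂ (o + 5) 0 = A (o + 10) x := by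
    rw [a2 _ (by omega), ← hA1, setCell_apply, if_pos rfl]
  have e6 : A₂ (o + 6) 0 = A (o + 10) x' := by
    rw [← hA2, setCell_apply, if_pos rfl, a1 _ (by omega)]
  have e4 : A₄ (o + 4) 0 = A (o + 4) 0 - 1 := by
    rw [← hA4, setCell_apply, if_pos rfl, r1 _ (by omega), a2 _ (by omega), a1 _ (by omega)]
  obtain ⟨f1, f2, f3⟩ := exec_fill (n := n) (fun z => n * A₄ (o + 4) 0 + elem z)
    (fun z => A₄ (o + 10) z)
    (by rw [a04 o (by omega) (by omega) (by omega) (by omega), hn]) (by omega) hN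
    (by
      intro C hC z hz
      have hCo : C o 0 = n := by
        rw [hC o (by omega), a04 o (by omega) (by omega) (by omega) (by omega), hn]
      rw [RamExpr.eval, eval_call, eval_mulE hCo hN]
      simp only [RamExpr.eval, List.getD_cons_zero]
      rw [hC _ (by omega), hC _ (by omega),
        a04 (o + 11) (by omega) (by omega) (by omega) (by omega), helem z hz])
    (by
      intro C hC z hz
      simp only [RamExpr.eval, List.getD_cons_zero]
      rw [hC _ (by omega)])
    (by
      intro z hz z' hz' heq
      exact hinj z hz z' hz' (by simpa using heq)) hB
  have g4 : B (o + 4) 0 = A₄ (o + 4) 0 := by rw [f1 _ (by omega)]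
  have g10 : B (o + 10) = A₄ (o + 10) := f1 _ (by omega)
  refine ⟨?_, by rw [g4, e4], ?_, ?_, ?_⟩
  · intro a ha
    simp only [List.mem_cons, List.not_mem_nil, or_false] at ha
    rw [f1 a (by omega), a04 a (by omega) (by omega) (by omega) (by omega)]
  · intro z hz
    rw [g10, a4 _ (by omega), r2 z (by omega), e5, e6, a2 _ (by omega), a1 _ (by omega)]
  · intro z hz
    rw [g4, g10]
    exact f2 z hz
  · intro i hi
    rw [g4] at hi
    rw [f3 i hi, a04 0 (by omega) (by omega) (by omega) (by omega)]

variable (o)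

/-- Classes of similar elements are merged. -/
def mergeSimilar : RamCmd :=
  loop (loop (ite (RamExpr.and (RamExpr.and (RamExpr.lt (var 0) (sizeE o))
      (RamExpr.lt (var 1) (sizeE o))) (RamExpr.and (similarE o)
        (RamExpr.not (RamExpr.eq (read (o + 10) (var 0)) (read (o + 10) (var 1))))))
    (mergeStep o) skip))

/-- The division is replaced by the one in which two intervals are merged. -/
def mergeIntervals : RamCmd :=
  loop (ite (RamExpr.lt (read (o + 7) (const 0)) (var 0))
    (write (o + 9) (var 0) (bdE o (add (var 0) (const 1)))) skip)

variable {o}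

/-- The boundaries after `p` move down by one place. The loop goes upwards, so cell `i + 1` is read
before it is overwritten. -/
theorem exec_mergeIntervals {n N k t m p : ℕ} {c : ℕ → ℕ → ℕ} {bd : ℕ → ℕ} {A B : ℕ → ℕ → ℕ}
    {v : List ℕ} (hA : StoresMatrix o A n k t c) (hbd : StoresDivision o A n bd)
    (hd : IsDivision n m bd) (hp : A (o + 7) 0 = p) (hpm : p + 2 ≤ m) (hN : n ≤ N)
    (hB : (mergeIntervals o).exec N v A = B) :
    (∀ b ≠ o + 9, B b = A b) ∧ StoresDivision o B n (bd ∘ skipIndex p) := by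
  subst hB
  have h := exec_loop_induction (N := N) (v := v) (A := A)
    (p := ite (RamExpr.lt (read (o + 7) (const 0)) (var 0))
      (write (o + 9) (var 0) (bdE o (add (var 0) (const 1)))) skip)
    (fun i B => (∀ b ≠ o + 9, B b = A b) ∧ (∀ z < i, z < n → B (o + 9) z = bd (skipIndex p z)) ∧
      ∀ z, i ≤ z → B (o + 9) z = A (o + 9) z)
    ⟨fun _ _ => rfl, fun _ h => absurd h (by omega), fun _ _ => rfl⟩ (by
      rintro i hi B ⟨h1, h2, h3⟩
      have hc : (RamExpr.lt (read (o + 7) (const 0)) (var 0)).eval N B (i :: v) ≠ 0 ↔ p < i := by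
        rw [lt_ne]
        simp only [RamExpr.eval, List.getD_cons_zero]
        rw [h1 (o + 7) (by omega), hp]
      have hold : ∀ z, z < n → A (o + 9) z = bd z := fun z hz => by
        have := hbd z; rwa [if_pos hz] at this
      rw [exec]
      by_cases hpi : p < i
      · have hval : (bdE o (add (var 0) (const 1))).eval N B (i :: v) = bd (i + 1) := by
          simp only [bdE, RamExpr.eval_ite, lt_ne, sizeE, RamExpr.eval, List.getD_cons_zero]
          rw [h1 o (by omega), hA.size, h3 (i + 1) (by omega)]
          exact hbd (i + 1)
        rw [if_pos (hc.2 hpi), exec, hval]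
        simp only [RamExpr.eval, List.getD_cons_zero]
        refine ⟨fun b hb => by rw [setCell_of_ne hb, h1 b hb], fun z hz hzn => ?_, fun z hz => ?_⟩
        · rw [setCell_apply]
          split_ifs with e1
          · rw [e1, skipIndex, if_neg (by omega)]
          · exact h2 z (by omega) hzn
        · rw [setCell_apply, if_neg (by omega), h3 z (by omega)]
      · rw [if_neg (fun h => hpi (hc.1 h)), exec]
        refine ⟨h1, fun z hz hzn => ?_, fun z hz => h3 z (by omega)⟩
        rcases Nat.lt_or_ge z i with h | h
        · exact h2 z h hzn
        · obtain rfl : z = i := by omega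
          rw [h3 z le_rfl, hold z hzn, skipIndex, if_pos (by omega)])
  refine ⟨h.1, fun i => ?_⟩
  have hmn := hd.le
  split_ifs with hi
  · exact h.2.1 i (by omega) hi
  · rw [Function.comp, skipIndex, if_neg (by omega), hd.top _ (by omega)]

end RamCmd

/-! ### Correctness of the main loop -/

theorem SimilarRows.symm {c : ℕ → ℕ → ℕ} {n k : ℕ} {bd : ℕ → ℕ} {x x' : ℕ}
    (h : SimilarRows c n k bd x x') : SimilarRows c n k bd x' x :=
  ⟨h.1.symm, fun y hy h1 h2 => by
    rw [← h.1] at h1 h2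
    exact (h.2 y hy h1 h2).symm⟩

theorem SimilarRows.trans {c : ℕ → ℕ → ℕ} {n k : ℕ} {bd : ℕ → ℕ} {x x' x'' : ℕ}
    (h : SimilarRows c n k bd x x') (h' : SimilarRows c n k bd x' x'') :
    SimilarRows c n k bd x x'' :=
  ⟨h.1.trans h'.1, fun y hy h1 h2 => (h.2 y hy h1 h2).trans (h'.2 y hy (by rwa [← h.1])
    (by rwa [← h.1]))⟩

theorem redLabels_congr {c : ℕ → ℕ → ℕ} {n : ℕ} {lab lab' : ℕ → ℕ}
    (h : ∀ z < n, lab z = lab' z) (l : ℕ) : redLabels c n lab l = redLabels c n lab' l := by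
  have himg : (Finset.range n).image lab = (Finset.range n).image lab' :=
    Finset.image_congr fun z hz => h z (by simpa using hz)
  have hhom : ∀ l', HomogeneousLabels c n lab l l' ↔ HomogeneousLabels c n lab' l l' := by
    intro l'
    refine forall₂_congr fun x hx => forall₂_congr fun x' hx' => forall₂_congr fun y hy =>
      forall₂_congr fun y' hy' => ?_
    rw [h x hx, h x' hx', h y hy, h y' hy']
  classical
  unfold redLabels
  rw [himg]
  exact Finset.filter_congr fun l' _ => by rw [hhom l']

/-! ### The sequence of labellings written to the output -/

/-- The labels after merging the classes of `x` and `x'`. -/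
def mergeLabels (lab : ℕ → ℕ) (x x' z : ℕ) : ℕ := if lab z = lab x' then lab x else lab z

theorem card_image_mergeLabels {n x x' : ℕ} {lab : ℕ → ℕ} (hx : x < n) (hx' : x' < n)
    (hne : lab x ≠ lab x') :
    ((Finset.range n).image (mergeLabels lab x x')).card + 1 = ((Finset.range n).image lab).card := by
  have : (Finset.range n).image (mergeLabels lab x x') =
      ((Finset.range n).image lab).erase (lab x') := by
    ext l
    simp only [Finset.mem_image, Finset.mem_range, Finset.mem_erase, mergeLabels]
    constructor
    · rintro ⟨z, hz, rfl⟩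
      split_ifs with h
      · exact ⟨hne, x, hx, rfl⟩
      · exact ⟨h, z, hz, rfl⟩
    · rintro ⟨h, z, hz, rfl⟩
      exact ⟨z, hz, if_neg h⟩
  rw [this]
  exact Finset.card_erase_add_one (Finset.mem_image_of_mem _ (Finset.mem_range.2 hx'))

/-- The rows `idx, …, n - 1` of the output `R` are labellings with small red-degree, each of which
arises from the next by merging two classes; row `idx` is `lab`. -/
structure OutputRows (c : ℕ → ℕ → ℕ) (n K : ℕ) (elem R : ℕ → ℕ) (idx : ℕ) (lab : ℕ → ℕ) :
    Prop where
  lt : idx < n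
  current : ∀ z < n, R (n * idx + elem z) = lab z
  last : ∀ z < n, ∀ z' < n, R (n * (n - 1) + elem z) = R (n * (n - 1) + elem z') → z = z'
  merge : ∀ i, idx ≤ i → i + 1 < n → ∃ x < n, ∃ x' < n,
    R (n * (i + 1) + elem x) ≠ R (n * (i + 1) + elem x') ∧ ∀ z < n,
      R (n * i + elem z) = mergeLabels (fun z => R (n * (i + 1) + elem z)) x x' z
  red : ∀ i, idx ≤ i → i < n → ∀ x < n,
    (redLabels c n (fun z => R (n * i + elem z)) (R (n * i + elem x))).card ≤ K
  card : ((Finset.range n).image lab).card = idx + 1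

/-- Each merge removes exactly one label, so `card` ties the row number to the number of classes and
shows that a row is still free. Since `elem z < n`, the new row does not overlap the later ones. -/
theorem OutputRows.step {c : ℕ → ℕ → ℕ} {n K idx : ℕ} {elem R R' lab lab' : ℕ → ℕ}
    (h : OutputRows c n K elem R idx lab) (helem : ∀ z < n, elem z < n) {x x' : ℕ} (hx : x < n)
    (hx' : x' < n) (hne : lab x ≠ lab x') (hlab : ∀ z < n, lab' z = mergeLabels lab x x' z)
    (hnew : ∀ z < n, R' (n * (idx - 1) + elem z) = lab' z)
    (hold : ∀ i, (∀ z < n, i ≠ n * (idx - 1) + elem z) → R' i = R i)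
    (hred : ∀ x < n, (redLabels c n lab' (lab' x)).card ≤ K) :
    OutputRows c n K elem R' (idx - 1) lab' := by
  have himg : (Finset.range n).image lab' = (Finset.range n).image (mergeLabels lab x x') :=
    Finset.image_congr fun z hz => hlab z (by simpa using hz)
  have hcard := card_image_mergeLabels hx hx' hne
  rw [← himg, h.card] at hcard
  have hpos : 0 < ((Finset.range n).image lab').card :=
    Finset.card_pos.2 ⟨_, Finset.mem_image_of_mem _ (Finset.mem_range.2 hx)⟩
  have hlt := h.lt
  obtain ⟨j, rfl⟩ : ∃ j, idx = j + 1 := ⟨idx - 1, by omega⟩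
  rw [Nat.add_sub_cancel] at *
  have hkeep : ∀ i, j + 1 ≤ i → ∀ z, R' (n * i + elem z) = R (n * i + elem z) := by
    intro i hi z
    refine hold _ fun z' hz' heq => ?_
    have h1 := helem z' hz'
    have h2 := Nat.mul_le_mul_left n hi
    rw [mul_add] at h2
    omega
  refine ⟨by omega, hnew, ?_, ?_, ?_, by omega⟩
  · intro z hz z' hz'
    rw [hkeep (n - 1) (by omega), hkeep (n - 1) (by omega)]
    exact h.last z hz z' hz'
  · intro i hi hin
    rcases Nat.eq_or_lt_of_le hi with rfl | hi
    · refine ⟨x, hx, x', hx', ?_, fun z hz => ?_⟩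
      · rw [hkeep _ le_rfl, hkeep _ le_rfl, h.current x hx, h.current x' hx']
        exact hne
      · rw [hnew z hz, hlab z hz]
        simp only [mergeLabels, hkeep _ le_rfl, h.current x hx, h.current x' hx', h.current z hz]
    · obtain ⟨a, ha, b, hb, h1, h2⟩ := h.merge i hi hin
      refine ⟨a, ha, b, hb, ?_, fun z hz => ?_⟩
      · rwa [hkeep _ (by omega), hkeep _ (by omega)]
      · rw [hkeep i hi, h2 z hz]
        simp only [mergeLabels, hkeep (i + 1) (by omega)]
  · intro i hi hin y hy
    rcases Nat.eq_or_lt_of_le hi with rfl | hi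
    · rw [hnew y hy, redLabels_congr hnew]
      exact hred y hy
    · rw [redLabels_congr fun z _ => hkeep i hi z, hkeep i hi]
      exact h.red i hi hin y hy

namespace RamCmd

open RamExpr

/-- Throughout, the labelling lies between the similarity classes of `bd₀` and those of `bd`: only
elements similar for `bd` are joined, and joined labels are never separated. Hence `hred` bounds
every intermediate red-degree, and after all pairs have been visited the labels are the classes for
`bd`. -/
theorem exec_mergeSimilar {o n k t m K : ℕ} {c : ℕ → ℕ → ℕ} {bd bd₀ elem : ℕ → ℕ}
    {A B : ℕ → ℕ → ℕ} {v : List ℕ} (ho : 2 ≤ o) (hA : StoresMatrix o A n k t c)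
    (hbd : StoresDivision o A n bd) (hd : IsDivision n m bd)
    (helem : ∀ z < n, A (o + 11) z = elem z) (hlt : ∀ z < n, elem z < n)
    (hinj : ∀ z < n, ∀ z' < n, elem z = elem z' → z = z')
    (hred : ∀ lab : ℕ → ℕ, (∀ x < n, ∀ x' < n, SimilarRows c n k bd₀ x x' → lab x = lab x') →
      (∀ x < n, ∀ x' < n, lab x = lab x' → SimilarRows c n k bd x x') →
      ∀ x < n, (redLabels c n lab (lab x)).card ≤ K)
    (h0 : ∀ x < n, ∀ x' < n, SimilarRows c n k bd₀ x x' → A (o + 10) x = A (o + 10) x')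
    (h1 : ∀ x < n, ∀ x' < n, A (o + 10) x = A (o + 10) x' → SimilarRows c n k bd x x')
    (hout : OutputRows c n K elem (A 0) (A (o + 4) 0) (A (o + 10)))
    (hB : (mergeSimilar o).exec (2 * n + 1) v A = B) :
    Agree o A B ∧ (∀ x < n, ∀ x' < n, B (o + 10) x = B (o + 10) x' ↔ SimilarRows c n k bd x x') ∧
      OutputRows c n K elem (B 0) (B (o + 4) 0) (B (o + 10)) := by
  subst hB
  set Base : (ℕ → ℕ → ℕ) → Prop := fun B => Agree o A B ∧
    (∀ x < n, ∀ x' < n, SimilarRows c n k bd₀ x x' → B (o + 10) x = B (o + 10) x') ∧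
    (∀ x < n, ∀ x' < n, B (o + 10) x = B (o + 10) x' → SimilarRows c n k bd x x') ∧
    OutputRows c n K elem (B 0) (B (o + 4) 0) (B (o + 10)) with hBase
  have hstep : ∀ (B : ℕ → ℕ → ℕ) (i j : ℕ) (v : List ℕ), Base B →
      ∃ B', (ite (RamExpr.and (RamExpr.and (RamExpr.lt (var 0) (sizeE o))
      (RamExpr.lt (var 1) (sizeE o))) (RamExpr.and (similarE o)
        (RamExpr.not (RamExpr.eq (read (o + 10) (var 0)) (read (o + 10) (var 1))))))
      (mergeStep o) skip).exec (2 * n + 1) (j :: i :: v) B = B' ∧ Base B' ∧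
      (j < n → i < n → SimilarRows c n k bd j i → B' (o + 10) j = B' (o + 10) i) ∧
      ∀ x < n, ∀ x' < n, B (o + 10) x = B (o + 10) x' → B' (o + 10) x = B' (o + 10) x' := by
    rintro B i j v ⟨b1, b2, b3, b4⟩
    have hBm := b1.storesMatrix hA
    have hBd := b1.storesDivision hbd
    refine ⟨_, rfl, ?_⟩
    have hc : (RamExpr.and (RamExpr.and (RamExpr.lt (var 0) (sizeE o))
        (RamExpr.lt (var 1) (sizeE o))) (RamExpr.and (similarE o)
        (RamExpr.not (RamExpr.eq (read (o + 10) (var 0)) (read (o + 10) (var 1)))))).eval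
          (2 * n + 1) B (j :: i :: v) ≠ 0 ↔
        (j < n ∧ i < n) ∧ SimilarRows c n k bd j i ∧ ¬ B (o + 10) j = B (o + 10) i := by
      rw [and_ne, and_ne, and_ne, lt_ne, lt_ne, eval_sizeE hBm, not_ne, eq_ne]
      refine and_congr_right fun hij => ?_
      simp only [RamExpr.eval, List.getD_cons_zero, List.getD_cons_succ] at hij ⊢
      rw [similarE_ne hBm hBd hd hij.1 hij.2]
    rw [exec]
    split_ifs with hcond
    · obtain ⟨⟨hj, hi⟩, hs, hne⟩ := hc.1 hcond
      obtain ⟨m1, m2, m3, m4, m5⟩ := exec_mergeStep (n := n) (N := 2 * n + 1) (elem := elem)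
        (x := j) (x' := i) (v := v) ho hBm.size (by omega)
        (fun z hz => by rw [b1 _ (by simp), helem z hz]) hinj rfl
      generalize (mergeStep o).exec (2 * n + 1) (j :: i :: v) B = B' at *
      -- Equal labels stay equal, so a pair treated once needs no second visit.
      have hmono : ∀ x < n, ∀ x' < n, B (o + 10) x = B (o + 10) x' →
          B' (o + 10) x = B' (o + 10) x' := by
        intro x hx x' hx' heq
        rw [m3 x hx, m3 x' hx', heq]
      have g2 : ∀ x < n, ∀ x' < n, SimilarRows c n k bd₀ x x' → B' (o + 10) x = B' (o + 10) x' :=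
        fun x hx x' hx' h => hmono x hx x' hx' (b2 x hx x' hx' h)
      have g3 : ∀ x < n, ∀ x' < n, B' (o + 10) x = B' (o + 10) x' → SimilarRows c n k bd x x' := by
        intro x hx x' hx' heq
        rw [m3 x hx, m3 x' hx'] at heq
        split_ifs at heq with e1 e2 e2
        · exact b3 x hx x' hx' (e1.trans e2.symm)
        · exact (b3 x hx i hi e1).trans (hs.symm.trans (b3 j hj x' hx' heq))
        · exact (b3 x hx j hj heq).trans (hs.trans (b3 x' hx' i hi e2).symm)
        · exact b3 x hx x' hx' heq
      rw [m2] at m4 m5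
      refine ⟨⟨b1.trans m1, g2, g3, ?_⟩, fun _ _ _ => ?_, hmono⟩
      · rw [m2]
        exact b4.step hlt hj hi hne m3 m4 m5 (hred _ g2 g3)
      · rw [m3 j hj, m3 i hi, if_neg hne, if_pos rfl]
    · rw [exec]
      refine ⟨⟨b1, b2, b3, b4⟩, fun hj hi hs => ?_, fun _ _ _ _ h => h⟩
      by_contra hne
      exact hcond (hc.2 ⟨⟨hj, hi⟩, hs, hne⟩)
  have h := exec_loop_induction (N := 2 * n + 1) (v := v) (A := A)
    (p := loop (ite (RamExpr.and (RamExpr.and (RamExpr.lt (var 0) (sizeE o))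
      (RamExpr.lt (var 1) (sizeE o))) (RamExpr.and (similarE o)
        (RamExpr.not (RamExpr.eq (read (o + 10) (var 0)) (read (o + 10) (var 1))))))
      (mergeStep o) skip))
    (fun i B => Base B ∧ ∀ x' < n, x' < i → ∀ x < n, SimilarRows c n k bd x x' →
      B (o + 10) x = B (o + 10) x')
    ⟨⟨fun _ _ => rfl, h0, h1, hout⟩, fun _ _ h => absurd h (by omega)⟩ (by
      rintro i hi B ⟨hbase, hdone⟩
      have h' := exec_loop_induction (N := 2 * n + 1) (v := i :: v) (A := B)
        (p := ite (RamExpr.and (RamExpr.and (RamExpr.lt (var 0) (sizeE o))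
          (RamExpr.lt (var 1) (sizeE o))) (RamExpr.and (similarE o)
          (RamExpr.not (RamExpr.eq (read (o + 10) (var 0)) (read (o + 10) (var 1))))))
          (mergeStep o) skip)
        (fun j B => Base B ∧ (∀ x' < n, x' < i → ∀ x < n, SimilarRows c n k bd x x' →
          B (o + 10) x = B (o + 10) x') ∧ (i < n → ∀ x < n, x < j → SimilarRows c n k bd x i →
          B (o + 10) x = B (o + 10) i))
        ⟨hbase, hdone, fun _ _ _ h => absurd h (by omega)⟩ (by
          rintro j hj B ⟨c1, c2, c3⟩
          obtain ⟨B', e, d1, d2, d3⟩ := hstep B i j v c1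
          rw [e]
          refine ⟨d1, fun x' hx' hi' x hx hs => d3 _ hx _ hx' (c2 x' hx' hi' x hx hs),
            fun hin x hx hxj hs => ?_⟩
          rcases Nat.lt_or_ge x j with h | h
          · exact d3 _ hx _ hin (c3 hin x hx h hs)
          · obtain rfl : x = j := by omega
            exact d2 hx hin hs)
      refine ⟨h'.1, fun x' hx' hxi x hx hs => ?_⟩
      rcases Nat.lt_or_ge x' i with h | h
      · exact h'.2.1 x' hx' h x hx hs
      · obtain rfl : x' = i := by omega
        exact h'.2.2 hx' x hx (by omega) hs)
  obtain ⟨⟨b1, b2, b3, b4⟩, b5⟩ := h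
  exact ⟨b1, fun x hx x' hx' => ⟨b3 x hx x' hx', b5 x' hx' (by omega) x hx⟩, b4⟩

end RamCmd

/-! ### The search for a minor and the main loop -/

/-- The cuts given by `x` and `y` belong to a minor. -/
def MinorCuts (c : ℕ → ℕ → ℕ) (n k t : ℕ) (bd : ℕ → ℕ) (x y : ℕ) : Prop :=
  t ≤ (cutsBelow (2 * n) x y).card + 1 ∧ IntervalChain (MixedWithAll (BlockMixed c k bd)
    (cutsBelow (2 * n) x y) (2 * n)) (2 * n) t 0

/-- The number of the row part of position `p` in the minor given by `x` and `y`. -/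
noncomputable def minorRow (c : ℕ → ℕ → ℕ) (n k t : ℕ) (bd : ℕ → ℕ) (x y p : ℕ) : ℕ :=
  min ((Finset.range (2 * n + 1)).filter fun j =>
    bd ((nextEnd (MixedWithAll (BlockMixed c k bd) (cutsBelow (2 * n) x y) (2 * n))
      (2 * n + 1))^[j + 1] 0) ≤ p).card (t - 1)

/-- The number of the column part of position `p` in the minor given by `x` and `y`. -/
def minorCol (n t : ℕ) (bd : ℕ → ℕ) (x y p : ℕ) : ℕ :=
  min ((cutsBelow (2 * n) x y).filter fun u => bd u ≤ p).card (t - 1)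

/-- Choose `A` with `2 ^ A < m ≤ 2 ^ A * 2`; the division is padded by empty intervals up to this
power of two, which is at most `2 * n`. All boundaries from `m` on equal `n`, so a dyadic minor
below `2 ^ A * 2` is one that the search up to `2 * n` would have found. -/
theorem IsDivision.exists_chainLength_le {n m k t : ℕ} {c : ℕ → ℕ → ℕ} {bd : ℕ → ℕ}
    (h : IsDivision n m bd) (hk : 2 ≤ k) (hm : 2 ≤ m) (ht : 1 ≤ t)
    (hno : ∀ x < 2 * n + 1, ∀ y < 2 * n + 1, ¬ MinorCuts c n k t bd x y) :
    ∃ p, p + 2 ≤ m ∧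
      chainLength (BlockMixed c k bd p (p + 2)) 0 (2 * n) ≤ 8 * (2 ^ (2 * t + 1)) ^ 5 := by
  have hX := h.mixPred c hk
  have hmn := h.le
  set A := Nat.log 2 (m - 1) with hA
  have h1 : 2 ^ A ≤ m - 1 := Nat.pow_log_le_self 2 (by omega)
  have h2 : m - 1 < 2 ^ (A + 1) := Nat.lt_pow_succ_log_self (by omega) _
  rw [pow_succ] at h2
  obtain ⟨p, hp, hle⟩ := exists_chainLength_pair_le hX (A := A) (m := m) ht (by omega) (by omega) (by
    rintro ⟨x, y, hx, hy, hc, hb, hch⟩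
    have hcut : cutsBelow (2 * n) x y = cutSet x y := by
      refine Finset.filter_true_of_mem fun u hu => ?_
      have := (hb u hu).2
      omega
    refine hno x (by omega) y (by omega) ⟨by rwa [hcut], ?_⟩
    rw [hcut]
    refine (hch.mono_pred fun a b hab u hu v hv huv => ?_).mono_hi (by omega)
    have htop : ∀ u, BlockMixed c k bd a b u (2 ^ A * 2) → BlockMixed c k bd a b u (2 * n) := by
      intro u hu
      unfold BlockMixed at hu ⊢
      rwa [h.top (2 * n) (by omega), ← h.top (2 ^ A * 2) (by omega)]
    simp only [Finset.mem_insert] at hu hv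
    have hu' : u < 2 ^ A * 2 ∧ u ∈ insert 0 (insert (2 ^ A * 2) (cutSet x y)) := by
      rcases hu with rfl | rfl | hu
      · exact ⟨by omega, by simp⟩
      · rcases hv with rfl | rfl | hv
        · omega
        · omega
        · have := (hb v hv).2; omega
      · exact ⟨(hb u hu).2, by simp [hu]⟩
    rcases hv with rfl | rfl | hv
    · omega
    · exact htop u (hab u hu'.2 _ (by simp) hu'.1)
    · exact hab u hu'.2 v (by simp [hv]) huv)
  refine ⟨p, hp, ?_⟩
  have hP := hX.row p (p + 2)
  refine ((h.chainLength_le_top c hk p (p + 2) (2 * n)).trans ?_).trans hle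
  rw [← intervalChain_iff hP]
  exact (intervalChain_chainLength hP 0 m).mono_hi (by omega)

/-- The arrays `0` and `1` contain the labels of a minor. -/
def MinorOutput (c : ℕ → ℕ → ℕ) (n k t : ℕ) (elem : ℕ → ℕ) (B : ℕ → ℕ → ℕ) : Prop :=
  ∃ m bd x y, IsDivision n m bd ∧ MinorCuts c n k t bd x y ∧
    ∀ p < n, B 0 (elem p) = minorRow c n k t bd x y p ∧ B 1 (elem p) = minorCol n t bd x y p

/-- The state of the algorithm when the division has `m` intervals. -/
structure DivisionState (o : ℕ) (c : ℕ → ℕ → ℕ) (n k t d K : ℕ) (elem : ℕ → ℕ) (m : ℕ)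
    (B : ℕ → ℕ → ℕ) (bd : ℕ → ℕ) : Prop where
  flag : B (o + 3) 0 = 0
  matrix : StoresMatrix o B n k t c
  elem_eq : ∀ z < n, B (o + 11) z = elem z
  division : IsDivision n m bd
  stored : StoresDivision o B n bd
  chain_le : ∀ i < m, chainLength (BlockMixed c k bd i (i + 1)) 0 m ≤ d
  label : ∀ x < n, ∀ x' < n, B (o + 10) x = B (o + 10) x' ↔ SimilarRows c n k bd x x'
  output : OutputRows c n K elem (B 0) (B (o + 4) 0) (B (o + 10))

namespace RamCmd

open RamExpr

variable (o : ℕ)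

/-- The labels of the minor for the cuts in the first two variables are written. -/
def writeMinor : RamCmd :=
  seq (write (o + 3) (const 0) (const 1)) (seq (fill o 0 (read (o + 11) (var 0)) (rowLabelE o))
    (fill o 1 (read (o + 11) (var 0)) (colLabelE o)))

/-- Search for a minor. -/
def search : RamCmd :=
  loop (loop (ite (RamExpr.and (RamExpr.not (read (o + 3) (const 0))) (foundE o))
    (writeMinor o) skip))

/-- One round of the algorithm. -/
def round : RamCmd :=
  ite (RamExpr.and (RamExpr.not (read (o + 3) (const 0)))
      (RamExpr.lt (add (var 0) (const 1)) (sizeE o)))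
    (seq (search o) (ite (read (o + 3) (const 0)) skip
      (seq (write (o + 7) (const 0)
          (call (bestE o) (sub (sizeE o) (var 0)) (const 0) (const 0) (const 0)))
        (seq (mergeIntervals o) (mergeSimilar o))))) skip

variable {o} {c : ℕ → ℕ → ℕ} {n k t d K m : ℕ} {elem : ℕ → ℕ} {A B : ℕ → ℕ → ℕ} {bd : ℕ → ℕ}
  {v : List ℕ}

theorem exec_writeMinor {x y : ℕ} (ho : 2 ≤ o) (hA : StoresMatrix o A n k t c)
    (hbd : StoresDivision o A n bd) (hd : IsDivision n m bd)
    (helem : ∀ z < n, A (o + 11) z = elem z)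
    (hinj : ∀ z < n, ∀ z' < n, elem z = elem z' → z = z')
    (hx : x < 2 * n + 1) (hy : y < 2 * n + 1) (hcut : MinorCuts c n k t bd x y)
    (hB : (writeMinor o).exec (2 * n + 1) (x :: y :: v) A = B) :
    B (o + 3) 0 = 1 ∧ MinorOutput c n k t elem B := by
  simp only [writeMinor, exec] at hB
  generalize hA1 : setCell A (o + 3) _ _ = A₁ at hB
  generalize hA2 : (fill o 0 _ _).exec _ _ _ = A₂ at hB
  simp only [RamExpr.eval] at hA1
  have a1 : ∀ b ≠ o + 3, A₁ b = A b := fun b hb => by rw [← hA1, setCell_of_ne hb]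
  have e3 : A₁ (o + 3) 0 = 1 := by rw [← hA1, setCell_apply, if_pos rfl]
  have hcongr : ∀ C : ℕ → ℕ → ℕ, (∀ b, b ≠ 0 → b ≠ 1 → C b = A₁ b) →
      StoresMatrix o C n k t c ∧ StoresDivision o C n bd ∧ ∀ z < n, C (o + 11) z = elem z := by
    intro C hC
    have h : ∀ b, o ≤ b → b ≠ o + 3 → C b = A b := fun b hb h3 => by
      rw [hC b (by omega) (by omega), a1 b h3]
    exact ⟨hA.congr (h _ (by omega) (by omega)) (h _ (by omega) (by omega))
      (h _ (by omega) (by omega)) (h _ (by omega) (by omega)),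
      hbd.congr (h _ (by omega) (by omega)),
      fun z hz => by rw [h _ (by omega) (by omega), helem z hz]⟩
  obtain ⟨f1, f2, -⟩ := exec_fill (n := n) elem (minorRow c n k t bd x y)
    (hcongr A₁ fun _ _ _ => rfl).1.size (by omega) (by omega)
    (fun C hC z hz => by
      simp only [RamExpr.eval, List.getD_cons_zero]
      exact (hcongr C fun b hb _ => hC b hb).2.2 z hz)
    (fun C hC z hz => eval_rowLabelE (hcongr C fun b hb _ => hC b hb).1
      (hcongr C fun b hb _ => hC b hb).2.1 hd hx hy z) hinj hA2
  have a2 := hcongr A₂ fun b hb _ => f1 b hb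
  obtain ⟨g1, g2, -⟩ := exec_fill (n := n) elem (minorCol n t bd x y)
    a2.1.size (by omega) (by omega)
    (fun C hC z hz => by
      simp only [RamExpr.eval, List.getD_cons_zero]
      exact (hcongr C fun b hb hb' => (hC b hb').trans (f1 b hb)).2.2 z hz)
    (fun C hC z hz => eval_colLabelE (hcongr C fun b hb hb' => (hC b hb').trans (f1 b hb)).1
      (hcongr C fun b hb hb' => (hC b hb').trans (f1 b hb)).2.1 hx hy z) hinj hB
  refine ⟨by rw [g1 _ (by omega), f1 _ (by omega), e3], m, bd, x, y, hd, hcut, fun p hp => ?_⟩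
  exact ⟨by rw [g1 _ (by omega), f2 p hp], g2 p hp⟩

/-- The flag blocks all further writing once a minor is found. Until then the memory is unchanged,
so each test still refers to the original data. -/
theorem exec_search (ho : 2 ≤ o) (hk : 2 ≤ k) (hn : 0 < n)
    (hinj : ∀ z < n, ∀ z' < n, elem z = elem z' → z = z')
    (hA : DivisionState o c n k t d K elem m A bd)
    (hB : (search o).exec (2 * n + 1) v A = B) :
    (B = A ∧ ∀ x < 2 * n + 1, ∀ y < 2 * n + 1, ¬ MinorCuts c n k t bd x y) ∨
      (B (o + 3) 0 = 1 ∧ MinorOutput c n k t elem B) := by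
  subst hB
  have hcond : ∀ (B : ℕ → ℕ → ℕ) (x y : ℕ) (v : List ℕ),
      (RamExpr.and (RamExpr.not (read (o + 3) (const 0))) (foundE o)).eval (2 * n + 1) B
        (x :: y :: v) ≠ 0 ↔ B (o + 3) 0 = 0 ∧
        (foundE o).eval (2 * n + 1) B (x :: y :: v) ≠ 0 := by
    intro B x y v
    rw [and_ne, not_ne]
    simp only [RamExpr.eval, ne_eq, not_not]
  have h := exec_loop_induction (N := 2 * n + 1) (v := v) (A := A)
    (p := loop (ite (RamExpr.and (RamExpr.not (read (o + 3) (const 0))) (foundE o))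
      (writeMinor o) skip))
    (fun j B => (B = A ∧ ∀ x < 2 * n + 1, ∀ y < j, ¬ MinorCuts c n k t bd x y) ∨
      (B (o + 3) 0 = 1 ∧ MinorOutput c n k t elem B))
    (Or.inl ⟨rfl, fun _ _ _ h => absurd h (by omega)⟩) (by
      intro y hy B hB
      have h' := exec_loop_induction (N := 2 * n + 1) (v := y :: v) (A := B)
        (p := ite (RamExpr.and (RamExpr.not (read (o + 3) (const 0))) (foundE o))
          (writeMinor o) skip)
        (fun i B => (B = A ∧ (∀ x < 2 * n + 1, ∀ y' < y, ¬ MinorCuts c n k t bd x y') ∧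
            ∀ x < i, ¬ MinorCuts c n k t bd x y) ∨
          (B (o + 3) 0 = 1 ∧ MinorOutput c n k t elem B))
        (hB.imp_left fun h => ⟨h.1, h.2, fun _ h => absurd h (by omega)⟩) (by
          rintro x hx B (⟨rfl, h1, h2⟩ | hB)
          · rw [exec]
            split_ifs with hc
            · rw [hcond, foundE_ne hA.matrix hA.stored hA.division hk hn hx hy] at hc
              exact Or.inr (exec_writeMinor ho hA.matrix hA.stored hA.division hA.elem_eq hinj
                hx hy hc.2 rfl)
            · rw [hcond, foundE_ne hA.matrix hA.stored hA.division hk hn hx hy] at hc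
              refine Or.inl ⟨rfl, h1, fun x' hx' => ?_⟩
              rcases Nat.lt_or_ge x' x with h | h
              · exact h2 x' h
              · obtain rfl : x' = x := by omega
                exact fun h => hc ⟨hA.flag, h⟩
          · rw [exec, if_neg, exec]
            · exact Or.inr hB
            · rw [hcond, hB.1]
              simp)
      refine h'.imp_left fun h => ⟨h.1, fun x hx y' hy' => ?_⟩
      rcases Nat.lt_or_ge y' y with h3 | h3
      · exact h.2.1 x hx y' h3
      · obtain rfl : y' = y := by omega
        exact h.2.2 x hx)
  exact h

theorem exec_round {j : ℕ} (ho : 2 ≤ o) (hk : 2 ≤ k) (ht : 1 ≤ t) (hn : 0 < n)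
    (hsymm : ∀ x y x' y', c x y = c x' y' → c y x = c y' x')
    (hlt : ∀ z < n, elem z < n) (hinj : ∀ z < n, ∀ z' < n, elem z = elem z' → z = z')
    (hd : 8 * (2 ^ (2 * t + 1)) ^ 5 ≤ d) (hK : (d + 1) * (2 * k ^ (2 * d + 1)) ≤ K)
    (hj : j + 1 < n) (hA : DivisionState o c n k t d K elem (n - j) A bd)
    (hB : (round o).exec (2 * n + 1) (j :: v) A = B) :
    (∃ bd, DivisionState o c n k t d K elem (n - (j + 1)) B bd) ∨
      (B (o + 3) 0 = 1 ∧ MinorOutput c n k t elem B) := by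
  have hc : (RamExpr.and (RamExpr.not (read (o + 3) (const 0)))
      (RamExpr.lt (add (var 0) (const 1)) (sizeE o))).eval (2 * n + 1) A (j :: v) ≠ 0 := by
    rw [and_ne, not_ne, lt_ne, eval_sizeE hA.matrix]
    simp only [RamExpr.eval, List.getD_cons_zero, hA.flag]
    exact ⟨by simp, hj⟩
  rw [round, exec, if_pos hc, exec] at hB
  rcases exec_search ho hk hn hinj hA rfl (v := j :: v) with ⟨h1, hno⟩ | h1
  · left
    rw [h1, exec, if_neg (by simp [RamExpr.eval, hA.flag]), exec, exec, exec] at hB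
    obtain ⟨p, hp, hpm, hbest⟩ := eval_bestE hA.matrix hA.stored hA.division hk (by omega) [0, 0, 0]
    obtain ⟨q, hqm, hq⟩ := hA.division.exists_chainLength_le hk (by omega) ht hno
    -- The chosen pair `p` is at least as good as the pair `q` supplied by the density theorem, and
    -- a chain up to `n - j` is also one up to `2 * n`.
    have hpd : chainLength (BlockMixed c k bd p (p + 2)) 0 (n - j) ≤ d := by
      refine le_trans ?_ ((hbest q hqm).trans (hq.trans hd))
      have hP := (hA.division.mixPred c hk).row p (p + 2)
      rw [← intervalChain_iff hP]
      exact (intervalChain_chainLength hP 0 _).mono_hi (by omega)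
    generalize hA1 : setCell A (o + 7) _ _ = A₁ at hB
    generalize hA2 : (mergeIntervals o).exec _ _ _ = A₂ at hB
    have a1 : ∀ b ≠ o + 7, A₁ b = A b := fun b hb => by rw [← hA1, setCell_of_ne hb]
    have e7 : A₁ (o + 7) 0 = p := by
      have : ((sizeE o).sub (var 0)).eval (2 * n + 1) A (j :: v) = n - j := by
        rw [RamExpr.eval, eval_sizeE hA.matrix]; rfl
      rw [← hA1, RamExpr.eval, setCell_apply, if_pos rfl, eval_call, this, ← hp]
      rfl
    obtain ⟨m1, m2⟩ := exec_mergeIntervals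
      (hA.matrix.congr (a1 _ (by omega)) (a1 _ (by omega)) (a1 _ (by omega)) (a1 _ (by omega)))
      (hA.stored.congr (a1 _ (by omega))) hA.division e7 hpm (by omega) hA2
    have a2 : ∀ b, b ≠ o + 7 → b ≠ o + 9 → A₂ b = A b := fun b h7 h9 => by
      rw [m1 b h9, a1 b h7]
    have e10 : A₂ (o + 10) = A (o + 10) := a2 _ (by omega) (by omega)
    have hm2 : StoresMatrix o A₂ n k t c := hA.matrix.congr (a2 _ (by omega) (by omega))
      (a2 _ (by omega) (by omega)) (a2 _ (by omega) (by omega)) (a2 _ (by omega) (by omega))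
    have hdiv := hA.division.merge hpm
    have hel : ∀ z < n, A₂ (o + 11) z = elem z := fun z hz => by
      rw [a2 _ (by omega) (by omega), hA.elem_eq z hz]
    obtain ⟨s1, s2, s3⟩ := exec_mergeSimilar (K := K) ho hm2 m2 hdiv hel hlt hinj
      (fun lab g1 g2 x hx => (hA.division.card_redLabels_merge_le hsymm hk hpm hA.chain_le hpd
        g1 g2 hx).trans hK)
      (fun x hx x' hx' hs => by rw [e10]; exact (hA.label x hx x' hx').2 hs)
      (fun x hx x' hx' hs => by
        rw [e10] at hs
        exact hA.division.similar_merge c hk hpm hx hx' ((hA.label x hx x' hx').1 hs))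
      (by
        rw [e10, a2 0 (by omega) (by omega), a2 (o + 4) (by omega) (by omega)]
        exact hA.output) hB
    rw [show n - (j + 1) = n - j - 1 by omega]
    exact ⟨bd ∘ skipIndex p, ⟨by rw [s1 _ (by simp), a2 _ (by omega) (by omega), hA.flag],
      s1.storesMatrix hm2, fun z hz => by rw [s1 _ (by simp), hel z hz], hdiv,
      s1.storesDivision m2,
      fun i hi => hA.division.chainLength_merge_le c hk hpm hA.chain_le hpd hi, s2, s3⟩⟩
  · right
    generalize (search o).exec (2 * n + 1) (j :: v) A = C at hB h1
    rw [exec, if_pos (by simp [RamExpr.eval, h1.1]), exec] at hB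
    rwa [← hB]

theorem exec_rounds (ho : 2 ≤ o) (hk : 2 ≤ k) (ht : 1 ≤ t) (hn : 0 < n)
    (hsymm : ∀ x y x' y', c x y = c x' y' → c y x = c y' x')
    (hlt : ∀ z < n, elem z < n) (hinj : ∀ z < n, ∀ z' < n, elem z = elem z' → z = z')
    (hd : 8 * (2 ^ (2 * t + 1)) ^ 5 ≤ d) (hK : (d + 1) * (2 * k ^ (2 * d + 1)) ≤ K)
    (hA : DivisionState o c n k t d K elem n A bd)
    (hB : (loop (round o)).exec (2 * n + 1) v A = B) :
    (B (o + 3) 0 = 0 ∧ ∃ lab, OutputRows c n K elem (B 0) 0 lab) ∨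
      (B (o + 3) 0 = 1 ∧ MinorOutput c n k t elem B) := by
  subst hB
  -- The loop has `2 * n + 1` rounds, but only the first `n - 1` merge intervals; afterwards the
  -- guard makes rounds idle. A set flag has the same effect.
  have h := exec_loop_induction (N := 2 * n + 1) (v := v) (A := A) (p := round o)
    (fun j B => (∃ bd, DivisionState o c n k t d K elem (n - min j (n - 1)) B bd) ∨
      (B (o + 3) 0 = 1 ∧ MinorOutput c n k t elem B))
    (Or.inl ⟨bd, by simpa using hA⟩) (by
      rintro j hj B (⟨bd, hB⟩ | hB)
      · by_cases hjn : j + 1 < n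
        · rw [min_eq_left (by omega)] at hB
          rw [min_eq_left (by omega)]
          exact exec_round ho hk ht hn hsymm hlt hinj hd hK hjn hB rfl
        · rw [min_eq_right (by omega)] at hB
          rw [min_eq_right (by omega), round, exec, if_neg, exec]
          · exact Or.inl ⟨bd, hB⟩
          · rw [and_ne, lt_ne, eval_sizeE hB.matrix]
            exact fun h => hjn h.2
      · rw [round, exec, if_neg, exec]
        · exact Or.inr hB
        · rw [and_ne, not_ne]
          simp [RamExpr.eval, hB.1])
  refine h.imp_left ?_
  rintro ⟨bd, hB⟩
  refine ⟨hB.flag, ?_⟩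
  rw [min_eq_right (by omega), show n - (n - 1) = 1 by omega] at hB
  generalize (loop (round o)).exec (2 * n + 1) v A = B at *
  have hpart : ∀ x < n, partIndex n bd x = 0 := fun x hx => by
    have := hB.division.partIndex_lt hx
    omega
  have hout := hB.output
  -- With a single interval left there are no other intervals to disagree on, so all elements are
  -- similar. One class remains and the output has reached row `0`.
  have hcard : ((Finset.range n).image (B (o + 10))).card ≤ 1 := by
    refine Finset.card_le_one.2 ?_
    simp only [Finset.mem_image, Finset.mem_range]
    rintro _ ⟨x, hx, rfl⟩ _ ⟨x', hx', rfl⟩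
    refine (hB.label x hx x' hx').2 ⟨by rw [hpart x hx, hpart x' hx'], fun y hy hne => ?_⟩
    exact absurd (by rw [hpart x hx, hpart y hy]) hne
  rw [hout.card] at hcard
  rw [show B (o + 4) 0 = 0 by omega] at hout
  exact ⟨_, hout⟩

end RamCmd

/-! ### Initialization -/

/-- The code of the truth values `β i` at the pairs `(p, p)`, `(p, q)`, `(q, p)`, `(q, q)` for all
`i < j`. -/
def pairCode (β : ℕ → ℕ → ℕ → ℕ) (p q : ℕ) : ℕ → ℕ
  | 0 => 0
  | j + 1 => 2 * (2 * (2 * (2 * pairCode β p q j + β j p p) + β j p q) + β j q p) + β j q q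

theorem pairCode_lt {β : ℕ → ℕ → ℕ → ℕ} (hβ : ∀ j x y, β j x y ≤ 1) (p q m : ℕ) :
    pairCode β p q m < 16 ^ m := by
  induction m with
  | zero => simp [pairCode]
  | succ j ih =>
    have := hβ j p p
    have := hβ j p q
    have := hβ j q p
    have := hβ j q q
    rw [pairCode, pow_succ]
    omega

theorem pairCode_eq_iff {β : ℕ → ℕ → ℕ → ℕ} (hβ : ∀ j x y, β j x y ≤ 1) {p q p' q' m : ℕ} :
    pairCode β p q m = pairCode β p' q' m ↔ ∀ j < m, β j p p = β j p' p' ∧ β j p q = β j p' q' ∧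
      β j q p = β j q' p' ∧ β j q q = β j q' q' := by
  induction m with
  | zero => simp [pairCode]
  | succ j ih =>
    rw [Nat.forall_lt_succ_right, ← ih, pairCode, pairCode]
    have := hβ j p p
    have := hβ j p q
    have := hβ j q p
    have := hβ j q q
    have := hβ j p' p'
    have := hβ j p' q'
    have := hβ j q' p'
    have := hβ j q' q'
    omega

/-- The four bits of each symbol are permuted when the pair is reversed. This is what allows columns
to be treated as rows of the transposed block. -/
theorem pairCode_swap {β : ℕ → ℕ → ℕ → ℕ} (hβ : ∀ j x y, β j x y ≤ 1) {p q p' q' m : ℕ}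
    (h : pairCode β p q m = pairCode β p' q' m) : pairCode β q p m = pairCode β q' p' m := by
  rw [pairCode_eq_iff hβ] at h ⊢
  intro j hj
  obtain ⟨h1, h2, h3, h4⟩ := h j hj
  exact ⟨h4, h3, h2, h1⟩

/-- The address of the pair `(u, w)`, or of its first entries, in the truth table of a relation of
arity `l ≤ 2`. -/
def tableAddress (l n u w : ℕ) : ℕ := if l = 0 then 0 else if l = 1 then u else u + n * w

/-- The number of elements that are smaller than `u` in the order with truth table `R`. -/
def tableRank (R : ℕ → ℕ) (n u : ℕ) : ℕ :=
  ((Finset.range n).filter fun w => R (w + n * u) ≠ 0 ∧ R (u + n * w) = 0).card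

/-- The division into singletons. -/
theorem isDivision_min (n : ℕ) : IsDivision n n fun i => min i n where
  zero := by simp
  strict i hi := by omega
  top i hi := by omega

theorem partIndex_min {n x : ℕ} (hx : x < n) : partIndex n (fun i => min i n) x = x :=
  ((isDivision_min n).partIndex_eq_iff hx x).2 ⟨by omega, by omega⟩

namespace RamExpr

variable (o : ℕ) (ar : ℕ → ℕ)

/-- `2 * x` -/
def twiceE (x : RamExpr) : RamExpr := call (add (var 0) (var 0)) x (const 0) (const 0) (const 0)

/-- `n * x` -/
def timesE (x : RamExpr) : RamExpr := call (mulE o) x (const 0) (const 0) (const 0)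

/-- the truth value of the relation with number `j` at a pair of positions -/
def bitE (j : ℕ) (x y : RamExpr) : RamExpr :=
  read j (if ar j = 0 then const 0 else if ar j = 1 then read (o + 11) x
    else add (read (o + 11) x) (timesE o (read (o + 11) y)))

/-- the code of a pair of positions -/
def pairCodeE (x y : RamExpr) : ℕ → RamExpr
  | 0 => const 0
  | j + 1 => add (twiceE (add (twiceE (add (twiceE (add (twiceE (pairCodeE x y j))
      (bitE o ar j x x))) (bitE o ar j x y))) (bitE o ar j y x))) (bitE o ar j y y)

/-- the rank of an element in the order with number `r` -/
def rankE (r : ℕ) : RamExpr :=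
  count (and (lt (var 0) (sizeE o)) (and (read r (add (var 0) (timesE o (var 1))))
    (not (read r (add (var 1) (timesE o (var 0)))))))

variable {o ar} {A : ℕ → ℕ → ℕ} {n N : ℕ} {v : List ℕ}

theorem eval_twiceE {x : RamExpr} : (twiceE x).eval N A v = 2 * x.eval N A v := by
  rw [twiceE, eval_call, two_mul]; rfl

theorem eval_timesE (hs : A o 0 = n) (hN : n ≤ N) {x : RamExpr} :
    (timesE o x).eval N A v = n * x.eval N A v := by
  rw [timesE, eval_call, eval_mulE hs hN]

theorem eval_bitE (hs : A o 0 = n) (hN : n ≤ N) {j : ℕ} {x y : RamExpr} :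
    (bitE o ar j x y).eval N A v = A j (tableAddress (ar j) n (A (o + 11) (x.eval N A v))
      (A (o + 11) (y.eval N A v))) := by
  rw [bitE, tableAddress, eval]
  split_ifs
  · rfl
  · rfl
  · rw [eval, eval_timesE hs hN]; rfl

theorem eval_pairCodeE (hs : A o 0 = n) (hN : n ≤ N) {x y : RamExpr} {β : ℕ → ℕ → ℕ → ℕ} {m : ℕ}
    (hβ : ∀ j < m, ∀ z ∈ [x.eval N A v, y.eval N A v], ∀ z' ∈ [x.eval N A v, y.eval N A v],
      A j (tableAddress (ar j) n (A (o + 11) z) (A (o + 11) z')) = β j z z') :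
    (pairCodeE o ar x y m).eval N A v = pairCode β (x.eval N A v) (y.eval N A v) m := by
  induction m with
  | zero => rfl
  | succ j ih =>
    have h := hβ j (Nat.lt_succ_self j)
    rw [pairCodeE, pairCode]
    simp only [eval, eval_twiceE, eval_bitE hs hN]
    rw [ih fun i hi => hβ i (by omega), h _ (by simp) _ (by simp), h _ (by simp) _ (by simp),
      h _ (by simp) _ (by simp), h _ (by simp) _ (by simp)]

theorem eval_rankE (hs : A o 0 = n) (hN : n ≤ N) (r u : ℕ) :
    (rankE o r).eval N A (u :: v) = tableRank (A r) n u := by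
  rw [rankE, eval_count (fun w => w < n ∧ A r (w + n * u) ≠ 0 ∧ A r (u + n * w) = 0), tableRank]
  · congr 1
    ext w
    simp only [Finset.mem_filter, Finset.mem_range]
    constructor
    · exact fun h => h.2
    · exact fun h => ⟨by omega, h⟩
  · intro w _
    rw [and_ne, and_ne, not_ne, lt_ne]
    simp only [eval, eval_timesE hs hN, sizeE, hs, List.getD_cons_zero, List.getD_cons_succ,
      ne_eq, not_not]

end RamExpr

namespace RamCmd

open RamExpr

variable (o : ℕ) (ar : ℕ → ℕ) (m r : ℕ)

/-- The codes of all pairs are written. -/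
def writeCodes : RamCmd :=
  loop (ite (RamExpr.lt (var 0) (sizeE o))
    (fill o (o + 8) (add (timesE o (var 1)) (var 0)) (pairCodeE o ar (var 1) (var 0) m)) skip)

/-- The data for the division into singletons are written. -/
def setup : RamCmd :=
  seq (fill o (o + 11) (rankE o r) (var 0)) (seq (writeCodes o ar m)
    (seq (fill o (o + 9) (var 0) (var 0)) (seq (fill o (o + 10) (var 0) (var 0))
      (seq (write (o + 4) (const 0) (sub (sizeE o) (const 1)))
        (fill o 0 (add (timesE o (read (o + 4) (const 0))) (read (o + 11) (var 0))) (var 0))))))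

variable {o ar m r} {A B : ℕ → ℕ → ℕ} {n N k t d K : ℕ} {v : List ℕ} {elem : ℕ → ℕ}
  {β : ℕ → ℕ → ℕ → ℕ}

theorem exec_writeCodes (hm : m ≤ o) (hs : A o 0 = n) (hN : n ≤ N)
    (hβ : ∀ j < m, ∀ z < n, ∀ z' < n,
      A j (tableAddress (ar j) n (A (o + 11) z) (A (o + 11) z')) = β j z z')
    (hB : (writeCodes o ar m).exec N v A = B) :
    (∀ b ≠ o + 8, B b = A b) ∧ ∀ p < n, ∀ q < n, B (o + 8) (n * p + q) = pairCode β p q m := by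
  subst hB
  have hlin : ∀ p q p' q' : ℕ, q < n → q' < n → n * p + q = n * p' + q' → p = p' := by
    intro p q p' q' hq hq' h
    rcases Nat.lt_trichotomy p p' with h1 | h1 | h1
    · have := Nat.mul_le_mul_left n h1
      rw [Nat.mul_succ] at this
      omega
    · exact h1
    · have := Nat.mul_le_mul_left n h1
      rw [Nat.mul_succ] at this
      omega
  have h := exec_loop_induction (N := N) (v := v) (A := A)
    (p := ite (RamExpr.lt (var 0) (sizeE o))
      (fill o (o + 8) (add (timesE o (var 1)) (var 0)) (pairCodeE o ar (var 1) (var 0) m)) skip)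
    (fun i B => (∀ b ≠ o + 8, B b = A b) ∧ ∀ p < n, p < i → ∀ q < n,
      B (o + 8) (n * p + q) = pairCode β p q m)
    ⟨fun _ _ => rfl, fun _ _ h => absurd h (by omega)⟩ (by
      rintro p hp B ⟨h1, h2⟩
      have hc : (RamExpr.lt (var 0) (sizeE o)).eval N B (p :: v) ≠ 0 ↔ p < n := by
        rw [lt_ne, sizeE]
        simp only [RamExpr.eval, List.getD_cons_zero]
        rw [h1 o (by omega), hs]
      rw [exec]
      rcases Nat.lt_or_ge p n with hpn | hpn
      · rw [if_pos (hc.2 hpn)]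
        obtain ⟨f1, f2, f3⟩ := exec_fill (n := n) (A := B) (N := N) (v := p :: v) (o := o)
          (a := o + 8) (x := add (timesE o (var 1)) (var 0))
          (y := pairCodeE o ar (var 1) (var 0) m) (fun q => n * p + q) (fun q => pairCode β p q m)
          (by rw [h1 _ (by omega), hs]) (by omega) hN
          (fun C hC q hq => by
            have hC' : C o 0 = n := by rw [hC _ (by omega), h1 _ (by omega), hs]
            rw [RamExpr.eval, eval_timesE hC' hN]; rfl)
          (fun C hC q hq => by
            have hC' : ∀ b ≠ o + 8, C b = A b := fun b hb => by rw [hC b hb, h1 b hb]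
            rw [eval_pairCodeE (β := β) (by rw [hC' _ (by omega), hs]) hN]
            · rfl
            · intro j hj z hz z' hz'
              simp only [RamExpr.eval, List.getD_cons_succ, List.getD_cons_zero, List.mem_cons,
                List.not_mem_nil, or_false] at hz hz'
              rw [hC' j (by omega), hC' (o + 11) (by omega)]
              exact hβ j hj z (by omega) z' (by omega))
          (fun z _ z' _ h => by simpa using h) rfl
        refine ⟨fun b hb => by rw [f1 b hb, h1 b hb], fun p' hp' hpp q hq => ?_⟩
        rcases Nat.lt_or_ge p' p with h | h
        · rw [f3 _ fun z hz heq => ?_, h2 p' hp' h q hq]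
          have := hlin _ _ _ _ hq hz heq
          omega
        · obtain rfl : p' = p := by omega
          exact f2 q hq
      · rw [if_neg (fun h => absurd (hc.1 h) (by omega)), exec]
        exact ⟨h1, fun p' hp' hpp => h2 p' hp' (by omega)⟩)
  exact ⟨h.1, fun p hp q hq => h.2 p hp (by omega) q hq⟩

/-- Array `0` holds a truth table as well as the output, so it is overwritten last, after the ranks
and the codes have been extracted from the input. The choice `o = m + 2` keeps the working arrays
apart from the input tables and from the output arrays `0` and `1`. -/
theorem exec_setup (hr : r < m) (ho : o = m + 2) (hn : 0 < n) (hk : 16 ^ m < k)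
    (hβ1 : ∀ j x y, β j x y ≤ 1) (h0 : A o 0 = n) (h1 : A (o + 1) 0 = k) (h2 : A (o + 2) 0 = t)
    (h3 : A (o + 3) 0 = 0) (hlt : ∀ p < n, elem p < n) (hrank : ∀ p < n, tableRank (A r) n (elem p) = p)
    (hsurj : ∀ u < n, ∃ p < n, elem p = u)
    (hβ : ∀ j < m, ∀ z < n, ∀ z' < n, A j (tableAddress (ar j) n (elem z) (elem z')) = β j z z')
    (hB : (setup o ar m r).exec (2 * n + 1) v A = B) :
    DivisionState o (fun p q => pairCode β p q m) n k t d K elem n B fun i => min i n := by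
  simp only [setup, exec] at hB
  generalize hA1 : (fill o (o + 11) _ _).exec _ _ _ = A₁ at hB
  generalize hA2 : (writeCodes o ar m).exec _ _ _ = A₂ at hB
  generalize hA3 : (fill o (o + 9) _ _).exec _ _ _ = A₃ at hB
  generalize hA4 : (fill o (o + 10) _ _).exec _ _ _ = A₄ at hB
  generalize hA5 : setCell A₄ _ _ _ = A₅ at hB
  have hinj : ∀ z < n, ∀ z' < n, elem z = elem z' → z = z' := fun z hz z' hz' h => by
    rw [← hrank z hz, h, hrank z' hz']
  have hrinj : ∀ u < n, ∀ u' < n, tableRank (A r) n u = tableRank (A r) n u' → u = u' := by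
    intro u hu u' hu' h
    obtain ⟨p, hp, rfl⟩ := hsurj u hu
    obtain ⟨p', hp', rfl⟩ := hsurj u' hu'
    rw [hrank p hp, hrank p' hp'] at h
    rw [h]
  obtain ⟨a1, b1, -⟩ := exec_fill (n := n) (fun u => tableRank (A r) n u) (fun u => u) h0
    (by omega) (by omega)
    (fun C hC z _ => by
      rw [eval_rankE (by rw [hC _ (by omega), h0]) (by omega), hC r (by omega)])
    (fun C hC z _ => rfl) hrinj hA1
  have e11 : ∀ p < n, A₁ (o + 11) p = elem p := fun p hp => by
    have := b1 (elem p) (hlt p hp)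
    rwa [hrank p hp] at this
  obtain ⟨a2, b2⟩ := exec_writeCodes (n := n) (β := β) (by omega) (by rw [a1 _ (by omega), h0])
    (by omega) (fun j hj z hz z' hz' => by
      rw [e11 z hz, e11 z' hz', a1 j (by omega), hβ j hj z hz z' hz']) hA2
  obtain ⟨a3, b3, -⟩ := exec_fill (n := n) (fun u => u) (fun u => u)
    (by rw [a2 _ (by omega), a1 _ (by omega), h0]) (by omega) (by omega)
    (fun C hC z _ => rfl) (fun C hC z _ => rfl) (fun _ _ _ _ h => h) hA3
  obtain ⟨a4, b4, -⟩ := exec_fill (n := n) (fun u => u) (fun u => u)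
    (by rw [a3 _ (by omega), a2 _ (by omega), a1 _ (by omega), h0]) (by omega) (by omega)
    (fun C hC z _ => rfl) (fun C hC z _ => rfl) (fun _ _ _ _ h => h) hA4
  have a5 : ∀ b ≠ o + 4, A₅ b = A₄ b := fun b hb => by rw [← hA5, setCell_of_ne hb]
  have hs4 : A₄ o 0 = n := by
    rw [a4 _ (by omega), a3 _ (by omega), a2 _ (by omega), a1 _ (by omega), h0]
  have e4 : A₅ (o + 4) 0 = n - 1 := by
    rw [← hA5, RamExpr.eval, setCell_apply, if_pos rfl]
    simp only [RamExpr.eval, sizeE, hs4]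
  have e11' : A₅ (o + 11) = A₁ (o + 11) := by
    rw [a5 _ (by omega), a4 _ (by omega), a3 _ (by omega), a2 _ (by omega)]
  have hs5 : A₅ o 0 = n := by rw [a5 _ (by omega), hs4]
  obtain ⟨a6, b6, -⟩ := exec_fill (n := n) (fun z => n * (n - 1) + elem z) (fun u => u)
    hs5 (by omega) (by omega)
    (fun C hC z hz => by
      rw [RamExpr.eval, eval_timesE (by rw [hC _ (by omega), hs5]) (by omega)]
      simp only [RamExpr.eval, List.getD_cons_zero]
      rw [hC _ (by omega), hC _ (by omega), e4, e11', e11 z hz])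
    (fun C hC z _ => rfl) (fun z hz z' hz' h => hinj z hz z' hz' (by simpa using h)) hB
  have hkeep : ∀ b, o ≤ b → b ≠ o + 4 → b ≠ o + 8 → b ≠ o + 9 → b ≠ o + 10 → b ≠ o + 11 →
      B b = A b := by
    intro b hb h4 h8 h9 h10 h11
    rw [a6 _ (by omega), a5 _ h4, a4 _ h10, a3 _ h9, a2 _ h8, a1 _ h11]
  have hlab : ∀ z < n, B (o + 10) z = z := fun z hz => by
    rw [a6 _ (by omega), a5 _ (by omega), b4 z hz]
  have hdiv := isDivision_min n
  have hk2 : 2 ≤ k := by have : 0 < 16 ^ m := by positivity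
                         omega
  refine ⟨?_, ⟨?_, ?_, ?_, ?_⟩, ?_, hdiv, ?_, ?_, ?_, ?_⟩
  · rw [hkeep _ (by omega) (by omega) (by omega) (by omega) (by omega) (by omega), h3]
  · rw [hkeep _ (by omega) (by omega) (by omega) (by omega) (by omega) (by omega), h0]
  · rw [hkeep _ (by omega) (by omega) (by omega) (by omega) (by omega) (by omega), h1]
  · rw [hkeep _ (by omega) (by omega) (by omega) (by omega) (by omega) (by omega), h2]
  · intro p hp q hq
    rw [a6 _ (by omega), a5 _ (by omega), a4 _ (by omega), a3 _ (by omega), b2 p hp q hq]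
  · intro z hz
    rw [a6 _ (by omega), e11', e11 z hz]
  · intro i
    show _ = min i n
    split_ifs with hi
    · rw [a6 _ (by omega), a5 _ (by omega), a4 _ (by omega), b3 i hi]
      omega
    · omega
  -- All chains have length `0` at the start: a single row meets at most `16 ^ m` distinct columns,
  -- which is less than `k`.
  · intro i hi
    refine le_trans (le_of_eq ?_) (Nat.zero_le _)
    by_contra hne
    have := pred_of_chainLength_pos ((hdiv.mixPred _ hk2).row i (i + 1)) (Nat.pos_of_ne_zero hne)
    simp only [BlockMixed] at this
    rw [min_eq_left (by omega), min_eq_left (by omega)] at this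
    exact not_mixed_single (fun x y => pairCode_lt hβ1 x y m) hk _ _ _ this
  · intro x hx x' hx'
    rw [hlab x hx, hlab x' hx']
    constructor
    · rintro rfl
      exact ⟨rfl, fun _ _ _ _ => rfl⟩
    · intro h
      have := h.1
      rwa [partIndex_min hx, partIndex_min hx'] at this
  · have e4' : B (o + 4) 0 = n - 1 := by rw [a6 _ (by omega), e4]
    rw [e4']
    refine ⟨by omega, ?_, ?_, ?_, ?_, ?_⟩
    · intro z hz
      rw [b6 z hz, hlab z hz]
    · intro z hz z' hz'
      rw [b6 z hz, b6 z' hz']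
      exact fun h => h
    · intro i hi hin
      omega
    · intro i hi hin x hx
      obtain rfl : i = n - 1 := by omega
      refine le_trans (le_of_eq ?_) (Nat.zero_le _)
      classical
      rw [Finset.card_eq_zero, redLabels_congr b6, redLabels]
      refine Finset.filter_false_of_mem fun l hl => ?_
      rintro ⟨-, hne⟩
      refine hne fun x hx x' hx' y hy y' hy' h1 h1' h2 h2' => ?_
      rw [show x = x' from h1.trans h1'.symm, show y = y' from h2.trans h2'.symm]
    · rw [Finset.image_congr (g := id) fun z hz => hlab z (by simpa using hz), Finset.image_id,
        Finset.card_range]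
      omega

end RamCmd

/-! ### Partitions given by labels -/

section Labels

variable {α : Type*}

theorem mem_classes_ker {f : α → ℕ} {X : Set α} :
    X ∈ (Setoid.ker f).classes ↔ ∃ a, X = {b | f b = f a} := Iff.rfl

theorem setOf_eq_label_inj {f : α → ℕ} {a b : α} (h : {x | f x = f a} = {x | f x = f b}) :
    f a = f b := by
  have : a ∈ {x | f x = f b} := by rw [← h]; rfl
  exact this

theorem classes_ker_of_const [Nonempty α] {f : α → ℕ} (h : ∀ a b, f a = f b) :
    (Setoid.ker f).classes = {Set.univ} := by
  ext X
  rw [mem_classes_ker, Set.mem_singleton_iff]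
  have : ∀ a, {b | f b = f a} = Set.univ := fun a => Set.eq_univ_of_forall fun b => h b a
  simp [this]

theorem classes_ker_of_injective {f : α → ℕ} (h : Function.Injective f) :
    (Setoid.ker f).classes = Set.range fun a : α => ({a} : Set α) := by
  ext X
  rw [mem_classes_ker, Set.mem_range]
  have : ∀ a, {b | f b = f a} = {a} := fun a => by ext b; simp [h.eq_iff]
  simp only [this]
  exact exists_congr fun a => eq_comm

/-- Replacing the label `g x'` by `g x` unites two classes and leaves the others alone; read
backwards this is a split. -/
theorem isSplitOf_classes_ker {f g : α → ℕ} {x x' : α} (hne : g x ≠ g x')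
    (h : ∀ b, f b = if g b = g x' then g x else g b) :
    IsSplitOf (Setoid.ker f).classes (Setoid.ker g).classes := by
  have hfx : f x = g x := by rw [h, if_neg hne]
  have hX : ∀ b, f b = f x ↔ g b = g x ∨ g b = g x' := by
    intro b
    rw [hfx, h]
    split_ifs with h1
    · simp [h1]
    · simp [h1]
  have hcls : ∀ a, g a ≠ g x → g a ≠ g x' → {b | f b = f a} = {b | g b = g a} := by
    intro a h1 h2
    ext b
    simp only [Set.mem_ofPred_eq]
    rw [h a, h b, if_neg h2]
    split_ifs with h3
    · rw [h3]; exact ⟨fun h => absurd h.symm h1, fun h => absurd h.symm h2⟩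
    · rfl
  refine ⟨{b | f b = f x}, ⟨x, rfl⟩, {b | g b = g x}, {b | g b = g x'}, ⟨x, rfl⟩, ⟨x', rfl⟩, ?_, ?_,
    ?_⟩
  · rw [Set.disjoint_left]
    exact fun b h1 h2 => hne (h1.symm.trans h2)
  · ext b
    exact (hX b).symm
  · ext X
    simp only [Set.mem_union, Set.mem_sdiff, Set.mem_singleton_iff, Set.mem_insert_iff,
      mem_classes_ker]
    constructor
    · rintro ⟨a, rfl⟩
      by_cases h1 : g a = g x
      · right; left; rw [h1]
      · by_cases h2 : g a = g x'
        · right; right; rw [h2]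
        · left
          refine ⟨⟨a, (hcls a h1 h2).symm⟩, fun heq => ?_⟩
          rw [← hcls a h1 h2] at heq
          rcases (hX a).1 (setOf_eq_label_inj heq) with h | h
          · exact h1 h
          · exact h2 h
    · rintro (⟨⟨a, rfl⟩, hne'⟩ | rfl | rfl)
      · have hna : ¬ f a = f x := fun h => hne' (by rw [h])
        rw [hX, not_or] at hna
        exact ⟨a, hcls a hna.1 hna.2⟩
      · exact ⟨x, rfl⟩
      · exact ⟨x', rfl⟩

/-- Every value of `f` on `S` is sent to a value of `g` at a corresponding point, and this
assignment is injective. Finiteness of `T` matters because `ncard` is `0` on infinite sets. -/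
theorem ncard_image_le_of_factor {ι κ A B : Type*} {f : ι → A} {g : κ → B} {S : Set ι} {T : Set κ}
    (s : ι → κ) (hT : T.Finite) (hs : ∀ i ∈ S, s i ∈ T)
    (h : ∀ i ∈ S, ∀ j ∈ S, g (s i) = g (s j) → f i = f j) :
    (f '' S).ncard ≤ (g '' T).ncard := by
  rcases S.eq_empty_or_nonempty with rfl | ⟨i₀, hi₀⟩
  · simp
  have : Nonempty ι := ⟨i₀⟩
  refine Set.ncard_le_ncard_of_injOn (fun a => g (s (Function.invFunOn f S a))) ?_ ?_
    (hT.image g)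
  · rintro _ ⟨i, hi, rfl⟩
    exact ⟨_, hs _ (Function.invFunOn_mem ⟨i, hi, rfl⟩), rfl⟩
  · rintro a ha b hb hab
    have ha' := Function.invFunOn_mem (f := f) (s := S) ha
    have hb' := Function.invFunOn_mem (f := f) (s := S) hb
    rw [← Function.invFunOn_eq (f := f) (s := S) ha, ← Function.invFunOn_eq (f := f) (s := S) hb]
    exact h _ ha' _ hb' hab

end Labels

/-- `pos` numbers the elements of `α` in increasing order, and the function `c` determines atomic
types. -/
structure CodesTypes (L : FirstOrder.Language) {α : Type*} [LinearOrder α] [L.Structure α] (n : ℕ)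
    (pos : α → ℕ) (c : ℕ → ℕ → ℕ) : Prop where
  strictMono : StrictMono pos
  lt : ∀ a, pos a < n
  surj : ∀ p < n, ∃ a, pos a = p
  eq_iff : ∀ a b a' b', c (pos a) (pos b) = c (pos a') (pos b') ↔ atp L a b = atp L a' b'
  swap : ∀ x y x' y', c x y = c x' y' → c y x = c y' x'

namespace CodesTypes

variable {L : FirstOrder.Language} {α : Type*} [LinearOrder α] [L.Structure α] {n : ℕ}
  {pos : α → ℕ} {c : ℕ → ℕ → ℕ}

theorem finite (h : CodesTypes L n pos c) : Finite α :=
  Finite.of_injective (fun a => (⟨pos a, h.lt a⟩ : Fin n)) fun a b hab =>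
    h.strictMono.injective (by simpa using hab)

theorem homogeneous (h : CodesTypes L n pos c) {lab : ℕ → ℕ} {a b : α}
    (hh : HomogeneousLabels c n lab (lab (pos a)) (lab (pos b))) :
    Homogeneous L {x | lab (pos x) = lab (pos a)} {x | lab (pos x) = lab (pos b)} := by
  constructor
  · rw [Set.ncard_eq_one]
    refine ⟨fun y => atp L a y, ?_⟩
    refine Set.eq_singleton_iff_unique_mem.2 ⟨⟨a, rfl, rfl⟩, ?_⟩
    rintro _ ⟨x, hx, rfl⟩
    funext y
    exact (h.eq_iff _ _ _ _).1 (hh _ (h.lt x) _ (h.lt a) _ (h.lt y) _ (h.lt y) hx rfl y.2 y.2)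
  · rw [Set.ncard_eq_one]
    refine ⟨fun y => atp L b y, ?_⟩
    refine Set.eq_singleton_iff_unique_mem.2 ⟨⟨b, rfl, rfl⟩, ?_⟩
    rintro _ ⟨x, hx, rfl⟩
    funext y
    exact (h.eq_iff _ _ _ _).1 (h.swap _ _ _ _
      (hh _ (h.lt y) _ (h.lt y) _ (h.lt x) _ (h.lt b) y.2 y.2 hx rfl))

theorem redDegreeLE (h : CodesTypes L n pos c) {lab : ℕ → ℕ} {K : ℕ}
    (hK : ∀ x < n, (redLabels c n lab (lab x)).card ≤ K) :
    RedDegreeLE L (Setoid.ker fun a => lab (pos a)).classes K := by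
  classical
  rintro X ⟨a, rfl⟩
  refine le_trans ?_ (hK (pos a) (h.lt a))
  have hsub : {Y ∈ (Setoid.ker fun a => lab (pos a)).classes |
      Y ≠ {x | (Setoid.ker fun a => lab (pos a)) x a} ∧
        ¬ Homogeneous L {x | (Setoid.ker fun a => lab (pos a)) x a} Y} ⊆
      (fun l => {x | lab (pos x) = l}) '' (redLabels c n lab (lab (pos a)) : Set ℕ) := by
    rintro _ ⟨⟨b, rfl⟩, hne, hh⟩
    refine ⟨lab (pos b), ?_, rfl⟩
    simp only [redLabels, Finset.coe_filter, Finset.mem_image, Finset.mem_range, Set.mem_ofPred_eq]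
    refine ⟨⟨pos b, h.lt b, rfl⟩, fun heq => hne ?_, fun hl => hh (h.homogeneous hl)⟩
    show {x | lab (pos x) = lab (pos b)} = {x | lab (pos x) = lab (pos a)}
    rw [heq]
  refine (Set.ncard_le_ncard hsub ((Finset.finite_toSet _).image _)).trans ?_
  exact (Set.ncard_image_le (Finset.finite_toSet _)).trans (by rw [Set.ncard_coe_finset])

theorem isContractionSequence (h : CodesTypes L n pos c) (hn : 0 < n) {K : ℕ}
    {elem R lab : ℕ → ℕ} (ho : OutputRows c n K elem R 0 lab) :
    IsContractionSequence n
        (fun i => (Setoid.ker fun a => R (n * i + elem (pos a))).classes) ∧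
      ∀ i < n, RedDegreeLE L (Setoid.ker fun a => R (n * i + elem (pos a))).classes K := by
  have : Nonempty α := ⟨(h.surj 0 hn).choose⟩
  refine ⟨⟨hn, fun i _ => Setoid.isPartition_classes _, ?_, ?_, ?_⟩, fun i hi => ?_⟩
  · refine classes_ker_of_const fun a b => ?_
    rw [ho.current _ (h.lt a), ho.current _ (h.lt b)]
    exact Finset.card_le_one.1 ho.card.le _ (Finset.mem_image_of_mem _ (Finset.mem_range.2 (h.lt a)))
      _ (Finset.mem_image_of_mem _ (Finset.mem_range.2 (h.lt b)))
  · exact classes_ker_of_injective fun a b hab =>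
      h.strictMono.injective (ho.last _ (h.lt a) _ (h.lt b) hab)
  · intro i hi
    obtain ⟨x, hx, x', hx', hne, hm⟩ := ho.merge i (Nat.zero_le _) hi
    obtain ⟨x, rfl⟩ := h.surj x hx
    obtain ⟨x', rfl⟩ := h.surj x' hx'
    exact isSplitOf_classes_ker hne fun b => hm _ (h.lt b)
  · exact h.redDegreeLE (lab := fun z => R (n * i + elem z)) (ho.red i (Nat.zero_le _) hi)

end CodesTypes

/-! ### Minors given by labels -/

/-- The labels `lab` increase from `0` to `t - 1`, and the interval `[E i, E (i + 1))` has
label `i`. -/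
structure LabelBlocks (n t : ℕ) (lab E : ℕ → ℕ) : Prop where
  mono : Monotone lab
  lt : ∀ p, lab p < t
  block_lt : ∀ i < t, E i < E (i + 1)
  le : ∀ i < t, E (i + 1) ≤ n
  label : ∀ i < t, ∀ p, E i ≤ p → p < E (i + 1) → lab p = i

theorem card_filter_range_eq {g : ℕ → ℕ} (hg : Monotone g) {M i p : ℕ} (hi : i ≤ M) (h1 : g i ≤ p)
    (h2 : p < g (i + 1)) : ((Finset.range M).filter fun j => g (j + 1) ≤ p).card = i := by
  have : (Finset.range M).filter (fun j => g (j + 1) ≤ p) = Finset.range i := by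
    ext j
    simp only [Finset.mem_filter, Finset.mem_range]
    constructor
    · rintro ⟨-, h⟩
      by_contra hj
      have := hg (show i + 1 ≤ j + 1 by omega)
      omega
    · intro hj
      exact ⟨by omega, (hg (show j + 1 ≤ i by omega)).trans h1⟩
  rw [this, Finset.card_range]

/-- The count finds the block that contains `p`; capping it at `t - 1` joins everything beyond to
the last part, which leaves exactly `t` labels. Parts may be larger than their blocks, which does no
harm to mixedness. -/
theorem labelBlocks_min_card {n t M : ℕ} {g : ℕ → ℕ} (hg : Monotone g) (ht : 1 ≤ t)
    (hM : t ≤ M + 1) (hlt : ∀ i < t, g i < g (i + 1)) (hn : ∀ i, g i ≤ n) :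
    LabelBlocks n t (fun p => min ((Finset.range M).filter fun j => g (j + 1) ≤ p).card (t - 1))
      g where
  mono p q hpq := by
    refine min_le_min_right _ (Finset.card_le_card fun j hj => ?_)
    rw [Finset.mem_filter] at hj ⊢
    exact ⟨hj.1, hj.2.trans hpq⟩
  lt p := by have := min_le_right ((Finset.range M).filter fun j => g (j + 1) ≤ p).card (t - 1)
             omega
  block_lt := hlt
  le i _ := hn _
  label i hi p h1 h2 := by
    rw [card_filter_range_eq hg (by omega) h1 h2]
    omega

theorem minorRow_labelBlocks {c : ℕ → ℕ → ℕ} {n m k t x y : ℕ} {bd : ℕ → ℕ}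
    (h : IsDivision n m bd) (hk : 2 ≤ k) (hn : 0 < n) (ht : 1 ≤ t) (hc : MinorCuts c n k t bd x y) :
    ∃ E : ℕ → ℕ, LabelBlocks n t (minorRow c n k t bd x y) (fun i => bd (E i)) ∧
      ∀ i < t, MixedWithAll (BlockMixed c k bd) (cutsBelow (2 * n) x y) (2 * n) (E i) (E (i + 1)) := by
  set P := MixedWithAll (BlockMixed c k bd) (cutsBelow (2 * n) x y) (2 * n) with hPdef
  have hP : IntervalPred P := (h.mixPred c hk).mixedWithAll _ (by omega)
  set E : ℕ → ℕ := fun i => (nextEnd P (2 * n + 1))^[i] 0 with hE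
  have hsucc : ∀ i, E (i + 1) = nextEnd P (2 * n + 1) (E i) := fun i =>
    Function.iterate_succ_apply' _ _ _
  have hle : ∀ z, nextEnd P (2 * n + 1) z ≤ 2 * n + 1 := fun z => by
    classical exact (Finset.card_filter_le _ _).trans (by rw [Finset.card_range])
  have hmono : Monotone E := by
    refine monotone_nat_of_le_succ fun i => ?_
    rcases Nat.lt_or_ge (E (i + 1)) (2 * n + 1) with h1 | h1
    · rw [hsucc] at h1 ⊢
      exact (hP.lt (nextEnd_spec hP h1)).le
    · refine le_trans ?_ h1
      cases i with
      | zero => exact Nat.zero_le _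
      | succ i => rw [hsucc]; exact hle _
  have htop : E t ≤ 2 * n := (intervalChain_iff_iterate hP (Nat.zero_le _)).1 hc.2
  -- As the `t`-th end is at most `2 * n`, none of the earlier ends is the default `2 * n + 1`, so
  -- all of them were really found.
  have hstep : ∀ i < t, P (E i) (E (i + 1)) := by
    intro i hi
    have h1 := hmono (show i + 1 ≤ t from hi)
    rw [hsucc] at h1 ⊢
    exact nextEnd_spec hP (by omega)
  have hlen := hc.2.length_le hP
  refine ⟨E, ?_, hstep⟩
  refine labelBlocks_min_card (M := 2 * n + 1) (g := fun i => bd (E i)) (h.monotone.comp hmono) ht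
    (by omega) (fun i hi => ?_) fun i => h.bd_le _
  exact (mixPred_mixed c hk).lt' (hstep i hi 0 (by simp) (2 * n) (by simp) (by omega))

theorem pos_of_mem_cutSet {x y u : ℕ} (hu : u ∈ cutSet x y) : 0 < u := by
  obtain ⟨i, -, rfl⟩ := mem_cutSet.1 hu
  rw [cutPoint]
  positivity

/-- The boundaries are `0`, the cuts in increasing order, and then `2 * n`. Distinct cuts could
still bound the same positions through `bd`; the mixed row interval `[a, b)` excludes this, because
a mixed block has nonempty columns. -/
theorem minorCol_labelBlocks {c : ℕ → ℕ → ℕ} {n m k t x y a b : ℕ} {bd : ℕ → ℕ}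
    (h : IsDivision n m bd) (hk : 2 ≤ k) (hn : 0 < n) (ht : 1 ≤ t) (hc : MinorCuts c n k t bd x y)
    (hab : MixedWithAll (BlockMixed c k bd) (cutsBelow (2 * n) x y) (2 * n) a b) :
    ∃ F : ℕ → ℕ, LabelBlocks n t (minorCol n t bd x y) (fun i => bd (F i)) ∧
      ∀ i < t, F i < F (i + 1) ∧ F i ∈ insert 0 (insert (2 * n) (cutsBelow (2 * n) x y)) ∧
        F (i + 1) ∈ insert 0 (insert (2 * n) (cutsBelow (2 * n) x y)) := by
  set K := cutsBelow (2 * n) x y with hKdef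
  set s := K.card with hs
  set u := K.orderEmbOfFin rfl with hu
  have hK : ∀ v ∈ K, 0 < v ∧ v < 2 * n := fun v hv => by
    rw [hKdef, cutsBelow, Finset.mem_filter] at hv
    exact ⟨pos_of_mem_cutSet hv.1, hv.2⟩
  have huK : ∀ i, u i ∈ K := fun i => Finset.orderEmbOfFin_mem K rfl i
  set F : ℕ → ℕ := fun i => if i = 0 then 0 else if hi : i - 1 < s then u ⟨i - 1, hi⟩ else 2 * n
    with hF
  have F0 : F 0 = 0 := rfl
  have F1 : ∀ i (hi : i < s), F (i + 1) = u ⟨i, hi⟩ := fun i hi => by simp [hF, hi]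
  have F2 : ∀ i, s ≤ i → F (i + 1) = 2 * n := fun i hi => by simp [hF, hi]
  have hmem : ∀ i, F i ∈ insert 0 (insert (2 * n) K) := by
    intro i
    cases i with
    | zero => simp [F0]
    | succ i =>
      rcases Nat.lt_or_ge i s with hi | hi
      · rw [F1 i hi]; simp [huK]
      · rw [F2 i hi]; simp
  have hlt : ∀ i ≤ s, F i < F (i + 1) := by
    intro i hi
    cases i with
    | zero =>
      rw [F0]
      rcases Nat.lt_or_ge 0 s with h1 | h1
      · rw [F1 0 h1]; exact (hK _ (huK _)).1
      · rw [F2 0 h1]; omega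
    | succ i =>
      rw [F1 i hi]
      rcases Nat.lt_or_ge (i + 1) s with h1 | h1
      · rw [F1 _ h1]
        exact u.strictMono (by simp [Fin.lt_def])
      · rw [F2 _ h1]; exact (hK _ (huK _)).2
  have hmono : Monotone F := by
    refine monotone_nat_of_le_succ fun i => ?_
    rcases Nat.lt_or_ge s i with hi | hi
    · rw [F2 i hi.le]
      obtain ⟨j, rfl⟩ : ∃ j, i = j + 1 := ⟨i - 1, by omega⟩
      rw [F2 j (by omega)]
    · exact (hlt i hi).le
  have hts : t ≤ s + 1 := hc.1
  have hlab : minorCol n t bd x y =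
      fun p => min ((Finset.range s).filter fun j => bd (F (j + 1)) ≤ p).card (t - 1) := by
    funext p
    rw [minorCol, ← hKdef]
    congr 1
    symm
    refine Finset.card_bij (fun j _ => F (j + 1)) ?_ ?_ ?_
    · intro j hj
      rw [Finset.mem_filter, Finset.mem_range] at hj
      rw [Finset.mem_filter]
      exact ⟨by rw [F1 j hj.1]; exact huK _, hj.2⟩
    · intro i hi j hj hij
      rw [Finset.mem_filter, Finset.mem_range] at hi hj
      rw [F1 i hi.1, F1 j hj.1] at hij
      simpa using u.injective hij
    · intro v hv
      rw [Finset.mem_filter] at hv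
      have : v ∈ Set.range u := by rw [hu, Finset.range_orderEmbOfFin]; exact hv.1
      obtain ⟨⟨i, hi⟩, rfl⟩ := this
      refine ⟨i, ?_, F1 i hi⟩
      rw [Finset.mem_filter, Finset.mem_range, F1 i hi]
      exact ⟨hi, hv.2⟩
  refine ⟨F, ?_, fun i hi => ⟨hlt i (by omega), hmem i, hmem (i + 1)⟩⟩
  rw [hlab]
  refine labelBlocks_min_card (g := fun i => bd (F i)) (h.monotone.comp hmono) ht
    hts (fun i hi => ?_) fun i => h.bd_le _
  exact (mixPred_mixed c hk).lt (hab _ (hmem i) _ (hmem (i + 1)) (hlt i (by omega)))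

namespace CodesTypes

variable {L : FirstOrder.Language} {α : Type*} [LinearOrder α] [L.Structure α] {n : ℕ}
  {pos : α → ℕ} {c : ℕ → ℕ → ℕ}

theorem classes_convex (h : CodesTypes L n pos c) {t : ℕ} {lab E : ℕ → ℕ}
    (hl : LabelBlocks n t lab E) : IsConvexPartition (Setoid.ker fun a => lab (pos a)).classes ∧
      (Setoid.ker fun a => lab (pos a)).classes.ncard = t := by
  refine ⟨⟨Setoid.isPartition_classes _, ?_⟩, ?_⟩
  · rintro _ ⟨a, rfl⟩
    refine ⟨fun x hx y hy z hz => ?_⟩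
    have h1 := hl.mono (h.strictMono.monotone hz.1)
    have h2 := hl.mono (h.strictMono.monotone hz.2)
    have hx' : lab (pos x) = lab (pos a) := hx
    have hy' : lab (pos y) = lab (pos a) := hy
    show lab (pos z) = lab (pos a)
    omega
  · have : (Setoid.ker fun a => lab (pos a)).classes =
        (fun i => {x | lab (pos x) = i}) '' (Finset.range t : Set ℕ) := by
      ext X
      constructor
      · rintro ⟨a, rfl⟩
        exact ⟨lab (pos a), by simpa using hl.lt _, rfl⟩
      · rintro ⟨i, hi, rfl⟩
        have hi' : i < t := by simpa using hi
        have h1 := hl.block_lt i hi'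
        obtain ⟨a, ha⟩ := h.surj (E i) (h1.trans_le (hl.le i hi'))
        exact ⟨a, by rw [← hl.label i hi' (pos a) (by omega) (by omega)]; rfl⟩
    rw [this, Set.InjOn.ncard_image, Set.ncard_coe_finset, Finset.card_range]
    intro i hi j hj hij
    have hi' : i < t := by simpa using hi
    have h1 := hl.block_lt i hi'
    obtain ⟨a, ha⟩ := h.surj (E i) (h1.trans_le (hl.le i hi'))
    have h2 := hl.label i hi' (pos a) (by omega) (by omega)
    have : a ∈ {x | lab (pos x) = j} := by
      rw [← show {x | lab (pos x) = i} = {x | lab (pos x) = j} from hij]; exact h2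
    exact h2.symm.trans this

/-- Rows that differ on `[p, q)` still differ on the larger set `Y`, so enlarging the block cannot
lower the counts. Distinct columns are counted as rows of the transposed block and carried back by
`CodesTypes.swap`. -/
theorem le_numRows (h : CodesTypes L n pos c) {k a b p q : ℕ} (hb : b ≤ n) (hq : q ≤ n)
    {X Y : Set α} (hX : ∀ x, a ≤ pos x → pos x < b → x ∈ X)
    (hY : ∀ y, p ≤ pos y → pos y < q → y ∈ Y) (hk : Mixed c k a b p q) :
    k ≤ numRows (adjacencyMatrix L α) X Y ∨ k ≤ numCols (adjacencyMatrix L α) X Y := by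
  classical
  have := h.finite
  rcases Nat.eq_zero_or_pos k with rfl | hk0
  · exact Or.inl (Nat.zero_le _)
  have key : ∀ a b p q, rowCount c a b p q = (rowOn c p q '' (Set.Ico a b)).ncard := by
    intro a b p q
    rw [rowCount, ← Set.ncard_coe_finset, Finset.coe_image, Finset.coe_Ico]
  have hne : 0 < n := by
    by_contra hn
    have hb0 : b = 0 := by omega
    have hq0 : q = 0 := by omega
    subst hb0 hq0
    rcases hk with hk | hk <;> · rw [key] at hk; simp at hk; omega
  have : Nonempty α := ⟨(h.surj 0 hne).choose⟩
  obtain ⟨σ, hσ⟩ : ∃ σ : ℕ → α, ∀ p < n, pos (σ p) = p :=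
    ⟨fun p => if hp : p < n then (h.surj p hp).choose else Classical.arbitrary α, fun p hp => by
      simp only [dif_pos hp]; exact (h.surj p hp).choose_spec⟩
  rcases hk with hk | hk
  · left
    refine hk.trans ?_
    rw [key]
    refine ncard_image_le_of_factor σ X.toFinite (fun i hi => ?_) fun i hi j hj hij => ?_
    · have hi := Set.mem_Ico.1 hi
      exact hX _ (by rw [hσ i (by omega)]; omega) (by rw [hσ i (by omega)]; omega)
    · have hi := Set.mem_Ico.1 hi
      have hj := Set.mem_Ico.1 hj
      rw [rowOn_eq_iff]
      intro y h1 h2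
      have := congrFun hij ⟨σ y, hY _ (by rw [hσ y (by omega)]; omega)
        (by rw [hσ y (by omega)]; omega)⟩
      have := (h.eq_iff _ _ _ _).2 this
      rwa [hσ i (by omega), hσ j (by omega), hσ y (by omega)] at this
  · right
    refine hk.trans ?_
    rw [key]
    refine ncard_image_le_of_factor σ Y.toFinite (fun i hi => ?_) fun i hi j hj hij => ?_
    · have hi := Set.mem_Ico.1 hi
      exact hY _ (by rw [hσ i (by omega)]; omega) (by rw [hσ i (by omega)]; omega)
    · have hi := Set.mem_Ico.1 hi
      have hj := Set.mem_Ico.1 hj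
      rw [rowOn_eq_iff]
      intro y h1 h2
      have := congrFun hij ⟨σ y, hX _ (by rw [hσ y (by omega)]; omega)
        (by rw [hσ y (by omega)]; omega)⟩
      have := h.swap _ _ _ _ ((h.eq_iff _ _ _ _).2 this)
      rwa [hσ i (by omega), hσ j (by omega), hσ y (by omega)] at this

/-- The search works with the enlarged parameter `k'`, so its minors are more than sufficient for
`k`. -/
theorem isMixedMinor (h : CodesTypes L n pos c) (hn : 0 < n) {k k' t : ℕ} (hk : 2 ≤ k')
    (hkk : k ≤ k') (ht : 1 ≤ t) {elem : ℕ → ℕ} {B : ℕ → ℕ → ℕ}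
    (hB : MinorOutput c n k' t elem B) :
    IsMixedMinor (adjacencyMatrix L α) k t (Setoid.ker fun a => B 0 (elem (pos a))).classes
      (Setoid.ker fun a => B 1 (elem (pos a))).classes := by
  obtain ⟨m, bd, x, y, hd, hc, hlab⟩ := hB
  obtain ⟨E, hE, hE'⟩ := minorRow_labelBlocks hd hk hn ht hc
  obtain ⟨F, hF, hF'⟩ := minorCol_labelBlocks hd hk hn ht hc (hE' 0 ht)
  have e0 : (fun a => B 0 (elem (pos a))) = fun a => minorRow c n k' t bd x y (pos a) :=
    funext fun a => (hlab _ (h.lt a)).1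
  have e1 : (fun a => B 1 (elem (pos a))) = fun a => minorCol n t bd x y (pos a) :=
    funext fun a => (hlab _ (h.lt a)).2
  rw [e0, e1]
  refine ⟨(h.classes_convex hE).1, (h.classes_convex hF).1, (h.classes_convex hE).2,
    (h.classes_convex hF).2, ?_⟩
  rintro _ ⟨a, rfl⟩ _ ⟨b, rfl⟩
  have hi := hE.lt (pos a)
  have hj := hF.lt (pos b)
  have hmix := hE' _ hi _ (hF' _ hj).2.1 _ (hF' _ hj).2.2 (hF' _ hj).1
  exact (h.le_numRows (hE.le _ hi) (hF.le _ hj) (fun z h1 h2 => hE.label _ hi _ h1 h2)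
    (fun z h1 h2 => hF.label _ hj _ h1 h2) hmix).imp hkk.trans hkk.trans

end CodesTypes

/-! ### The algorithm -/

section Input

open FirstOrder FirstOrder.Language FirstOrder.Language.Structure

variable {L : Language} {m : ℕ} (e : (Σ l, L.Relations l) ≃ Fin m) {α : Type*} [L.Structure α]
  {n : ℕ} (ν : α ≃ Fin n) (k t : ℕ)

theorem ramInput_arr_le_one (j i : ℕ) : (ramInput e ν k t).arr j i ≤ 1 := by
  simp only [ramInput]
  split_ifs <;> omega

theorem ramInput_arr_of_le {j : ℕ} (hj : m ≤ j) (i : ℕ) : (ramInput e ν k t).arr j i = 0 := by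
  simp only [ramInput]
  rw [if_neg]
  rintro ⟨R, x, h, -⟩
  have := (e R).2
  omega

theorem ramInput_arr_ne_zero (R : Σ l, L.Relations l) (x : Fin R.1 → α) :
    (ramInput e ν k t).arr (e R) (finFunctionFinEquiv (ν ∘ x) : ℕ) ≠ 0 ↔ RelMap R.2 x := by
  simp only [ramInput]
  split_ifs with h
  · refine iff_of_true one_ne_zero ?_
    obtain ⟨R', x', h1, h2, h3⟩ := h
    obtain rfl : R' = R := e.injective (Fin.ext h1)
    have := finFunctionFinEquiv.injective (Fin.ext h2)
    rwa [← ν.injective.comp_left this]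
  · exact iff_of_false (by simp) fun hx => h ⟨R, x, rfl, rfl, hx⟩

variable {ν} in
theorem finFunctionFinEquiv_eq_tableAddress {l : ℕ} (hl : l ≤ 2) {x : Fin l → α} {u w : α}
    (hx : ∀ i : Fin l, x i = if (i : ℕ) = 0 then u else w) :
    (finFunctionFinEquiv (ν ∘ x) : ℕ) = tableAddress l n (ν u) (ν w) := by
  rw [finFunctionFinEquiv_apply]
  interval_cases l
  · simp [tableAddress]
  · simp [tableAddress, hx]
  · simp [tableAddress, Fin.sum_univ_two, hx, mul_comm]

/-- The truth value of relation number `j` at a pair of elements. -/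
theorem ramInput_arr_tableAddress (R : Σ l, L.Relations l) (hR : R.1 ≤ 2) {x : Fin R.1 → α}
    {u w : α} (hx : ∀ i : Fin R.1, x i = if (i : ℕ) = 0 then u else w) :
    (ramInput e ν k t).arr (e R) (tableAddress R.1 n (ν u) (ν w)) ≠ 0 ↔ RelMap R.2 x := by
  rw [← finFunctionFinEquiv_eq_tableAddress hR hx, ramInput_arr_ne_zero]

/-- The arity of the relation symbol with number `j`. -/
def arityOf (j : ℕ) : ℕ := if h : j < m then (e.symm ⟨j, h⟩).1 else 0

theorem arityOf_apply (R : Σ l, L.Relations l) : arityOf e (e R) = R.1 := by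
  simp [arityOf]

/-- With at most two argument places, a choice of variables for a symbol is determined by a pair
`(i, i')`, so the type is read off the truth tables at the four pairs formed from the two elements.
-/
theorem atp_eq_iff (hbin : ∀ R : Σ l, L.Relations l, R.1 ≤ 2) {a b a' b' : α} :
    atp L a b = atp L a' b' ↔ ∀ j < m, ∀ i i' : Fin 2,
      (ramInput e ν k t).arr j (tableAddress (arityOf e j) n (ν (![a, b] i)) (ν (![a, b] i'))) =
      (ramInput e ν k t).arr j
        (tableAddress (arityOf e j) n (ν (![a', b'] i)) (ν (![a', b'] i'))) := by
  have h01 : ∀ x y : ℕ, x ≤ 1 → y ≤ 1 → (x = y ↔ (x ≠ 0 ↔ y ≠ 0)) := by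
    intro x y hx hy
    omega
  constructor
  · intro h j hj i i'
    obtain ⟨R, hR⟩ : ∃ R, e R = ⟨j, hj⟩ := e.surjective _
    obtain rfl : j = e R := by rw [hR]
    rw [arityOf_apply, h01 _ _ (ramInput_arr_le_one ..) (ramInput_arr_le_one ..)]
    set s : Fin R.1 → Fin 2 := fun z => if (z : ℕ) = 0 then i else i' with hs
    rw [ramInput_arr_tableAddress e ν k t R (hbin R) (x := ![a, b] ∘ s)
        (fun z => by simp only [Function.comp, hs]; split_ifs <;> rfl),
      ramInput_arr_tableAddress e ν k t R (hbin R) (x := ![a', b'] ∘ s)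
        (fun z => by simp only [Function.comp, hs]; split_ifs <;> rfl)]
    exact iff_of_eq (congrFun (congrFun h R) s)
  · intro h
    funext R s
    obtain ⟨i, i', hs⟩ : ∃ i i' : Fin 2, ∀ z : Fin R.1, s z = if (z : ℕ) = 0 then i else i' := by
      refine ⟨if hz : 0 < R.1 then s ⟨0, hz⟩ else 0, if hz : 1 < R.1 then s ⟨1, hz⟩ else 0,
        fun z => ?_⟩
      have h1 := z.2
      have h2 := hbin R
      split_ifs with h3 h4 h4
      · exact congrArg s (Fin.ext h3)
      · omega
      · exact congrArg s (Fin.ext (by simp only; omega))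
      · omega
    have := h (e R) (e R).2 i i'
    rw [arityOf_apply, h01 _ _ (ramInput_arr_le_one ..) (ramInput_arr_le_one ..),
      ramInput_arr_tableAddress e ν k t R (hbin R) (x := ![a, b] ∘ s)
        (fun z => by simp only [Function.comp, hs]; split_ifs <;> rfl),
      ramInput_arr_tableAddress e ν k t R (hbin R) (x := ![a', b'] ∘ s)
        (fun z => by simp only [Function.comp, hs]; split_ifs <;> rfl)] at this
    exact propext this

theorem ramInput_le [L.IsOrdered] [LinearOrder α] [L.OrderedStructure α] (a b : α) :
    (ramInput e ν k t).arr (e ⟨2, leSymb⟩) ((ν a : ℕ) + n * ν b) ≠ 0 ↔ a ≤ b := by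
  have := ramInput_arr_tableAddress e ν k t ⟨2, leSymb⟩ le_rfl (x := ![a, b]) (u := a) (w := b)
    (by intro i; fin_cases i <;> rfl)
  simp only [tableAddress] at this
  exact this.trans (relMap_leSymb ![a, b])

end Input

/-- The parameters are stored in arrays and the registers `0, 1, 2` are set to `2 * n + 1, 0, 1`. -/
def prologue (o W : ℕ) : RamProg :=
  .seq (.const 3 0) (.seq (.write o 3 0) (.seq (.const 4 W) (.seq (.add 4 4 1)
    (.seq (.write (o + 1) 3 4) (.seq (.write (o + 2) 3 2) (.seq (.const 2 1)
      (.seq (.add 0 0 0) (.seq (.add 0 0 2) (.const 1 0)))))))))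

theorem runs_prologue (o W : ℕ) (s : RamState) : ∃ s', (prologue o W).Runs s 10 s' ∧
    s'.Ready (2 * s.reg 0 + 1) ∧ s'.arr = setCell (setCell (setCell s.arr o 0 (s.reg 0)) (o + 1) 0
      (W + s.reg 1)) (o + 2) 0 (s.reg 2) := by
  refine ⟨_, .seq (.const _ _ _) (.seq (.write _ _ _ _) (.seq (.const _ _ _) (.seq (.add _ _ _ _)
    (.seq (.write _ _ _ _) (.seq (.write _ _ _ _) (.seq (.const _ _ _)
      (.seq (.add _ _ _ _) (.seq (.add _ _ _ _) (.const _ _ _))))))))), ⟨?_, ?_, ?_⟩, ?_⟩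
  · simp [RamState.setReg, RamState.setArr, two_mul]
  · simp [RamState.setReg, RamState.setArr]
  · simp [RamState.setReg, RamState.setArr]
  · simp [RamState.setReg, RamState.setArr, setCell]

/-- The algorithm for a signature with `m` symbols of arities `ar`, where the order has
number `r`. -/
def contractionProgram (ar : ℕ → ℕ) (m r : ℕ) : RamProg :=
  .seq (prologue (m + 2) (16 ^ m))
    (.seq (RamCmd.compile (.seq (RamCmd.setup (m + 2) ar m r) (.loop (RamCmd.round (m + 2)))) [] 3)
      (.seq (.const 3 0) (.read 0 (m + 2 + 3) 3)))

/-- A bound on the running time of the algorithm. -/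
noncomputable def contractionTime (ar : ℕ → ℕ) (m r : ℕ) : Polynomial ℕ :=
  (RamCmd.cost (.seq (RamCmd.setup (m + 2) ar m r) (.loop (RamCmd.round (m + 2))))).comp
    (2 * Polynomial.X + 1) + 12

theorem runs_contractionProgram (ar : ℕ → ℕ) (m r : ℕ) (s : RamState) : ∃ T s',
    (contractionProgram ar m r).Runs s T s' ∧ T ≤ (contractionTime ar m r).eval (s.reg 0) ∧
      s'.arr = RamCmd.exec (2 * s.reg 0 + 1)
        (.seq (RamCmd.setup (m + 2) ar m r) (.loop (RamCmd.round (m + 2)))) []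
        (setCell (setCell (setCell s.arr (m + 2) 0 (s.reg 0)) (m + 2 + 1) 0
          (16 ^ m + s.reg 1)) (m + 2 + 2) 0 (s.reg 2)) ∧
      s'.reg 0 = s'.arr (m + 2 + 3) 0 := by
  obtain ⟨s₁, h1, h2, h3⟩ := runs_prologue (m + 2) (16 ^ m) s
  obtain ⟨T, s₂, g1, g2, g3, -⟩ := RamCmd.compile_spec _
    (.seq (RamCmd.setup (m + 2) ar m r) (.loop (RamCmd.round (m + 2)))) [] [] 3 s₁ h2 le_rfl
    (by simp) rfl
  refine ⟨_, _, .seq h1 (.seq g1 (.seq (.const _ _ _) (.read _ _ _ _))), ?_, ?_, ?_⟩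
  · simp only [contractionTime, Polynomial.eval_add, Polynomial.eval_comp, Polynomial.eval_mul,
      Polynomial.eval_X, Polynomial.eval_ofNat, Polynomial.eval_one]
    omega
  · rw [RamState.setReg_arr, RamState.setReg_arr, g3, h3]
  · simp [RamState.setReg]

/-- The number `d` equals `2 ^ (10 * t + 8)`, and the exponent of `2` on the left is at most `(4 * m
+ k + 2) * (4 * d) ≤ 2 ^ (4 * m + k + 10 * t + 12)`. Since `1`, `k` and `t` are at most `k * t`, the
coefficients `1 + 10 + 12` add up to `23`. -/
theorem redDegree_bound {k t m : ℕ} (hk : 1 ≤ k) (ht : 1 ≤ t) :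
    (8 * (2 ^ (2 * t + 1)) ^ 5 + 1) * (2 * (16 ^ m + k) ^ (2 * (8 * (2 ^ (2 * t + 1)) ^ 5) + 1)) ≤
      2 ^ 2 ^ ((4 * m + 23) * (k * t)) := by
  have hd : 8 * (2 ^ (2 * t + 1)) ^ 5 = 2 ^ (10 * t + 8) := by
    rw [← pow_mul, show (8 : ℕ) = 2 ^ 3 from rfl, ← pow_add]; congr 1; ring
  rw [hd]
  set d := 2 ^ (10 * t + 8) with hd'
  have h1 : d + 1 ≤ 2 ^ d := Nat.lt_two_pow_self
  have h2 : 16 ^ m + k ≤ 2 ^ (4 * m + k + 1) := by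
    have e1 : 16 ^ m ≤ 2 ^ (4 * m + k) := by
      rw [show (16 : ℕ) = 2 ^ 4 from rfl, ← pow_mul]
      exact Nat.pow_le_pow_right (by norm_num) (by omega)
    have e2 : k ≤ 2 ^ (4 * m + k) := Nat.lt_two_pow_self.le.trans
      (Nat.pow_le_pow_right (by norm_num) (by omega))
    rw [pow_succ]
    omega
  have h3 : (d + 1) * (2 * (16 ^ m + k) ^ (2 * d + 1)) ≤
      2 ^ (d + (1 + (4 * m + k + 1) * (2 * d + 1))) := by
    rw [pow_add 2 d, pow_add 2 1, pow_one, pow_mul]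
    gcongr
  refine h3.trans (Nat.pow_le_pow_right (by norm_num) ?_)
  have h4 : d + (1 + (4 * m + k + 1) * (2 * d + 1)) ≤ (4 * m + k + 2) * (4 * d) := by
    have hd1 : 1 ≤ d := Nat.one_le_two_pow
    nlinarith [Nat.zero_le (4 * m + k)]
  have h5 : 4 * m + k + 2 ≤ 2 ^ (4 * m + k + 2) := Nat.lt_two_pow_self.le
  have h6 : 4 * d = 2 ^ (10 * t + 10) := by
    rw [hd', show (4 : ℕ) = 2 ^ 2 from rfl, ← pow_add]; congr 1; ring
  refine h4.trans ((Nat.mul_le_mul_right _ h5).trans ?_)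
  rw [h6, ← pow_add]
  refine Nat.pow_le_pow_right (by norm_num) ?_
  have h7 : k ≤ k * t := Nat.le_mul_of_pos_right _ ht
  have h8 : t ≤ k * t := Nat.le_mul_of_pos_left _ hk
  have h9 : m ≤ m * (k * t) := Nat.le_mul_of_pos_right _ (Nat.mul_pos hk ht)
  have h10 : 1 ≤ k * t := Nat.mul_pos hk ht
  rw [add_mul, mul_assoc]
  omega

theorem mainTheorem10
    -- a finite relational signature with symbols of arity at most two, including `≤`
    (L : FirstOrder.Language) [L.IsRelational] [L.IsOrdered]
    (hbin : ∀ l, 2 < l → IsEmpty (L.Relations l))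
    (m : ℕ) (e : (Σ l, L.Relations l) ≃ Fin m) :
    ∃ (prog : RamProg) (time : Polynomial ℕ) (c : ℕ),
      ∀ (α : Type*) [LinearOrder α] [L.Structure α] [L.OrderedStructure α]
        (n : ℕ) (ν : α ≃ Fin n) (k t : ℕ), 1 ≤ n → 1 ≤ k → 1 ≤ t →
        ∃ (T : ℕ) (s : RamState),
          prog.Runs (ramInput e ν k t) T s ∧ T ≤ time.eval n ∧
          ((s.reg 0 = 0 ∧ IsContractionSequence n (outSequence ν s) ∧
              ∀ i < n, RedDegreeLE L (outSequence ν s i) (2 ^ 2 ^ (c * (k * t)))) ∨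
            (s.reg 0 = 1 ∧
              IsMixedMinor (adjacencyMatrix L α) k t (outRows ν s) (outCols ν s))) := by
  classical
  have hbin' : ∀ R : Σ l, L.Relations l, R.1 ≤ 2 := fun R => by
    by_contra h
    exact (hbin R.1 (by omega)).false R.2
  set r : ℕ := ((e ⟨2, FirstOrder.Language.leSymb⟩ : Fin m) : ℕ) with hr
  refine ⟨contractionProgram (arityOf e) m r, contractionTime (arityOf e) m r, 4 * m + 23, ?_⟩
  intro α _ _ _ n ν k t hn hk ht
  obtain ⟨T, s, hrun, hT, harr, hreg⟩ := runs_contractionProgram (arityOf e) m r (ramInput e ν k t)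
  have hr0 : (ramInput e ν k t).reg 0 = n := rfl
  have hr1 : (ramInput e ν k t).reg 1 = k := rfl
  have hr2 : (ramInput e ν k t).reg 2 = t := rfl
  rw [hr0] at hT
  rw [hr0, hr1, hr2, RamCmd.exec] at harr
  refine ⟨T, s, hrun, hT, ?_⟩
  set I := (ramInput e ν k t).arr with hI
  generalize hA : setCell (setCell (setCell I _ _ _) _ _ _) _ _ _ = A at harr
  have hAI : ∀ j < m, A j = I j := fun j hj => by
    rw [← hA, setCell_of_ne (by omega), setCell_of_ne (by omega), setCell_of_ne (by omega)]
  let fα : Fintype α := Fintype.ofEquiv _ ν.symm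
  have hcard : Fintype.card α = n := by rw [Fintype.card_congr ν, Fintype.card_fin]
  let σ : Fin n ≃o α := Fintype.orderIsoFinOfCardEq α hcard
  set pos : α → ℕ := fun a => (σ.symm a : ℕ) with hpos
  set elem : ℕ → ℕ := fun p => if h : p < n then (ν (σ ⟨p, h⟩) : ℕ) else 0 with helem
  have elem_pos : ∀ a, elem (pos a) = ν a := fun a => by
    simp [helem, hpos]
  have pos_lt : ∀ a, pos a < n := fun a => (σ.symm a).2
  have pos_surj : ∀ p < n, ∃ a, pos a = p := fun p hp => ⟨σ ⟨p, hp⟩, by simp [hpos]⟩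
  have pos_mono : StrictMono pos := fun a b hab => σ.symm.strictMono hab
  have elem_lt : ∀ p < n, elem p < n := fun p hp => by
    obtain ⟨a, rfl⟩ := pos_surj p hp
    rw [elem_pos]; exact (ν a).2
  have elem_surj : ∀ u < n, ∃ p < n, elem p = u := fun u hu =>
    ⟨pos (ν.symm ⟨u, hu⟩), pos_lt _, by rw [elem_pos]; simp⟩
  have elem_inj : ∀ p < n, ∀ q < n, elem p = elem q → p = q := by
    intro p hp q hq h
    obtain ⟨a, rfl⟩ := pos_surj p hp
    obtain ⟨b, rfl⟩ := pos_surj q hq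
    rw [elem_pos, elem_pos] at h
    rw [ν.injective (Fin.ext h)]
  have hle : ∀ a b : α, I r ((ν a : ℕ) + n * ν b) ≠ 0 ↔ a ≤ b := ramInput_le e ν k t
  -- The numbering `ν` is arbitrary, so positions must be recovered from the truth table of the
  -- order: the position of an element is the number of strictly smaller ones.
  have hrank : ∀ p < n, tableRank (A r) n (elem p) = p := by
    intro p hp
    rw [hAI r (e _).2, tableRank]
    have : (Finset.range n).filter (fun w => I r (w + n * elem p) ≠ 0 ∧ I r (elem p + n * w) = 0) =
        (Finset.range p).image elem := by
      ext w
      simp only [Finset.mem_filter, Finset.mem_range, Finset.mem_image]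
      obtain ⟨a, rfl⟩ := pos_surj p hp
      have key : ∀ b : α, (I r ((ν b : ℕ) + n * elem (pos a)) ≠ 0 ∧
          I r (elem (pos a) + n * (ν b : ℕ)) = 0) ↔ pos b < pos a := by
        intro b
        rw [elem_pos, hle, ← not_ne_iff, hle, not_le, pos_mono.lt_iff_lt]
        exact and_iff_right_of_imp le_of_lt
      constructor
      · rintro ⟨hw, h⟩
        have := (key (ν.symm ⟨w, hw⟩)).1 (by simpa using h)
        exact ⟨_, this, by rw [elem_pos]; simp⟩
      · rintro ⟨q, hq, rfl⟩
        obtain ⟨b, rfl⟩ := pos_surj q (hq.trans hp)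
        rw [elem_pos b]
        exact ⟨(ν b).2, (key b).2 hq⟩
    rw [this, Finset.card_image_of_injOn, Finset.card_range]
    intro q hq q' hq' h
    simp only [Finset.coe_range, Set.mem_Iio] at hq hq'
    exact elem_inj q (by omega) q' (by omega) h
  set β : ℕ → ℕ → ℕ → ℕ := fun j z z' => I j (tableAddress (arityOf e j) n (elem z) (elem z'))
    with hβ
  have hβ1 : ∀ j z z', β j z z' ≤ 1 := fun j z z' => ramInput_arr_le_one e ν k t _ _
  have hcodes : CodesTypes L n pos fun p q => pairCode β p q m := by
    refine ⟨pos_mono, pos_lt, pos_surj, fun a b a' b' => ?_, fun x y x' y' h => pairCode_swap hβ1 h⟩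
    rw [atp_eq_iff e ν k t hbin', pairCode_eq_iff hβ1]
    refine forall₂_congr fun j hj => ?_
    simp only [hβ, elem_pos, Fin.forall_fin_two, Matrix.cons_val_zero, Matrix.cons_val_one,
      and_assoc]
    rfl
  have hW : 1 ≤ 16 ^ m := Nat.one_le_pow _ _ (by norm_num)
  -- The bound on distinct rows is `16 ^ m + k`, so that it exceeds the number of codes even for
  -- small `k`, while `d` is exactly the bound supplied by the density theorem.
  have hstate := RamCmd.exec_setup (o := m + 2) (ar := arityOf e) (r := r) (A := A) (n := n)
    (k := 16 ^ m + k) (t := t) (d := 8 * (2 ^ (2 * t + 1)) ^ 5)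
    (K := 2 ^ 2 ^ ((4 * m + 23) * (k * t))) (v := []) (elem := elem) (β := β) (e _).2 rfl hn
    (by omega) hβ1
    (by rw [← hA, setCell_of_ne (by omega), setCell_of_ne (by omega), setCell_apply, if_pos rfl])
    (by rw [← hA, setCell_of_ne (by omega), setCell_apply, if_pos rfl])
    (by rw [← hA, setCell_apply, if_pos rfl])
    (by rw [← hA, setCell_of_ne (by omega), setCell_of_ne (by omega), setCell_of_ne (by omega)]
        exact ramInput_arr_of_le e ν k t (by omega) 0)
    elem_lt hrank elem_surj (fun j hj z _ z' _ => by rw [hAI j hj]) rfl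
  rcases RamCmd.exec_rounds (by omega) (by omega) ht hn hcodes.swap elem_lt elem_inj le_rfl
    (redDegree_bound hk ht) hstate harr.symm with ⟨hflag, lab, hout⟩ | ⟨hflag, hout⟩
  · left
    have hseq : outSequence ν s =
        fun i => (Setoid.ker fun a => s.arr 0 (n * i + elem (pos a))).classes := by
      funext i
      simp only [outSequence, readPartition, elem_pos, mul_comm]
    have := hcodes.isContractionSequence hn hout
    rw [hseq]
    exact ⟨hreg.trans hflag, this⟩
  · right
    have := hcodes.isMixedMinor hn (k := k) (by omega) (by omega) ht hout
    simp only [elem_pos] at this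
    refine ⟨hreg.trans hflag, ?_⟩
    simp only [outRows, outCols, readPartition, zero_add]
    exact this
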